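/- **Setting.** Let $p\in[2,\infty)$, let $(\Omega,\mathcal F,\mathbb P)$ be a probability space, let $\mathbb R^d$ carry a scalar product $\langle\cdot,\cdot\rangle$ with norm $\|\cdot\|$, let $U$ be a random variable with values in a measurable space $\mathcal U$, and let $F:\mathbb R^d\times\mathcal U\to\mathbb R^d$ be product-measurable with $F(\theta,U)$ integrable for every $\theta$. Assume that $f(\theta)=\mathbb E[F(\theta,U)]$ has a unique zero $\theta^*$. Let $F_k:\mathbb R^d\times\mathcal U\to\mathbb R^d$, $k\in\mathbb N=\{1,2,\dots\}$, be product-measurable with $F_k(\theta,U)$ integrable for every $\theta$, put $F_0=0$, and let $C_k\in(0,\infty)$ for $k\in\mathbb N$. Assume: * **B.1.** There are $L,L',L'',\lambda\in(0,\infty)$ and $H\in\mathbb R^{d\times d}$ such that for all $\theta$: $\langle\theta-\theta^*,f(\theta)\rangle\le -L\|\theta-\theta^*\|^2$, $\langle\theta-\theta^*,f(\theta)\rangle\le -L'\|f(\theta)\|^2$ and $\|f(\theta)-H(\theta-\theta^*)\|\le L''\|\theta-\theta^*\|^{1+\lambda}$. * **C.1.** There are measurable $\Gamma_1,\Gamma_2:\mathbb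 R^d\to(0,\infty)$, $M\in(1,\infty)$ and $K,\alpha,\beta\in(0,\infty)$ with $\alpha\ge\beta$ such that for all $k\in\mathbb N$ and all $\theta$, with $\Delta_k(\theta)=F_k(\theta,U)-F_{k-1}(\theta,U)$: $\mathbb E[\|\Delta_k(\theta)-\mathbb E[\Delta_k(\theta)]\|^p]^{1/p}\le\Gamma_1(\theta)M^{-k\beta}$, $\|\mathbb E[F_k(\theta,U)-F(\theta,U)]\|\le\Gamma_2(\theta)M^{-k\alpha}$ and $C_k\le KM^k$. * **C.2.** There are $K_1\in(0,\infty)$ and $\beta_1\ge0$, with $\beta_1\le\min(\beta,1/2)$ if $\beta\ne1/2$ and $\beta_1<1/2$ if $\beta=1/2$, such that $\Gamma_1(\theta)\le K_1(1+\|\theta\|)^{\beta_1p}$ and $\Gamma_2(\theta)\le K_1(1+\|\theta\|)^{\alpha p}$ for all $\theta$. **Algorithm.** Given $\theta_0\in\mathbb R^d$ and sequences of positive reals $(\gamma_n)$, $(\varepsilon_n)$, $(\sigma_n)$, $(b_n)$, $n\in\mathbb N$, let $$m_n(\theta)=1\vee\Big\lceil\tfrac1\alpha\log_M\tfrac{\Gamma_2(\theta)}{\varepsilon_n}\Big\rceil,\qquad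 N_{n,k}(\theta)=\big\lceil\kappa_n(\theta)M^{-k(\beta+1/2)}\big\rceil,$$ where $\kappa_n(\theta)=(\Gamma_1(\theta)/\sigma_n)^2M^{m_n(\theta)(1/2-\beta)_+}$ if $\beta\ne1/2$ and $\kappa_n(\theta)=(\Gamma_1(\theta)/\sigma_n)^2m_n(\theta)$ if $\beta=1/2$. With independent copies $U_{n,k,\ell}$ ($n,k,\ell\in\mathbb N$) of $U$ put, for $n\in\mathbb N$, $$Z_n(\theta)=\sum_{k=1}^{m_n(\theta)}\frac1{N_{n,k}(\theta)}\sum_{\ell=1}^{N_{n,k}(\theta)}\big(F_k(\theta,U_{n,k,\ell})-F_{k-1}(\theta,U_{n,k,\ell})\big),\quad \theta_n=\theta_{n-1}+\gamma_nZ_n(\theta_{n-1}),\quad \bar\theta_n=\frac{\sum_{k=1}^nb_k\theta_k}{\sum_{k=1}^nb_k},$$ $$\operatorname{cost}_n=\mathbb E\Big[\sum_{j=1}^n\sum_{k=1}^{m_j(\theta_{j-1})}N_{j,k}(\theta_{j-1})\,C_k\Big].$$ **Theorem (Multilevel Polyak-Ruppert approximation).** Let B.1, C.1 and C.2 hold,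 take $\lambda$ from B.1 and $\Gamma_1,\Gamma_2,M,\alpha,\beta$ from C.1 and C.2, and let $\theta_0\in\mathbb R^d$. Let $q\in[\frac p{1+\lambda},p)$, $\gamma_0,\sigma_0,\varepsilon_0,b_0\in(0,\infty)$, $r_1\in(0,1)$, $r_2\in(-r_1,\infty)$ and $r_3\in[r_2/2,\infty)$ with $$\frac{1+r_2}{r_1+r_2}\le\frac pq,$$ and let $\rho=\frac12(1+r_2)$ and, for all $n\in\mathbb N$, $\gamma_n=\gamma_0n^{-r_1}$, $\varepsilon_n=\varepsilon_0n^{-\rho}$, $\sigma_n^2=\sigma_0^2n^{-r_2}$, $b_n=b_0n^{r_3}$. (In particular, the choice of the parameters does not require knowledge of $L$.) 1. If $q\ge1$, or if $q<1$ and $\frac{1+r_2}{r_1+r_2}\le p$, then there is $\kappa\in(0,\infty)$ such that for all $n\in\mathbb N$ $$\mathbb E\big[\|\bar\theta_n-\theta^*\|^q\big]^{1/q}\le\kappa\,n^{-\rho}.$$ 2. If $\alpha>\beta\wedge\frac12$ and $r_2\ge\frac{\beta\wedge1/2}{\alpha-\beta\wedge1/2}$, then there is $\kappa'\in(0,\infty)$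 such that for all $n\in\mathbb N$ $$\operatorname{cost}_n\le\kappa'\begin{cases}n^{2\rho},&\beta>1/2,\\ n^{2\rho}(\ln(n+1))^2,&\beta=1/2,\\ n^{2\rho\left(1+\frac{1-2\beta}{2\alpha}\right)},&\beta<1/2.\end{cases}$$ -/

import Mathlib

open MeasureTheory ProbabilityTheory
open scoped ENNReal

namespace MultilevelSA

noncomputable section

/-- The function `f(θ) = E[F(θ, U)]` whose zero is sought. -/
def meanField {Ω 𝒰 E : Type*} [MeasurableSpace Ω] [NormedAddCommGroup E] [NormedSpace ℝ E]
    (P : Measure Ω) (U : Ω → 𝒰) (F : E → 𝒰 → E) (θ : E) : E :=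
  ∫ ω, F θ (U ω) ∂P

/-- Assumption on `f` and `θ*`, with exponent `lam`: contraction towards `θ*`, linear growth,
and linearisation at `θ*` by a linear map `H` up to an error of order `1 + lam`. -/
def FieldAssumption {E : Type*} [NormedAddCommGroup E] [InnerProductSpace ℝ E]
    (f : E → E) (θstar : E) (lam : ℝ) : Prop :=
  0 < lam ∧ ∃ L L' L'' : ℝ, 0 < L ∧ 0 < L' ∧ 0 < L'' ∧ ∃ H : E →L[ℝ] E, ∀ θ : E,
    inner ℝ (θ - θstar) (f θ) ≤ -L * ‖θ - θstar‖ ^ 2 ∧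
    inner ℝ (θ - θstar) (f θ) ≤ -L' * ‖f θ‖ ^ 2 ∧
    ‖f θ - H (θ - θstar)‖ ≤ L'' * ‖θ - θstar‖ ^ (1 + lam)

/-- The parameters that specify the multilevel Robbins-Monro algorithm: the functions and constants
of the level assumption, the step-sizes `γ`, the bias-levels `ε` and the noise-levels `σ`
(only the indices `n ≥ 1` of the three sequences are used). -/
structure Params (E : Type*) where
  Γ₁ : E → ℝ
  Γ₂ : E → ℝ
  M : ℝ
  α : ℝ
  β : ℝ
  γ : ℕ → ℝ
  ε : ℕ → ℝ
  σ : ℕ → ℝ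

/-- Assumption on the approximations `Fk k` of `F` (`k ≥ 1`, with `Fk 0` the zero function)
and on the cost bounds `C k`. The `p`-th central moments are `[0, ∞]`-valued. -/
structure LevelAssumption {Ω 𝒰 E : Type*} [MeasurableSpace Ω] [NormedAddCommGroup E]
    [NormedSpace ℝ E] [MeasurableSpace E] (P : Measure Ω) (U : Ω → 𝒰) (p : ℝ)
    (F : E → 𝒰 → E) (Fk : ℕ → E → 𝒰 → E) (C : ℕ → ℝ) (A : Params E) : Prop where
  measurable_Γ₁ : Measurable A.Γ₁
  measurable_Γ₂ : Measurable A.Γ₂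
  Γ₁_pos : ∀ θ, 0 < A.Γ₁ θ
  Γ₂_pos : ∀ θ, 0 < A.Γ₂ θ
  one_lt_M : 1 < A.M
  α_pos : 0 < A.α
  β_pos : 0 < A.β
  β_le_α : A.β ≤ A.α
  moment : ∀ k : ℕ, 1 ≤ k → ∀ θ : E,
    eLpNorm (fun ω => Fk k θ (U ω) - Fk (k - 1) θ (U ω)
        - ∫ ω', (Fk k θ (U ω') - Fk (k - 1) θ (U ω')) ∂P) (ENNReal.ofReal p) P
      ≤ ENNReal.ofReal (A.Γ₁ θ * A.M ^ (-(k : ℝ) * A.β))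
  bias : ∀ k : ℕ, 1 ≤ k → ∀ θ : E,
    ‖∫ ω, (Fk k θ (U ω) - F θ (U ω)) ∂P‖ ≤ A.Γ₂ θ * A.M ^ (-(k : ℝ) * A.α)
  cost : ∃ K : ℝ, 0 < K ∧ ∀ k : ℕ, 1 ≤ k → C k ≤ K * A.M ^ k

/-- Polynomial growth of `Γ₁` and `Γ₂`. -/
def GrowthAssumption {E : Type*} [NormedAddCommGroup E] (p : ℝ) (A : Params E) : Prop :=
  ∃ K₁ β₁ : ℝ, 0 < K₁ ∧ 0 ≤ β₁ ∧
    (A.β ≠ 1 / 2 → β₁ ≤ min A.β (1 / 2)) ∧ (A.β = 1 / 2 → β₁ < 1 / 2) ∧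
    ∀ θ : E, A.Γ₁ θ ≤ K₁ * (1 + ‖θ‖) ^ (β₁ * p) ∧ A.Γ₂ θ ≤ K₁ * (1 + ‖θ‖) ^ (A.α * p)

/-- The maximal level `m_n(θ) = 1 ∨ ⌈α⁻¹ log_M (Γ₂(θ) / ε_n)⌉`. -/
def maxLevel {E : Type*} (A : Params E) (n : ℕ) (θ : E) : ℕ :=
  max 1 ⌈(1 / A.α) * Real.logb A.M (A.Γ₂ θ / A.ε n)⌉₊

/-- The factor `κ_n(θ)` in the number of replications. -/
def kappa {E : Type*} (A : Params E) (n : ℕ) (θ : E) : ℝ :=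
  if A.β = 1 / 2 then (A.Γ₁ θ / A.σ n) ^ 2 * (maxLevel A n θ : ℝ)
  else (A.Γ₁ θ / A.σ n) ^ 2 * A.M ^ ((maxLevel A n θ : ℝ) * max (1 / 2 - A.β) 0)

/-- The number `N_{n,k}(θ) = ⌈κ_n(θ) M^{-k(β+1/2)}⌉` of replications on level `k`. -/
def numIter {E : Type*} (A : Params E) (n k : ℕ) (θ : E) : ℕ :=
  ⌈kappa A n θ * A.M ^ (-(k : ℝ) * (A.β + 1 / 2))⌉₊

/-- The multilevel estimator `Z_n(θ)` of `f(θ)` built from the samples `V n k l`. -/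
def estimator {Ω 𝒰 E : Type*} [NormedAddCommGroup E] [NormedSpace ℝ E]
    (A : Params E) (Fk : ℕ → E → 𝒰 → E) (V : ℕ → ℕ → ℕ → Ω → 𝒰) (n : ℕ) (θ : E) (ω : Ω) : E :=
  ∑ k ∈ Finset.Icc 1 (maxLevel A n θ), (1 / (numIter A n k θ : ℝ)) •
    ∑ l ∈ Finset.Icc 1 (numIter A n k θ), (Fk k θ (V n k l ω) - Fk (k - 1) θ (V n k l ω))

/-- The multilevel Robbins-Monro iterates `θ_n = θ_{n-1} + γ_n Z_n(θ_{n-1})`. -/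
def robbinsMonro {Ω 𝒰 E : Type*} [NormedAddCommGroup E] [NormedSpace ℝ E]
    (A : Params E) (Fk : ℕ → E → 𝒰 → E) (V : ℕ → ℕ → ℕ → Ω → 𝒰) (θ₀ : E) : ℕ → Ω → E
  | 0, _ => θ₀
  | n + 1, ω => robbinsMonro A Fk V θ₀ n ω
      + A.γ (n + 1) • estimator A Fk V (n + 1) (robbinsMonro A Fk V θ₀ n ω) ω

/-- The Polyak-Ruppert average `(∑_{k=1}^n b_k)⁻¹ ∑_{k=1}^n b_k θ_k`. -/
def polyakRuppert {Ω 𝒰 E : Type*} [NormedAddCommGroup E] [NormedSpace ℝ E]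
    (A : Params E) (Fk : ℕ → E → 𝒰 → E) (V : ℕ → ℕ → ℕ → Ω → 𝒰) (θ₀ : E) (b : ℕ → ℝ)
    (n : ℕ) (ω : Ω) : E :=
  (1 / ∑ k ∈ Finset.Icc 1 n, b k) • ∑ k ∈ Finset.Icc 1 n, b k • robbinsMonro A Fk V θ₀ k ω

/-- The mean computational cost
`E[∑_{j=1}^n ∑_{k=1}^{m_j(θ_{j-1})} N_{j,k}(θ_{j-1}) C_k]`, as an element of `[0, ∞]`. -/
def meanCost {Ω 𝒰 E : Type*} [MeasurableSpace Ω] [NormedAddCommGroup E] [NormedSpace ℝ E]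
    (P : Measure Ω) (A : Params E) (Fk : ℕ → E → 𝒰 → E) (C : ℕ → ℝ)
    (V : ℕ → ℕ → ℕ → Ω → 𝒰) (θ₀ : E) (n : ℕ) : ℝ≥0∞ :=
  ∫⁻ ω, ENNReal.ofReal (∑ j ∈ Finset.Icc 1 n,
    ∑ k ∈ Finset.Icc 1 (maxLevel A j (robbinsMonro A Fk V θ₀ (j - 1) ω)),
      (numIter A j k (robbinsMonro A Fk V θ₀ (j - 1) ω) : ℝ) * C k) ∂P

/-- The three-case cost rate. -/
def costRate (α β ρ : ℝ) (n : ℕ) : ℝ :=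
  if 1 / 2 < β then (n : ℝ) ^ (2 * ρ)
  else if β = 1 / 2 then (n : ℝ) ^ (2 * ρ) * Real.log ((n : ℝ) + 1) ^ 2
  else (n : ℝ) ^ (2 * ρ * (1 + (1 - 2 * β) / (2 * α)))

end

end MultilevelSA

/-!
Write `x_n = θ_n - θ*` and decompose the multilevel estimator at `θ_{n-1}` as `f(θ_{n-1})` plus a
bias plus a noise term. Telescoping over the levels and the choice of the maximal level make the
bias at most `ε_n` (`norm_levelMean_sub_le`). Conditionally on the past, the noise is a sum of
independent centered variables, and the numbers of replications are such that its `L^p`-norm is at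
most a multiple of `σ_n`, uniformly in `θ_{n-1}` (`exists_noise_bound`). Hence the algorithm is a
perturbed Robbins-Monro scheme with martingale noise (`PerturbedScheme`,
`exists_perturbedScheme`).

The moment bounds all rest on one inequality, the first order expansion with quadratic error of
`‖·‖ ^ p` for `p ≥ 2` (`exists_norm_add_rpow_le`). It implies `‖Y + N‖_p² ≤ ‖Y‖_p² + K ‖N‖_p²`
whenever `N` is conditionally centered given `Y` (`lpNorm_add_sq_le`), which bounds sums of
independent variables, martingales, and the recursion itself. For the latter, the one-sided
conditions on `f` make `x ↦ x + γ f(x)` a contraction with factor `1 - γ L / 2` for small `γ`, so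
that `‖x_n‖_p²` satisfies a linear recursion whose contraction, due to `r₁ < 1`, dominates any
polynomial decay for every value of `L` (`exists_le_rpow_of_recursion`). This gives
`‖x_n‖_p = O(n ^ (-(r₁ + r₂) / 2))`.

For the averages, the recursion is linearised at `θ*` and solved for `H x_k`:
`H x_k = (x_{k+1} - x_k) / γ_{k+1} - (f(θ_k) - H x_k) - bias - noise`. Summation by parts
turns the first term into terms of lower order; the linearisation error is of order `‖x_k‖ ^ (p / q)`, so its `L^q`-norm is
`O(k ^ (-ρ))` by the rate of `x_k` and the condition on `p / q`; the bias is `O(k ^ (-ρ))`; and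
the noise terms are orthogonal, so that their weighted sum is of the same order. Since `H` is
injective by the contraction property of `f`, this bounds the weighted sum of the `x_k` itself
(`PerturbedScheme.exists_lpNorm_sum_le`).

The cost of step `j` is at most `(1 + ‖θ_{j-1}‖) ^ p` times a deterministic rate: the growth
conditions on `Γ₁` and `Γ₂` are calibrated to this power. As the `p`-th moments of the iterates
are bounded, the mean costs add up to the claimed rate, the condition on `r₂` making the cost of
rounding up the numbers of replications negligible (`exists_sum_stepRate_le`).
-/

namespace MultilevelSA

/-! ### Power inequalities -/

lemma one_sub_rpow_le {x s : ℝ} (hx : 0 ≤ x) (hs : 1 ≤ s) : 1 - x ^ s ≤ s * (1 - x) := by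
  have h := one_add_mul_self_le_rpow_one_add (s := x - 1) (by linarith) hs
  rw [add_sub_cancel] at h
  linarith

lemma rpow_sub_one_le {x s : ℝ} (hx : 0 ≤ x) (hs : 1 ≤ s) :
    x ^ s - 1 ≤ s * x ^ (s - 1) * (x - 1) := by
  rcases hx.eq_or_lt with rfl | hx
  · rw [Real.zero_rpow (by linarith)]
    rcases hs.eq_or_lt with rfl | hs
    · norm_num
    · rw [Real.zero_rpow (by linarith)]; norm_num
  · have h := one_sub_rpow_le (x := x⁻¹) (by positivity) hs
    have h1 : x ^ s * (x⁻¹) ^ s = 1 := by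
      rw [← Real.mul_rpow hx.le (by positivity), mul_inv_cancel₀ hx.ne', Real.one_rpow]
    have h2 : x ^ s = x ^ (s - 1) * x := by
      rw [← Real.rpow_add_one hx.ne']; ring_nf
    have h3 := mul_le_mul_of_nonneg_left h (Real.rpow_nonneg hx.le s)
    have h4 : x ^ s * (s * (1 - x⁻¹)) = s * x ^ (s - 1) * (x - 1) := by
      rw [h2]; field_simp
    rw [h4, mul_sub, h1] at h3
    linarith

/-- A second order Taylor bound for `x ↦ x ^ s` at `1`. -/
lemma rpow_le_taylor {x s : ℝ} (hx : 0 ≤ x) (hx4 : x ≤ 4) (hs : 1 ≤ s) :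
    x ^ s ≤ 1 + s * (x - 1) + s ^ 2 * 4 ^ s * (x - 1) ^ 2 := by
  have h1 := rpow_sub_one_le hx hs
  have h4 : (1 : ℝ) ≤ 4 ^ s := Real.one_le_rpow (by norm_num) (by linarith)
  suffices h : (x ^ (s - 1) - 1) * (x - 1) ≤ s * 4 ^ s * (x - 1) ^ 2 by
    nlinarith [mul_le_mul_of_nonneg_left h (by linarith : 0 ≤ s)]
  rcases le_total x 1 with hx1 | hx1
  · have h2 : 1 - x ^ (s - 1) ≤ s * (1 - x) := by
      refine le_trans ?_ (one_sub_rpow_le hx hs)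
      rcases hx.eq_or_lt with rfl | hx0
      · rw [Real.zero_rpow (by linarith : s ≠ 0)]
        have := Real.rpow_nonneg (le_refl (0 : ℝ)) (s - 1)
        linarith
      · have := Real.rpow_le_rpow_of_exponent_ge hx0 hx1 (by linarith : s - 1 ≤ s)
        linarith
    calc (x ^ (s - 1) - 1) * (x - 1) = (1 - x ^ (s - 1)) * (1 - x) := by ring
      _ ≤ s * (1 - x) * (1 - x) := mul_le_mul_of_nonneg_right h2 (by linarith)
      _ = s * 1 * (x - 1) ^ 2 := by ring
      _ ≤ s * 4 ^ s * (x - 1) ^ 2 := by gcongr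
  · have h2 : x ^ (s - 1) - 1 ≤ s * 4 ^ s * (x - 1) := by
      have h3 : x ^ (s - 1) ≤ x ^ s := Real.rpow_le_rpow_of_exponent_le hx1 (by linarith)
      have h5 : x ^ (s - 1) ≤ 4 ^ s := h3.trans (Real.rpow_le_rpow hx hx4 (by linarith))
      calc x ^ (s - 1) - 1 ≤ x ^ s - 1 := by linarith
        _ ≤ s * x ^ (s - 1) * (x - 1) := h1
        _ ≤ s * 4 ^ s * (x - 1) := by gcongr
    calc (x ^ (s - 1) - 1) * (x - 1) ≤ s * 4 ^ s * (x - 1) * (x - 1) :=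
          mul_le_mul_of_nonneg_right h2 (by linarith)
      _ = s * 4 ^ s * (x - 1) ^ 2 := by ring

lemma sq_rpow {a : ℝ} (ha : 0 ≤ a) (s : ℝ) : (a ^ 2) ^ s = a ^ (2 * s) := by
  rw [← Real.rpow_natCast, ← Real.rpow_mul ha]; norm_num

/-- The function `‖·‖ ^ p`, `p ≥ 2`, on an inner product space has a first order expansion with
quadratic error; this is the source of all martingale moment bounds below. -/
lemma exists_norm_add_rpow_le (E : Type*) [NormedAddCommGroup E] [InnerProductSpace ℝ E]
    {p : ℝ} (hp : 2 ≤ p) :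
    ∃ C : ℝ, 1 ≤ C ∧ ∀ x y : E, ‖x + y‖ ^ p ≤ ‖x‖ ^ p + p * (‖x‖ ^ (p - 2) * inner ℝ x y)
      + C * (‖x‖ ^ (p - 2) * ‖y‖ ^ 2 + ‖y‖ ^ p) := by
  set s : ℝ := p / 2 with hs
  have hs1 : 1 ≤ s := by rw [hs]; linarith
  have hp2 : p = 2 * s := by rw [hs]; ring
  have h4 : (1 : ℝ) ≤ 4 ^ s := Real.one_le_rpow (by norm_num) (by linarith)
  refine ⟨2 ^ p + p + (s + 9 * (s ^ 2 * 4 ^ s)), ?_, fun x y => ?_⟩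
  · have : (0 : ℝ) ≤ 2 ^ p := by positivity
    nlinarith [mul_nonneg (sq_nonneg s) (by linarith : (0 : ℝ) ≤ 4 ^ s)]
  have h2p : (0 : ℝ) ≤ 2 ^ p := by positivity
  have hin := abs_le.1 (abs_real_inner_le_norm x y)
  have hxp : 0 ≤ ‖x‖ ^ (p - 2) := by positivity
  have hyp : 0 ≤ ‖y‖ ^ p := by positivity
  have hD : 0 ≤ s + 9 * (s ^ 2 * 4 ^ s) := by positivity
  rcases le_or_gt ‖x‖ ‖y‖ with hxy | hxy
  · have h1 : ‖x + y‖ ^ p ≤ 2 ^ p * ‖y‖ ^ p := by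
      rw [← Real.mul_rpow (by norm_num) (norm_nonneg _)]
      exact Real.rpow_le_rpow (norm_nonneg _) (by linarith [norm_add_le x y]) (by linarith)
    have h2 : -(‖x‖ ^ (p - 2) * inner ℝ x y) ≤ ‖y‖ ^ p := by
      have e : ‖y‖ ^ p = ‖y‖ ^ (p - 2) * (‖y‖ * ‖y‖) := by
        rcases (norm_nonneg y).eq_or_lt with h | h
        · rw [← h, Real.zero_rpow (by linarith)]; ring
        · rw [← pow_two, ← Real.rpow_natCast ‖y‖ 2, ← Real.rpow_add h]; norm_num
      rw [e, ← mul_neg]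
      have h5 : ‖x‖ ^ (p - 2) ≤ ‖y‖ ^ (p - 2) :=
        Real.rpow_le_rpow (norm_nonneg _) hxy (by linarith)
      calc ‖x‖ ^ (p - 2) * -inner ℝ x y ≤ ‖x‖ ^ (p - 2) * (‖y‖ * ‖y‖) := by
            gcongr
            nlinarith [norm_nonneg x, norm_nonneg y]
        _ ≤ _ := by gcongr
    have h3 : 0 ≤ ‖x‖ ^ (p - 2) * ‖y‖ ^ 2 := by positivity
    have h6 : 0 ≤ ‖x‖ ^ p := by positivity
    nlinarith [mul_nonneg h2p h3, mul_nonneg (by linarith : 0 ≤ p) h3, mul_nonneg hD h3,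
      mul_nonneg hD hyp, mul_le_mul_of_nonneg_left h2 (by linarith : 0 ≤ p)]
  · have hx0 : 0 < ‖x‖ := lt_of_le_of_lt (norm_nonneg _) hxy
    set a : ℝ := ‖x‖ ^ 2 with ha
    have ha0 : 0 < a := by positivity
    set t : ℝ := ‖x + y‖ ^ 2 with ht
    have hta : t - a = 2 * inner ℝ x y + ‖y‖ ^ 2 := by
      rw [ht, ha, norm_add_sq_real]; ring
    have ht4 : t ≤ 4 * a := by
      have : ‖x + y‖ ≤ 2 * ‖x‖ := by linarith [norm_add_le x y]
      rw [ht, ha]; nlinarith [norm_nonneg (x + y)]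
    have hT := rpow_le_taylor (x := t / a) (by positivity) (by rw [div_le_iff₀ ha0]; exact ht4) hs1
    have e1 : ‖x + y‖ ^ p = a ^ s * (t / a) ^ s := by
      rw [← Real.mul_rpow ha0.le (by positivity), mul_div_cancel₀ _ ha0.ne', ht,
        sq_rpow (norm_nonneg _), hp2]
    have e2 : ‖x‖ ^ p = a ^ s := by rw [ha, sq_rpow (norm_nonneg _), hp2]
    have e3 : ‖x‖ ^ (p - 2) = a ^ (s - 1) := by
      rw [ha, sq_rpow (norm_nonneg _), hp2]; ring_nf
    have e4 : a ^ s = a ^ (s - 1) * a := by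
      rw [← Real.rpow_add_one ha0.ne']; ring_nf
    have hq : (t - a) ^ 2 ≤ 9 * (a * ‖y‖ ^ 2) := by
      have : |t - a| ≤ 3 * (‖x‖ * ‖y‖) := by
        rw [hta, abs_le]; constructor <;> nlinarith [norm_nonneg y]
      calc (t - a) ^ 2 = |t - a| ^ 2 := (sq_abs _).symm
        _ ≤ (3 * (‖x‖ * ‖y‖)) ^ 2 := by gcongr
        _ = _ := by rw [ha]; ring
    have hA : 0 ≤ a ^ (s - 1) := by positivity
    have h1 : ‖x + y‖ ^ p ≤ a ^ s + s * (a ^ (s - 1) * (t - a))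
        + 9 * (s ^ 2 * 4 ^ s) * (a ^ (s - 1) * ‖y‖ ^ 2) := by
      rw [e1]
      calc a ^ s * (t / a) ^ s
          ≤ a ^ s * (1 + s * (t / a - 1) + s ^ 2 * 4 ^ s * (t / a - 1) ^ 2) := by gcongr
        _ = a ^ s + s * (a ^ (s - 1) * (t - a))
            + s ^ 2 * 4 ^ s * (a ^ (s - 1) * ((t - a) ^ 2 / a)) := by
              rw [e4]; field_simp
        _ ≤ a ^ s + s * (a ^ (s - 1) * (t - a))
            + s ^ 2 * 4 ^ s * (a ^ (s - 1) * (9 * ‖y‖ ^ 2)) := by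
              gcongr
              rw [div_le_iff₀ ha0]; linarith
        _ = _ := by ring
    have h3 : 0 ≤ a ^ (s - 1) * ‖y‖ ^ 2 := by positivity
    rw [e2, e3]
    rw [hta] at h1
    have e5 : p * (a ^ (s - 1) * inner ℝ x y) = 2 * s * (a ^ (s - 1) * inner ℝ x y) := by
      rw [← hp2]
    linarith [mul_nonneg h2p h3, mul_nonneg (by linarith : 0 ≤ p) h3, mul_nonneg hD hyp,
      mul_nonneg h2p hyp, mul_nonneg (by linarith : 0 ≤ p) hyp]

lemma rpow_add_mul_le {a b C p : ℝ} (ha : 0 ≤ a) (hb : 0 ≤ b) (hC : 1 ≤ C) (hp : 2 ≤ p) :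
    a ^ p + C * (a ^ (p - 2) * b ^ 2 + b ^ p) ≤ (a ^ 2 + 2 * C * b ^ 2) ^ (p / 2) := by
  set s : ℝ := p / 2 with hs
  have hs1 : 1 ≤ s := by rw [hs]; linarith
  have hp2 : p = 2 * s := by rw [hs]; ring
  set B : ℝ := 2 * C * b ^ 2 with hB
  have hB0 : 0 ≤ B := by positivity
  have h1 : a ^ p + B ^ s ≤ (a ^ 2 + B) ^ s := by
    have := Real.add_rpow_le_rpow_add (sq_nonneg a) hB0 hs1
    rwa [sq_rpow ha, ← hp2] at this
  have h2 : a ^ p + s * (a ^ (p - 2) * B) ≤ (a ^ 2 + B) ^ s := by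
    rcases ha.eq_or_lt with rfl | ha0
    · rw [Real.zero_rpow (by linarith)]
      rcases hp.eq_or_lt with rfl | hp'
      · have : s = 1 := by rw [hs]; norm_num
        simp [this]
      · rw [Real.zero_rpow (by linarith)]
        have : 0 ≤ ((0 : ℝ) ^ 2 + B) ^ s := by positivity
        simpa using this
    · have ha2 : 0 < a ^ 2 := by positivity
      have h := one_add_mul_self_le_rpow_one_add (s := B / a ^ 2)
        (le_trans (by norm_num) (by positivity : 0 ≤ B / a ^ 2)) hs1
      have e : (a ^ 2 + B) ^ s = a ^ p * (1 + B / a ^ 2) ^ s := by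
        rw [hp2, ← sq_rpow ha, ← Real.mul_rpow ha2.le (by positivity)]
        congr 1; field_simp
      have e2 : a ^ p = a ^ (p - 2) * a ^ 2 := by
        rw [← Real.rpow_natCast a 2, ← Real.rpow_add ha0]; norm_num
      rw [e]
      calc a ^ p + s * (a ^ (p - 2) * B) = a ^ p * (1 + s * (B / a ^ 2)) := by
            rw [e2]; field_simp
        _ ≤ _ := by gcongr
  have h3 : 2 * C * b ^ p ≤ B ^ s := by
    rw [hB, Real.mul_rpow (by linarith) (sq_nonneg b), sq_rpow hb, ← hp2]
    gcongr
    calc 2 * C = (2 * C) ^ (1 : ℝ) := (Real.rpow_one _).symm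
      _ ≤ (2 * C) ^ s := Real.rpow_le_rpow_of_exponent_le (by linarith) hs1
  have h4 : 2 * C * (a ^ (p - 2) * b ^ 2) ≤ s * (a ^ (p - 2) * B) := by
    have : 0 ≤ a ^ (p - 2) * B := by positivity
    rw [hB] at this ⊢
    nlinarith
  linarith

/-! ### Power sequences and their sums -/

lemma one_sub_rpow_le_max {x a : ℝ} (hx : 0 ≤ x) (hx1 : x ≤ 1) :
    1 - x ^ a ≤ max a 1 * (1 - x) := by
  rcases le_total 1 a with ha | ha
  · rw [max_eq_left ha]; exact one_sub_rpow_le hx ha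
  · rw [max_eq_right ha, one_mul]
    rcases hx.eq_or_lt with rfl | hx
    · linarith [Real.rpow_nonneg (le_refl (0 : ℝ)) a]
    · have := Real.rpow_le_rpow_of_exponent_ge hx hx1 ha
      rw [Real.rpow_one] at this
      linarith

lemma min_mul_le_one_sub_rpow {x a : ℝ} (hx : 0 ≤ x) (hx1 : x ≤ 1) (ha : 0 < a) :
    min a 1 * (1 - x) ≤ 1 - x ^ a := by
  rcases le_total 1 a with h | h
  · rw [min_eq_right h, one_mul]
    rcases hx.eq_or_lt with rfl | hx
    · rw [Real.zero_rpow ha.ne']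
    · have := Real.rpow_le_rpow_of_exponent_ge hx hx1 h
      rw [Real.rpow_one] at this
      linarith
  · rw [min_eq_left h]
    have := rpow_one_add_le_one_add_mul_self (s := x - 1) (by linarith) ha.le h
    rw [add_sub_cancel] at this
    linarith

lemma natCast_rpow_sub (a : ℝ) (k : ℕ) :
    ((k : ℝ) + 1) ^ a - (k : ℝ) ^ a = ((k : ℝ) + 1) ^ a * (1 - ((k : ℝ) / (k + 1)) ^ a) := by
  rw [Real.div_rpow (by positivity) (by positivity)]
  have : ((k : ℝ) + 1) ^ a ≠ 0 := by positivity
  field_simp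

lemma natCast_rpow_sub_one (a : ℝ) (k : ℕ) :
    ((k : ℝ) + 1) ^ (a - 1) = ((k : ℝ) + 1) ^ a * (1 - (k : ℝ) / (k + 1)) := by
  rw [Real.rpow_sub_one (by positivity)]
  field_simp; ring

lemma natCast_div_succ_mem (k : ℕ) : 0 ≤ (k : ℝ) / (k + 1) ∧ (k : ℝ) / (k + 1) ≤ 1 :=
  ⟨by positivity, by rw [div_le_one (by positivity)]; linarith⟩

lemma exists_sum_rpow_le {a : ℝ} (ha : -1 < a) :
    ∃ C : ℝ, 0 < C ∧ ∀ n : ℕ, ∑ k ∈ Finset.Icc 1 n, (k : ℝ) ^ a ≤ C * (n : ℝ) ^ (a + 1) := by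
  have hm : 0 < min (a + 1) 1 := lt_min (by linarith) one_pos
  refine ⟨(min (a + 1) 1)⁻¹, by positivity, fun n => ?_⟩
  rw [← div_eq_inv_mul, le_div_iff₀ hm]
  induction n with
  | zero => simp; positivity
  | succ n ih =>
    rw [Finset.sum_Icc_succ_top (by omega), add_mul]
    push_cast
    have h := min_mul_le_one_sub_rpow (natCast_div_succ_mem n).1 (natCast_div_succ_mem n).2
      (by linarith : 0 < a + 1)
    have e := natCast_rpow_sub (a + 1) n
    have e2 := natCast_rpow_sub_one (a + 1) n
    rw [add_sub_cancel_right] at e2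
    have h2 := mul_le_mul_of_nonneg_left h (by positivity : 0 ≤ ((n : ℝ) + 1) ^ (a + 1))
    rw [← e] at h2
    rw [e2]
    linarith

lemma exists_le_sum_rpow {a : ℝ} (ha : -1 < a) :
    ∃ c : ℝ, 0 < c ∧ ∀ n : ℕ, c * (n : ℝ) ^ (a + 1) ≤ ∑ k ∈ Finset.Icc 1 n, (k : ℝ) ^ a := by
  have hm : 0 < max (a + 1) 1 := lt_max_of_lt_right one_pos
  refine ⟨(max (a + 1) 1)⁻¹, by positivity, fun n => ?_⟩
  rw [← div_eq_inv_mul, div_le_iff₀ hm]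
  induction n with
  | zero => simp [Real.zero_rpow (by linarith : a + 1 ≠ 0)]
  | succ n ih =>
    rw [Finset.sum_Icc_succ_top (by omega), add_mul]
    push_cast
    have h := one_sub_rpow_le_max (a := a + 1) (natCast_div_succ_mem n).1 (natCast_div_succ_mem n).2
    have e := natCast_rpow_sub (a + 1) n
    have e2 := natCast_rpow_sub_one (a + 1) n
    rw [add_sub_cancel_right] at e2
    have h2 := mul_le_mul_of_nonneg_left h (by positivity : 0 ≤ ((n : ℝ) + 1) ^ (a + 1))
    rw [← e] at h2
    rw [e2]
    linarith

lemma exists_abs_rpow_sub_le (a : ℝ) :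
    ∃ C : ℝ, 0 < C ∧ ∀ k : ℕ, 1 ≤ k →
      |((k : ℝ) + 1) ^ a - (k : ℝ) ^ a| ≤ C * ((k : ℝ) + 1) ^ (a - 1) := by
  rcases le_or_gt 0 a with ha | ha
  · refine ⟨max a 1, lt_max_of_lt_right one_pos, fun k _ => ?_⟩
    rw [natCast_rpow_sub, natCast_rpow_sub_one, abs_mul, abs_of_nonneg (by positivity),
      mul_left_comm]
    have h0 := natCast_div_succ_mem k
    have h1 : ((k : ℝ) / (k + 1)) ^ a ≤ 1 := Real.rpow_le_one h0.1 h0.2 ha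
    rw [abs_of_nonneg (by linarith)]
    gcongr
    exact one_sub_rpow_le_max h0.1 h0.2
  · refine ⟨2 ^ (-a) * max (-a) 1, mul_pos (by positivity) (lt_max_of_lt_right one_pos),
      fun k hk => ?_⟩
    rw [natCast_rpow_sub, natCast_rpow_sub_one, abs_mul, abs_of_nonneg (by positivity),
      mul_left_comm]
    have h0 := natCast_div_succ_mem k
    have hk' : (1 : ℝ) ≤ k := by exact_mod_cast hk
    set x : ℝ := (k : ℝ) / (k + 1) with hx
    have hx0 : 0 < x := by positivity
    have hx2 : 1 / 2 ≤ x := by rw [hx, div_le_div_iff₀ (by norm_num) (by positivity)]; linarith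
    have h1 : 1 ≤ x ^ a := Real.one_le_rpow_of_pos_of_le_one_of_nonpos hx0 h0.2 ha.le
    have h2 : x ^ a ≤ 2 ^ (-a) := by
      have := Real.rpow_le_rpow_of_nonpos (by norm_num : (0 : ℝ) < 1 / 2) hx2 ha.le
      rwa [one_div, Real.inv_rpow (by norm_num), ← Real.rpow_neg (by norm_num)] at this
    rw [abs_of_nonpos (by linarith)]
    gcongr
    have e : -(1 - x ^ a) = x ^ a * (1 - x ^ (-a)) := by
      rw [mul_sub, ← Real.rpow_add hx0]; simp
    rw [e, mul_assoc]
    have h3 := one_sub_rpow_le_max (a := -a) h0.1 h0.2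
    have h4 : 0 ≤ 1 - x ^ (-a) := by
      have := Real.rpow_le_one h0.1 h0.2 (by linarith : 0 ≤ -a)
      linarith
    gcongr

open Filter Topology in
/-- Chung's lemma for step-sizes `n ^ (-r)`, `r < 1`: the contraction dominates every polynomial
decay, whatever the value of `c`. -/
lemma exists_le_rpow_of_recursion {u : ℕ → ℝ} {c C r s : ℝ} (hc : 0 < c) (hC : 0 ≤ C)
    (hr0 : 0 < r) (hr : r < 1) (hs : 0 < s)
    (h : ∀ᶠ n : ℕ in atTop, u (n + 1) ≤ (1 - c * ((n : ℝ) + 1) ^ (-r)) * u n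
      + C * (((n : ℝ) + 1) ^ (-r) * ((n : ℝ) + 1) ^ (-s))) :
    ∃ D : ℝ, 0 < D ∧ ∀ n : ℕ, 1 ≤ n → u n ≤ D * (n : ℝ) ^ (-s) := by
  have hcast : Tendsto (fun n : ℕ => (n : ℝ) + 1) atTop atTop :=
    tendsto_atTop_add_const_right _ _ tendsto_natCast_atTop_atTop
  have h1 : ∀ᶠ n : ℕ in atTop, ((n : ℝ) + 1) ^ (-r) < 1 / c :=
    ((tendsto_rpow_neg_atTop hr0).comp hcast).eventually (gt_mem_nhds (by positivity))
  have h2 : ∀ᶠ n : ℕ in atTop, 4 * s / c ≤ ((n : ℝ) + 1) ^ (1 - r) :=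
    ((tendsto_rpow_atTop (by linarith : 0 < 1 - r)).comp hcast).eventually
      (eventually_ge_atTop _)
  obtain ⟨n₀, hn₀⟩ := eventually_atTop.1 (h.and (h1.and (h2.and (eventually_ge_atTop 1))))
  set D : ℝ := 2 * C / c + 1 + ∑ i ∈ Finset.range (n₀ + 1), |u i| * (i : ℝ) ^ s with hD
  have hsum : 0 ≤ ∑ i ∈ Finset.range (n₀ + 1), |u i| * (i : ℝ) ^ s :=
    Finset.sum_nonneg fun i _ => by positivity
  have hDC : 2 * C / c ≤ D := by rw [hD]; linarith
  have hD0 : 0 < D := by rw [hD]; positivity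
  have hsmall : ∀ n : ℕ, 1 ≤ n → n ≤ n₀ → u n ≤ D * (n : ℝ) ^ (-s) := by
    intro n hn hle
    have hn' : (0 : ℝ) < n := by exact_mod_cast hn
    have h3 : |u n| * (n : ℝ) ^ s ≤ D := by
      have := Finset.single_le_sum (f := fun i : ℕ => |u i| * (i : ℝ) ^ s)
        (fun i _ => by positivity) (Finset.mem_range.2 (Nat.lt_succ_of_le hle))
      have h0 : 0 ≤ 2 * C / c + 1 := by positivity
      linarith
    rw [Real.rpow_neg hn'.le, ← div_eq_mul_inv, le_div_iff₀ (by positivity)]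
    exact le_trans (by gcongr; exact le_abs_self _) h3
  have hn₀1 : 1 ≤ n₀ := (hn₀ n₀ le_rfl).2.2.2
  have hbig : ∀ n : ℕ, n₀ ≤ n → u n ≤ D * (n : ℝ) ^ (-s) := by
    intro n hn
    induction n, hn using Nat.le_induction with
    | base => exact hsmall n₀ hn₀1 le_rfl
    | succ n hn ih =>
      obtain ⟨hrec, ha, hb, hn1⟩ := hn₀ n hn
      have hn' : (1 : ℝ) ≤ n := by exact_mod_cast hn1
      push_cast
      set g : ℝ := ((n : ℝ) + 1) ^ (-r) with hg
      have hg0 : 0 < g := by positivity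
      have hcg : c * g < 1 := by
        rw [lt_div_iff₀ hc] at ha; linarith
      -- the contraction factor `1 - c g / 2` compensates `((n + 1) / n) ^ s ≤ exp (s / n)`
      have hratio : (1 - c * g / 2) * (n : ℝ) ^ (-s) ≤ ((n : ℝ) + 1) ^ (-s) := by
        have hA : 1 - c * g / 2 ≤ Real.exp (-(c * g / 2)) := by
          linarith [Real.add_one_le_exp (-(c * g / 2))]
        have hB : ((n : ℝ) + 1) ^ s ≤ (n : ℝ) ^ s * Real.exp (s / n) := by
          have e : (n : ℝ) + 1 = n * (1 + 1 / n) := by field_simp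
          rw [e, Real.mul_rpow (by positivity) (by positivity)]
          gcongr
          calc (1 + 1 / (n : ℝ)) ^ s ≤ (Real.exp (1 / n)) ^ s := by
                gcongr; linarith [Real.add_one_le_exp (1 / (n : ℝ))]
            _ = Real.exp (s / n) := by rw [← Real.exp_mul]; congr 1; field_simp
        have hC' : s / n ≤ c * g / 2 := by
          have e : ((n : ℝ) + 1) ^ (1 - r) = ((n : ℝ) + 1) * g := by
            rw [hg, sub_eq_add_neg, Real.rpow_add (by positivity), Real.rpow_one]
          rw [e, div_le_iff₀ hc] at hb
          rw [div_le_iff₀ (by positivity)]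
          nlinarith [mul_pos hc hg0]
        rw [Real.rpow_neg (by positivity), Real.rpow_neg (by positivity), ← div_eq_mul_inv,
          div_le_iff₀ (by positivity), ← div_eq_inv_mul, le_div_iff₀ (by positivity)]
        calc (1 - c * g / 2) * ((n : ℝ) + 1) ^ s
            ≤ Real.exp (-(c * g / 2)) * ((n : ℝ) ^ s * Real.exp (s / n)) := by
              gcongr
          _ ≤ Real.exp (-(c * g / 2)) * ((n : ℝ) ^ s * Real.exp (c * g / 2)) := by gcongr
          _ = (n : ℝ) ^ s := by
              rw [mul_left_comm, ← Real.exp_add]; simp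
      have hfac : 1 - c * g ≤ (1 - c * g / 2) * (1 - c * g / 2) := by nlinarith [sq_nonneg (c * g)]
      have hDC2 : C ≤ D * (c / 2) := by
        rw [div_le_iff₀ hc] at hDC; linarith
      have hns : 0 ≤ (n : ℝ) ^ (-s) := by positivity
      have hns1 : 0 ≤ ((n : ℝ) + 1) ^ (-s) := by positivity
      calc u (n + 1) ≤ (1 - c * g) * u n + C * (g * ((n : ℝ) + 1) ^ (-s)) := hrec
        _ ≤ (1 - c * g) * (D * (n : ℝ) ^ (-s)) + D * (c / 2) * (g * ((n : ℝ) + 1) ^ (-s)) := by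
            gcongr
        _ ≤ (1 - c * g / 2) * (1 - c * g / 2) * (D * (n : ℝ) ^ (-s))
            + D * (c / 2) * (g * ((n : ℝ) + 1) ^ (-s)) := by gcongr
        _ = D * (1 - c * g / 2) * ((1 - c * g / 2) * (n : ℝ) ^ (-s))
            + D * (c / 2) * (g * ((n : ℝ) + 1) ^ (-s)) := by ring
        _ ≤ D * (1 - c * g / 2) * ((n : ℝ) + 1) ^ (-s)
            + D * (c / 2) * (g * ((n : ℝ) + 1) ^ (-s)) := by
            gcongr
            exact mul_nonneg hD0.le (by linarith)
        _ = D * ((n : ℝ) + 1) ^ (-s) := by ring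
  exact ⟨D, hD0, fun n hn => (le_total n n₀).elim (hsmall n hn) (hbig n)⟩

/-! ### Moment bounds for orthogonal increments -/

/-- `C` is an admissible constant in the first order expansion of `‖·‖ ^ p` on `E`. -/
def IsSmoothConst (E : Type*) [NormedAddCommGroup E] [InnerProductSpace ℝ E] (p C : ℝ) : Prop :=
  1 ≤ C ∧ ∀ x y : E, ‖x + y‖ ^ p ≤ ‖x‖ ^ p + p * (‖x‖ ^ (p - 2) * inner ℝ x y)
      + C * (‖x‖ ^ (p - 2) * ‖y‖ ^ 2 + ‖y‖ ^ p)

lemma rpow_mul_rpow_le_add {a b s t : ℝ} (ha : 0 ≤ a) (hb : 0 ≤ b) (hs : 0 ≤ s) (ht : 0 ≤ t) :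
    a ^ s * b ^ t ≤ a ^ (s + t) + b ^ (s + t) := by
  have hm : 0 ≤ max a b := le_max_of_le_left ha
  have h1 : a ^ s * b ^ t ≤ max a b ^ s * max a b ^ t := by
    gcongr
    · exact le_max_left _ _
    · exact le_max_right _ _
  rw [← Real.rpow_add_of_nonneg hm hs ht] at h1
  refine h1.trans ?_
  rcases max_choice a b with h | h <;> rw [h]
  · linarith [Real.rpow_nonneg hb (s + t)]
  · linarith [Real.rpow_nonneg ha (s + t)]

section

variable {Ω E : Type*} [MeasurableSpace Ω] {P : Measure Ω} [NormedAddCommGroup E] {p : ℝ}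

lemma MemLp.integrable_rpow {f : Ω → E} (hp : 0 < p) (hf : MemLp f (ENNReal.ofReal p) P) :
    Integrable (fun ω => ‖f ω‖ ^ p) P := by
  have := hf.integrable_norm_rpow (by simpa using hp) ENNReal.ofReal_ne_top
  rwa [ENNReal.toReal_ofReal hp.le] at this

lemma lpNorm_rpow {f : Ω → E} (hp : 0 < p) (hf : AEStronglyMeasurable f P) :
    lpNorm f (ENNReal.ofReal p) P ^ p = ∫ ω, ‖f ω‖ ^ p ∂P := by
  rw [lpNorm_eq_integral_norm_rpow_toReal (by simpa using hp) ENNReal.ofReal_ne_top hf,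
    ENNReal.toReal_ofReal hp.le, ← Real.rpow_mul (by positivity), inv_mul_cancel₀ hp.ne',
    Real.rpow_one]

lemma integrable_rpow_mul_sq {Y N : Ω → E} (hp : 2 ≤ p) (hY : MemLp Y (ENNReal.ofReal p) P)
    (hN : MemLp N (ENNReal.ofReal p) P) :
    Integrable (fun ω => ‖Y ω‖ ^ (p - 2) * ‖N ω‖ ^ 2) P := by
  refine ((MemLp.integrable_rpow (by linarith) hY).add
    (MemLp.integrable_rpow (by linarith) hN)).mono' ?_ ?_
  · exact ((hY.1.norm.aemeasurable.pow_const _).mul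
      (hN.1.norm.aemeasurable.pow_const _)).aestronglyMeasurable
  · refine Filter.Eventually.of_forall fun ω => ?_
    rw [Real.norm_of_nonneg (by positivity)]
    have := rpow_mul_rpow_le_add (norm_nonneg (Y ω)) (norm_nonneg (N ω))
      (by linarith : 0 ≤ p - 2) (by norm_num : (0 : ℝ) ≤ 2)
    rw [sub_add_cancel, Real.rpow_two] at this
    exact this

lemma integral_rpow_mul_sq_le {Y N : Ω → E} [IsProbabilityMeasure P] (hp : 2 ≤ p)
    (hY : MemLp Y (ENNReal.ofReal p) P) (hN : MemLp N (ENNReal.ofReal p) P) :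
    ∫ ω, ‖Y ω‖ ^ (p - 2) * ‖N ω‖ ^ 2 ∂P
      ≤ lpNorm Y (ENNReal.ofReal p) P ^ (p - 2) * lpNorm N (ENNReal.ofReal p) P ^ 2 := by
  rcases hp.eq_or_lt with rfl | hp2
  · have h := lpNorm_rpow (p := 2) (by norm_num) hN.1
    simp only [Real.rpow_two] at h
    rw [sub_self, Real.rpow_zero, one_mul, h]
    simp
  · have hp0 : 0 < p := by linarith
    have hconj : (p / (p - 2)).HolderConjugate (p / 2) := by
      rw [Real.holderConjugate_iff]
      constructor
      · rw [lt_div_iff₀ (by linarith)]; linarith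
      · rw [inv_div, inv_div]; field_simp; ring
    have h1 := hY.norm_rpow_div (ENNReal.ofReal (p - 2))
    have h2 := hN.norm_rpow_div (ENNReal.ofReal 2)
    rw [← ENNReal.ofReal_div_of_pos (by linarith), ENNReal.toReal_ofReal (by linarith)] at h1 h2
    have h := integral_mul_le_Lp_mul_Lq_of_nonneg (μ := P) hconj
      (Filter.Eventually.of_forall fun ω => by simp only [Pi.zero_apply]; positivity)
      (Filter.Eventually.of_forall fun ω => by simp only [Pi.zero_apply]; positivity) h1 h2
    have e1 : ∀ ω, (‖Y ω‖ ^ (p - 2)) ^ (p / (p - 2)) = ‖Y ω‖ ^ p := fun ω => by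
      rw [← Real.rpow_mul (norm_nonneg _)]; congr 1
      rw [mul_div_cancel₀]; linarith
    have e2 : ∀ ω, (‖N ω‖ ^ (2 : ℝ)) ^ (p / 2) = ‖N ω‖ ^ p := fun ω => by
      rw [← Real.rpow_mul (norm_nonneg _)]; congr 1; ring
    simp only [e1, e2] at h
    rw [← lpNorm_rpow hp0 hY.1, ← lpNorm_rpow hp0 hN.1, ← Real.rpow_mul lpNorm_nonneg,
      ← Real.rpow_mul lpNorm_nonneg] at h
    have e3 : p * (1 / (p / (p - 2))) = p - 2 := by field_simp
    have e4 : p * (1 / (p / 2)) = 2 := by field_simp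
    rw [e3, e4] at h
    simp only [Real.rpow_two] at h
    exact h

/-- If the fibre moments `E[‖h(x, W)‖ ^ p]` are bounded by `c ^ p` uniformly in `x`, so is the
moment of `h(ξ, W)` for `ξ` independent of `W`. -/
lemma memLp_lpNorm_le_of_indepFun [MeasurableSpace E] [OpensMeasurableSpace E]
    [SecondCountableTopology E] [IsProbabilityMeasure P] {α β : Type*}
    [MeasurableSpace α] [MeasurableSpace β] {ξ : Ω → α} {W : Ω → β} (hξ : Measurable ξ)
    (hW : Measurable W) (hind : IndepFun ξ W P) {h : α → β → E} {c : ℝ} (hc : 0 ≤ c) (hp : 0 < p)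
    (hh : Measurable (fun z : α × β => h z.1 z.2))
    (hmem : ∀ x, MemLp (fun ω => h x (W ω)) (ENNReal.ofReal p) P)
    (hle : ∀ x, lpNorm (fun ω => h x (W ω)) (ENNReal.ofReal p) P ≤ c) :
    MemLp (fun ω => h (ξ ω) (W ω)) (ENNReal.ofReal p) P ∧
      lpNorm (fun ω => h (ξ ω) (W ω)) (ENNReal.ofReal p) P ≤ c := by
  have hξW : Measurable fun ω => (ξ ω, W ω) := hξ.prodMk hW
  have hprod := hind.map_prod_eq_prod_map_map hξ.aemeasurable hW.aemeasurable
  have hP1 := Measure.isProbabilityMeasure_map (μ := P) hξ.aemeasurable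
  have hP2 := Measure.isProbabilityMeasure_map (μ := P) hW.aemeasurable
  have hm : Measurable fun z : α × β => ‖h z.1 z.2‖ₑ ^ p := hh.enorm.pow_const p
  have hx : ∀ x, ∫⁻ ω, ‖h x (W ω)‖ₑ ^ p ∂P ≤ ENNReal.ofReal c ^ p := by
    intro x
    have h1 : eLpNorm (fun ω => h x (W ω)) (ENNReal.ofReal p) P ≤ ENNReal.ofReal c := by
      rw [← ofReal_lpNorm (hmem x)]
      exact ENNReal.ofReal_le_ofReal (hle x)
    rw [eLpNorm_eq_lintegral_rpow_enorm_toReal (by simpa using hp) ENNReal.ofReal_ne_top,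
      ENNReal.toReal_ofReal hp.le, one_div, ENNReal.rpow_inv_le_iff hp] at h1
    exact h1
  have htot : ∫⁻ ω, ‖h (ξ ω) (W ω)‖ₑ ^ p ∂P ≤ ENNReal.ofReal c ^ p := by
    have e : ∫⁻ ω, ‖h (ξ ω) (W ω)‖ₑ ^ p ∂P
        = ∫⁻ z, ‖h z.1 z.2‖ₑ ^ p ∂((P.map ξ).prod (P.map W)) := by
      rw [← hprod, lintegral_map hm hξW]
    rw [e, lintegral_prod _ hm.aemeasurable]
    calc ∫⁻ x, ∫⁻ y, ‖h x y‖ₑ ^ p ∂(P.map W) ∂(P.map ξ)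
        ≤ ∫⁻ _x, ENNReal.ofReal c ^ p ∂(P.map ξ) := by
          refine lintegral_mono fun x => ?_
          have := lintegral_map (μ := P) (hm.comp (measurable_prodMk_left (x := x))) hW
          exact this.trans_le (hx x)
      _ = ENNReal.ofReal c ^ p := by simp
  have hmeas : Measurable fun ω => h (ξ ω) (W ω) := hh.comp hξW
  have hel : eLpNorm (fun ω => h (ξ ω) (W ω)) (ENNReal.ofReal p) P ≤ ENNReal.ofReal c := by
    rw [eLpNorm_eq_lintegral_rpow_enorm_toReal (by simpa using hp) ENNReal.ofReal_ne_top,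
      ENNReal.toReal_ofReal hp.le, one_div, ENNReal.rpow_inv_le_iff hp]
    exact htot
  refine ⟨⟨hmeas.aestronglyMeasurable, hel.trans_lt ENNReal.ofReal_lt_top⟩, ?_⟩
  rw [← toReal_eLpNorm hmeas.aestronglyMeasurable]
  exact ENNReal.toReal_le_of_le_ofReal hc hel

variable [InnerProductSpace ℝ E]

lemma integrable_inner_rpow {Y N : Ω → E} (hp : 2 ≤ p) (hY : MemLp Y (ENNReal.ofReal p) P)
    (hN : MemLp N (ENNReal.ofReal p) P) :
    Integrable (fun ω => inner ℝ (‖Y ω‖ ^ (p - 2) • Y ω) (N ω)) P := by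
  refine ((MemLp.integrable_rpow (by linarith) hY).add
    (MemLp.integrable_rpow (by linarith) hN)).mono' ?_ ?_
  · exact ((hY.1.norm.aemeasurable.pow_const _).aestronglyMeasurable.smul hY.1).inner hN.1
  · refine Filter.Eventually.of_forall fun ω => (norm_inner_le_norm _ _).trans ?_
    rw [norm_smul, Real.norm_of_nonneg (by positivity)]
    have := rpow_mul_rpow_le_add (norm_nonneg (Y ω)) (norm_nonneg (N ω))
      (by linarith : 0 ≤ p - 1) (by norm_num : (0 : ℝ) ≤ 1)
    rw [sub_add_cancel, Real.rpow_one] at this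
    have e : ‖Y ω‖ ^ (p - 2) * ‖Y ω‖ ≤ ‖Y ω‖ ^ (p - 1) := by
      rcases (norm_nonneg (Y ω)).eq_or_lt with h | h
      · rw [← h, mul_zero]; exact Real.rpow_nonneg le_rfl _
      · rw [← Real.rpow_add_one h.ne']; ring_nf; exact le_rfl
    calc _ ≤ ‖Y ω‖ ^ (p - 1) * ‖N ω‖ := by gcongr
      _ ≤ _ := this

/-- A type-2 inequality in `L^p`: adding an increment `N` that is orthogonal to the gradient of
`‖·‖ ^ p` at `Y` increases the squared `L^p`-norm at most by a multiple of that of `N`. -/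
theorem lpNorm_add_sq_le [IsProbabilityMeasure P] {C : ℝ} (hp : 2 ≤ p) (hC : IsSmoothConst E p C)
    {Y N : Ω → E} (hY : MemLp Y (ENNReal.ofReal p) P) (hN : MemLp N (ENNReal.ofReal p) P)
    (horth : ∫ ω, inner ℝ (‖Y ω‖ ^ (p - 2) • Y ω) (N ω) ∂P = 0) :
    lpNorm (Y + N) (ENNReal.ofReal p) P ^ 2
      ≤ lpNorm Y (ENNReal.ofReal p) P ^ 2 + 2 * C * lpNorm N (ENNReal.ofReal p) P ^ 2 := by
  have hp0 : 0 < p := by linarith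
  have hi1 := MemLp.integrable_rpow hp0 hY
  have hi2 := integrable_inner_rpow hp hY hN
  have hi3 := integrable_rpow_mul_sq hp hY hN
  have hi4 := MemLp.integrable_rpow hp0 hN
  have h1 : ∫ ω, ‖(Y + N) ω‖ ^ p ∂P ≤ ∫ ω, (‖Y ω‖ ^ p
      + p * inner ℝ (‖Y ω‖ ^ (p - 2) • Y ω) (N ω)
      + C * (‖Y ω‖ ^ (p - 2) * ‖N ω‖ ^ 2 + ‖N ω‖ ^ p)) ∂P := by
    refine integral_mono (MemLp.integrable_rpow hp0 (hY.add hN))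
      ((hi1.add (hi2.const_mul p)).add ((hi3.add hi4).const_mul C)) fun ω => ?_
    simp only [Pi.add_apply, real_inner_smul_left]
    exact hC.2 (Y ω) (N ω)
  have e1 := integral_add (hi1.add (hi2.const_mul p)) ((hi3.add hi4).const_mul C)
  have e2 := integral_add hi1 (hi2.const_mul p)
  have e3 := integral_add hi3 hi4
  simp only [Pi.add_apply] at e1
  rw [e1, e2, integral_const_mul, integral_const_mul, horth, e3, ← lpNorm_rpow hp0 (hY.add hN).1, ← lpNorm_rpow hp0 hY.1,
    ← lpNorm_rpow hp0 hN.1, mul_zero, add_zero] at h1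
  have h2 := integral_rpow_mul_sq_le hp hY hN
  have h3 := rpow_add_mul_le (p := p) (lpNorm_nonneg (f := Y) (p := ENNReal.ofReal p) (μ := P))
    (lpNorm_nonneg (f := N) (p := ENNReal.ofReal p) (μ := P)) hC.1 hp
  have h4 : lpNorm (Y + N) (ENNReal.ofReal p) P ^ p ≤ (lpNorm Y (ENNReal.ofReal p) P ^ 2
      + 2 * C * lpNorm N (ENNReal.ofReal p) P ^ 2) ^ (p / 2) := by
    refine (h1.trans ?_).trans h3
    have := hC.1
    gcongr
  have e : lpNorm (Y + N) (ENNReal.ofReal p) P ^ p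
      = (lpNorm (Y + N) (ENNReal.ofReal p) P ^ 2) ^ (p / 2) := by
    rw [sq_rpow lpNorm_nonneg]; congr 1; ring
  rw [e] at h4
  have := hC.1
  exact (Real.rpow_le_rpow_iff (by positivity) (by positivity) (by linarith)).1 h4

variable [MeasurableSpace E] [BorelSpace E] [SecondCountableTopology E] [CompleteSpace E]

/-- Conditional centering: a function of `(ξ, W)` that is centered in `W` for each value of `ξ` is
orthogonal to functions of `ξ`, if `ξ` and `W` are independent. -/
lemma integral_inner_eq_zero_of_indepFun [IsProbabilityMeasure P] {α β : Type*}
    [MeasurableSpace α] [MeasurableSpace β] {ξ : Ω → α} {W : Ω → β} (hξ : Measurable ξ)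
    (hW : Measurable W) (hind : IndepFun ξ W P) {g : α → E} (hg : Measurable g) {h : α → β → E}
    (hh : Measurable (fun z : α × β => h z.1 z.2))
    (hint : ∀ x, Integrable (fun ω => h x (W ω)) P) (hzero : ∀ x, ∫ ω, h x (W ω) ∂P = 0)
    (hi : Integrable (fun ω => inner ℝ (g (ξ ω)) (h (ξ ω) (W ω))) P) :
    ∫ ω, inner ℝ (g (ξ ω)) (h (ξ ω) (W ω)) ∂P = 0 := by
  have hm : Measurable fun z : α × β => (inner ℝ (g z.1) (h z.1 z.2) : ℝ) :=
    (hg.comp measurable_fst).inner hh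
  have hξW : Measurable fun ω => (ξ ω, W ω) := hξ.prodMk hW
  have hprod := hind.map_prod_eq_prod_map_map hξ.aemeasurable hW.aemeasurable
  have hP1 := Measure.isProbabilityMeasure_map (μ := P) hξ.aemeasurable
  have hP2 := Measure.isProbabilityMeasure_map (μ := P) hW.aemeasurable
  have hi' : Integrable (fun z : α × β => (inner ℝ (g z.1) (h z.1 z.2) : ℝ))
      ((P.map ξ).prod (P.map W)) := by
    rw [← hprod, integrable_map_measure hm.aestronglyMeasurable hξW.aemeasurable]
    exact hi
  have e : ∫ ω, (inner ℝ (g (ξ ω)) (h (ξ ω) (W ω)) : ℝ) ∂P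
      = ∫ z, (inner ℝ (g z.1) (h z.1 z.2) : ℝ) ∂((P.map ξ).prod (P.map W)) := by
    rw [← hprod, integral_map hξW.aemeasurable hm.aestronglyMeasurable]
  rw [e, integral_prod _ hi']
  refine integral_eq_zero_of_ae (Filter.Eventually.of_forall fun x => ?_)
  have hhx : Measurable (h x) := hh.comp measurable_prodMk_left
  have hix : Integrable (h x) (P.map W) := by
    rw [integrable_map_measure hhx.aestronglyMeasurable hW.aemeasurable]; exact hint x
  simp only [Pi.zero_apply]
  rw [integral_inner hix, integral_map hW.aemeasurable hhx.aestronglyMeasurable, hzero x,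
    inner_zero_right]

lemma lpNorm_sum_sq_le_of_iIndepFun [IsProbabilityMeasure P] {C : ℝ} (hp : 2 ≤ p)
    (hC : IsSmoothConst E p C) {ι : Type*} {X : ι → Ω → E} (hind : iIndepFun X P)
    (hmeas : ∀ i, Measurable (X i)) (hmem : ∀ i, MemLp (X i) (ENNReal.ofReal p) P)
    (hzero : ∀ i, ∫ ω, X i ω ∂P = 0) (s : Finset ι) :
    lpNorm (∑ i ∈ s, X i) (ENNReal.ofReal p) P ^ 2
      ≤ 2 * C * ∑ i ∈ s, lpNorm (X i) (ENNReal.ofReal p) P ^ 2 := by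
  classical
  have hp1 : (1 : ℝ≥0∞) ≤ ENNReal.ofReal p := by
    rw [ENNReal.one_le_ofReal]; linarith
  induction s using Finset.induction_on with
  | empty => simp
  | insert a s has ih =>
    rw [Finset.sum_insert has, Finset.sum_insert has, mul_add, add_comm (X a),
      add_comm (2 * C * _)]
    have hsm : Measurable (∑ i ∈ s, X i) := by
      have := Finset.measurable_sum s fun i _ => hmeas i
      rwa [← Finset.sum_fn] at this
    have hsL : MemLp (∑ i ∈ s, X i) (ENNReal.ofReal p) P := memLp_finsetSum' s fun i _ => hmem i
    have hI := hind.indepFun_finsetSum_of_notMem hmeas has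
    have horth := integral_inner_eq_zero_of_indepFun (P := P) hsm (hmeas a) hI
      (g := fun x : E => ‖x‖ ^ (p - 2) • x) (by fun_prop) (h := fun _ y => y) measurable_snd
      (fun _ => (hmem a).integrable hp1) (fun _ => hzero a)
      (integrable_inner_rpow hp hsL (hmem a))
    have := lpNorm_add_sq_le hp hC hsL (hmem a) horth
    linarith

end

/-! ### Sums over levels -/

lemma sum_pow_succ_le_of_one_lt {x : ℝ} (hx : 1 < x) (m : ℕ) :
    ∑ k ∈ Finset.range m, x ^ (k + 1) ≤ x / (x - 1) * x ^ m := by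
  have hx1 : 0 < x - 1 := by linarith
  have h : ∑ k ∈ Finset.range m, x ^ (k + 1) = x / (x - 1) * (x ^ m - 1) := by
    simp_rw [pow_succ']
    rw [← Finset.mul_sum, geom_sum_eq hx.ne']
    ring
  rw [h]
  gcongr
  linarith

lemma sum_pow_succ_le_of_lt_one {x : ℝ} (hx0 : 0 < x) (hx : x < 1) (m : ℕ) :
    ∑ k ∈ Finset.range m, x ^ (k + 1) ≤ 1 / (1 - x) := by
  have hx1 : 0 < 1 - x := by linarith
  have h : ∑ k ∈ Finset.range m, x ^ (k + 1) = x * (1 - x ^ m) / (1 - x) := by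
    simp_rw [pow_succ']
    rw [← Finset.mul_sum, geom_sum_eq hx.ne, ← neg_div_neg_eq]
    ring
  rw [h]
  gcongr
  nlinarith [pow_nonneg hx0.le m]

/-- The size of `∑_{k=1}^m M^{k(1/2-β)}`, which is the factor of `(Γ₁ / σ_n)²` in `kappa`. -/
noncomputable def levelWeight {E : Type*} (A : Params E) (m : ℕ) : ℝ :=
  if A.β = 1 / 2 then (m : ℝ) else A.M ^ ((m : ℝ) * max (1 / 2 - A.β) 0)

lemma kappa_eq {E : Type*} (A : Params E) (n : ℕ) (θ : E) :
    kappa A n θ = (A.Γ₁ θ / A.σ n) ^ 2 * levelWeight A (maxLevel A n θ) := by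
  unfold kappa levelWeight; split_ifs <;> rfl

lemma levelWeight_pos {E : Type*} (A : Params E) (hM : 1 < A.M) {m : ℕ} (hm : 1 ≤ m) :
    0 < levelWeight A m := by
  unfold levelWeight; split_ifs
  · exact_mod_cast hm
  · exact Real.rpow_pos_of_pos (by linarith) _

lemma exists_sum_level_le {E : Type*} (A : Params E) (hM : 1 < A.M) :
    ∃ c : ℝ, 0 < c ∧ ∀ m : ℕ,
      ∑ k ∈ Finset.range m, A.M ^ (((k : ℝ) + 1) * (1 / 2 - A.β)) ≤ c * levelWeight A m := by
  have hM0 : 0 < A.M := by linarith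
  have e : ∀ k : ℕ, A.M ^ (((k : ℝ) + 1) * (1 / 2 - A.β)) = (A.M ^ (1 / 2 - A.β)) ^ (k + 1) := by
    intro k
    rw [← Real.rpow_natCast, ← Real.rpow_mul hM0.le, mul_comm]
    push_cast; rfl
  simp_rw [e]
  rcases lt_trichotomy A.β (1 / 2) with h | h | h
  · have hx : 1 < A.M ^ (1 / 2 - A.β) := Real.one_lt_rpow hM (by linarith)
    refine ⟨_, div_pos (by linarith) (sub_pos.2 hx),
      fun m => (sum_pow_succ_le_of_one_lt hx m).trans_eq ?_⟩
    rw [levelWeight, if_neg h.ne, max_eq_left (by linarith), ← Real.rpow_natCast (_ ^ _),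
      ← Real.rpow_mul hM0.le, mul_comm (m : ℝ)]
  · refine ⟨1, one_pos, fun m => ?_⟩
    simp [levelWeight, h]
  · have hx : A.M ^ (1 / 2 - A.β) < 1 := Real.rpow_lt_one_of_one_lt_of_neg hM (by linarith)
    have hx0 : 0 < A.M ^ (1 / 2 - A.β) := by positivity
    refine ⟨1 / (1 - A.M ^ (1 / 2 - A.β)), div_pos one_pos (sub_pos.2 hx), fun m =>
      (sum_pow_succ_le_of_lt_one hx0 hx m).trans_eq ?_⟩
    rw [levelWeight, if_neg h.ne', max_eq_right (by linarith), mul_zero, Real.rpow_zero, mul_one]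

lemma sum_Icc_one_eq_sum_range {G : Type*} [AddCommMonoid G] (f : ℕ → G) (m : ℕ) :
    ∑ k ∈ Finset.Icc 1 m, f k = ∑ k ∈ Finset.range m, f (k + 1) := by
  induction m with
  | zero => simp
  | succ m ih => rw [Finset.sum_Icc_succ_top (by omega), ih, Finset.sum_range_succ]

/-! ### The multilevel estimator at a fixed point -/

lemma one_le_maxLevel {E : Type*} (A : Params E) (n : ℕ) (θ : E) : 1 ≤ maxLevel A n θ :=
  le_max_left _ _

section

variable {E : Type*} {A : Params E} {n : ℕ}

lemma kappa_pos (hΓ : ∀ θ, 0 < A.Γ₁ θ) (hM : 1 < A.M) (hσ : 0 < A.σ n) (θ : E) :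
    0 < kappa A n θ := by
  rw [kappa_eq]
  have := levelWeight_pos A hM (one_le_maxLevel A n θ)
  have := hΓ θ
  positivity

lemma one_le_numIter (hΓ : ∀ θ, 0 < A.Γ₁ θ) (hM : 1 < A.M) (hσ : 0 < A.σ n) (k : ℕ) (θ : E) :
    1 ≤ numIter A n k θ := by
  have := kappa_pos hΓ hM hσ θ
  have hM0 : 0 < A.M := by linarith
  exact Nat.one_le_ceil_iff.2 (by positivity)

end

/-- The samples used in step `n`, as one random variable; indices are shifted to start at `0`. -/
def sampleBlock {Ω 𝒰 : Type*} (V : ℕ → ℕ → ℕ → Ω → 𝒰) (n : ℕ) (ω : Ω) : ℕ × ℕ → 𝒰 :=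
  fun i => V n (i.1 + 1) (i.2 + 1) ω

/-- The multilevel estimator as a function of the parameter and of the block of samples. -/
noncomputable def blockEstimator {𝒰 E : Type*} [NormedAddCommGroup E] [NormedSpace ℝ E]
    (A : Params E) (Fk : ℕ → E → 𝒰 → E) (n : ℕ) (θ : E) (w : ℕ × ℕ → 𝒰) : E :=
  ∑ k ∈ Finset.range (maxLevel A n θ), (1 / (numIter A n (k + 1) θ : ℝ)) •
    ∑ l ∈ Finset.range (numIter A n (k + 1) θ), (Fk (k + 1) θ (w (k, l)) - Fk k θ (w (k, l)))

/-- The mean of the multilevel estimator: by telescoping, that of the highest level. -/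
noncomputable def levelMean {Ω 𝒰 E : Type*} [MeasurableSpace Ω] [NormedAddCommGroup E]
    [NormedSpace ℝ E] (P : Measure Ω) (U : Ω → 𝒰) (A : Params E) (Fk : ℕ → E → 𝒰 → E) (n : ℕ)
    (θ : E) : E :=
  ∫ ω, Fk (maxLevel A n θ) θ (U ω) ∂P

lemma estimator_eq {Ω 𝒰 E : Type*} [NormedAddCommGroup E] [NormedSpace ℝ E]
    (A : Params E) (Fk : ℕ → E → 𝒰 → E) (V : ℕ → ℕ → ℕ → Ω → 𝒰) (n : ℕ) (θ : E) (ω : Ω) :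
    estimator A Fk V n θ ω = blockEstimator A Fk n θ (sampleBlock V n ω) := by
  simp only [estimator, blockEstimator, sampleBlock, sum_Icc_one_eq_sum_range,
    Nat.add_sub_cancel]

lemma measurable_maxLevel {E : Type*} [MeasurableSpace E] {A : Params E} (hΓ₂ : Measurable A.Γ₂) (n : ℕ) : Measurable (maxLevel A n) := by
  have h : Measurable fun θ => (1 / A.α) * Real.logb A.M (A.Γ₂ θ / A.ε n) := by
    unfold Real.logb
    exact (((Real.measurable_log.comp (hΓ₂.div_const _)).div_const _).const_mul _)
  exact measurable_const.max (Nat.measurable_ceil.comp h)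

lemma measurable_numIter {E : Type*} [MeasurableSpace E] {A : Params E} (hΓ₁ : Measurable A.Γ₁) (hΓ₂ : Measurable A.Γ₂) (n k : ℕ) :
    Measurable (numIter A n k) := by
  have hm := measurable_maxLevel hΓ₂ n
  have h : Measurable (kappa A n) := by
    have e : kappa A n = fun θ => (A.Γ₁ θ / A.σ n) ^ 2 * levelWeight A (maxLevel A n θ) :=
      funext (kappa_eq A n)
    rw [e]
    exact ((hΓ₁.div_const _).pow_const 2).mul
      ((measurable_from_nat (f := levelWeight A)).comp hm)
  exact Nat.measurable_ceil.comp (h.mul_const _)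

/-- The highest level is chosen such that the bias is at most `ε_n`. -/
lemma norm_levelMean_sub_le {E Ω 𝒰 : Type*} [NormedAddCommGroup E] [NormedSpace ℝ E]
    [MeasurableSpace E] [MeasurableSpace Ω] {P : Measure Ω} {U : Ω → 𝒰} {p : ℝ} {F : E → 𝒰 → E}
    {Fk : ℕ → E → 𝒰 → E} {C : ℕ → ℝ} {A : Params E} {n : ℕ}
    (hC1 : LevelAssumption P U p F Fk C A) (hε : 0 < A.ε n)
    (hFint : ∀ θ, Integrable (fun ω => F θ (U ω)) P)
    (hFkint : ∀ k, ∀ θ, Integrable (fun ω => Fk k θ (U ω)) P) (θ : E) :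
    ‖levelMean P U A Fk n θ - meanField P U F θ‖ ≤ A.ε n := by
  have hM := hC1.one_lt_M
  have hM0 : 0 < A.M := by linarith
  have hα := hC1.α_pos
  have hΓ := hC1.Γ₂_pos θ
  unfold levelMean meanField
  rw [← integral_sub (hFkint _ θ) (hFint θ)]
  refine (hC1.bias _ (one_le_maxLevel A n θ) θ).trans ?_
  have h1 : (1 / A.α) * Real.logb A.M (A.Γ₂ θ / A.ε n) ≤ (maxLevel A n θ : ℝ) :=
    (Nat.le_ceil _).trans (by exact_mod_cast le_max_right _ _)
  have h2 : Real.logb A.M (A.Γ₂ θ / A.ε n) ≤ (maxLevel A n θ : ℝ) * A.α := by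
    rw [one_div, ← div_eq_inv_mul, div_le_iff₀ hα] at h1; exact h1
  rw [Real.logb_le_iff_le_rpow hM (by positivity), div_le_iff₀ hε] at h2
  rw [neg_mul, Real.rpow_neg hM0.le, ← div_eq_mul_inv, div_le_iff₀ (by positivity)]
  linarith

/-- The centered, weighted summand of the multilevel estimator with index `(k, l)` (shifted by one),
at a fixed parameter `θ`. -/
noncomputable def centeredTerm {E Ω 𝒰 : Type*} [NormedAddCommGroup E] [NormedSpace ℝ E]
    [MeasurableSpace Ω] (P : Measure Ω) (U : Ω → 𝒰) (A : Params E) (Fk : ℕ → E → 𝒰 → E)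
    (n : ℕ) (θ : E) (k : ℕ) (u : 𝒰) : E :=
  (1 / (numIter A n (k + 1) θ : ℝ)) • (Fk (k + 1) θ u - Fk k θ u
    - ∫ ω', (Fk (k + 1) θ (U ω') - Fk k θ (U ω')) ∂P)

lemma blockEstimator_sub_levelMean {E Ω 𝒰 : Type*} [NormedAddCommGroup E] [NormedSpace ℝ E]
    [MeasurableSpace E] [MeasurableSpace Ω] {P : Measure Ω} {U : Ω → 𝒰} {p : ℝ} {F : E → 𝒰 → E}
    {Fk : ℕ → E → 𝒰 → E} {C : ℕ → ℝ} {A : Params E} {n : ℕ}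
    (hC1 : LevelAssumption P U p F Fk C A) (hσ : 0 < A.σ n)
    (hFk0 : ∀ θ u, Fk 0 θ u = 0)
    (hFkint : ∀ k, ∀ θ, Integrable (fun ω => Fk k θ (U ω)) P) (θ : E) (w : ℕ × ℕ → 𝒰) :
    blockEstimator A Fk n θ w - levelMean P U A Fk n θ
      = ∑ i ∈ (Finset.range (maxLevel A n θ)).sigma
          (fun k => Finset.range (numIter A n (k + 1) θ)),
        centeredTerm P U A Fk n θ i.1 (w (i.1, i.2)) := by
  rw [Finset.sum_sigma]
  have h1 : levelMean P U A Fk n θ = ∑ k ∈ Finset.range (maxLevel A n θ),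
      ∫ ω', (Fk (k + 1) θ (U ω') - Fk k θ (U ω')) ∂P := by
    simp_rw [integral_sub (hFkint _ θ) (hFkint _ θ)]
    rw [Finset.sum_range_sub (fun k => ∫ ω, Fk k θ (U ω) ∂P)]
    simp [levelMean, hFk0]
  rw [h1, blockEstimator, ← Finset.sum_sub_distrib]
  refine Finset.sum_congr rfl fun k _ => ?_
  have hN : (numIter A n (k + 1) θ : ℝ) ≠ 0 := by
    have := one_le_numIter hC1.Γ₁_pos hC1.one_lt_M hσ (k + 1) θ
    positivity
  simp only [centeredTerm]
  rw [← Finset.smul_sum, Finset.sum_sub_distrib (g := fun _ => _), Finset.sum_const, Finset.card_range, smul_sub,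
    ← Nat.cast_smul_eq_nsmul ℝ, smul_smul, one_div, inv_mul_cancel₀ hN, one_smul]

lemma measurable_sampleBlock {Ω 𝒰 : Type*} [MeasurableSpace Ω] [MeasurableSpace 𝒰]
    {V : ℕ → ℕ → ℕ → Ω → 𝒰} {n : ℕ}
    (hVmeas : ∀ n k l, 1 ≤ n → 1 ≤ k → 1 ≤ l → Measurable (V n k l))
    (hn : 1 ≤ n) : Measurable (sampleBlock V n) :=
  measurable_pi_lambda _ fun i => hVmeas n _ _ hn (by omega) (by omega)

section

variable {E : Type*} [NormedAddCommGroup E] [InnerProductSpace ℝ E] [FiniteDimensional ℝ E]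
  [MeasurableSpace E] [BorelSpace E] {Ω 𝒰 : Type*} [MeasurableSpace Ω] [MeasurableSpace 𝒰]
  {P : Measure Ω} {U : Ω → 𝒰} {p : ℝ} {F : E → 𝒰 → E} {Fk : ℕ → E → 𝒰 → E} {C : ℕ → ℝ}
  {A : Params E} {V : ℕ → ℕ → ℕ → Ω → 𝒰} {n : ℕ}

/-- Sums with a measurable number of terms are measurable. -/
lemma measurable_sum_range_nat {α G : Type*} [MeasurableSpace α] [NormedAddCommGroup G]
    [MeasurableSpace G] [BorelSpace G] [SecondCountableTopology G] {m : α → ℕ}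
    (hm : Measurable m) {g : ℕ → α → G} (hg : ∀ k, Measurable (g k)) :
    Measurable fun z => ∑ k ∈ Finset.range (m z), g k z := by
  have h : Measurable fun x : α × ℕ => ∑ k ∈ Finset.range x.2, g k x.1 :=
    measurable_from_prod_countable_left fun j => by
      exact Finset.measurable_sum (Finset.range j) fun k _ => hg k
  exact h.comp (measurable_id.prodMk hm)

lemma measurable_blockEstimator (hΓ₁ : Measurable A.Γ₁) (hΓ₂ : Measurable A.Γ₂)
    (hFk : ∀ k, Measurable (fun x : E × 𝒰 => Fk k x.1 x.2)) (n : ℕ) :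
    Measurable fun z : E × (ℕ × ℕ → 𝒰) => blockEstimator A Fk n z.1 z.2 := by
  refine measurable_sum_range_nat ((measurable_maxLevel hΓ₂ n).comp measurable_fst) fun k => ?_
  have hN : Measurable fun z : E × (ℕ × ℕ → 𝒰) => numIter A n (k + 1) z.1 :=
    (measurable_numIter hΓ₁ hΓ₂ n (k + 1)).comp measurable_fst
  have hN' : Measurable fun z : E × (ℕ × ℕ → 𝒰) => 1 / (numIter A n (k + 1) z.1 : ℝ) :=
    (measurable_from_nat (f := fun j : ℕ => 1 / (j : ℝ))).comp hN
  refine hN'.smul (measurable_sum_range_nat hN fun l => ?_)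
  have h : Measurable fun z : E × (ℕ × ℕ → 𝒰) => (z.1, z.2 (k, l)) :=
    measurable_fst.prodMk ((measurable_pi_apply (k, l)).comp measurable_snd)
  exact ((hFk (k + 1)).comp h).sub ((hFk k).comp h)

lemma measurable_levelMean [IsProbabilityMeasure P] (hU : Measurable U) (hΓ₂ : Measurable A.Γ₂)
    (hFk : ∀ k, Measurable (fun x : E × 𝒰 => Fk k x.1 x.2)) (n : ℕ) :
    Measurable (levelMean P U A Fk n) := by
  have h : Measurable fun x : E × ℕ => ∫ ω, Fk x.2 x.1 (U ω) ∂P := by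
    refine measurable_from_prod_countable_left fun k => ?_
    have h1 : Measurable fun z : E × Ω => Fk k z.1 (U z.2) :=
      (hFk k).comp (measurable_fst.prodMk (hU.comp measurable_snd))
    exact (h1.stronglyMeasurable.integral_prod_right (ν := P)).measurable
  exact h.comp (measurable_id.prodMk (measurable_maxLevel hΓ₂ n))

/-- The noise of the multilevel estimator: it is centered, and its `L^p`-norm is at most a multiple
of `σ_n`, uniformly in the parameter. -/
theorem exists_noise_bound [IsProbabilityMeasure P] (hp : 2 ≤ p)
    (hC1 : LevelAssumption P U p F Fk C A)
    (hFk0 : ∀ θ u, Fk 0 θ u = 0) (hFk : ∀ k, Measurable (fun x : E × 𝒰 => Fk k x.1 x.2))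
    (hFkint : ∀ k, ∀ θ, Integrable (fun ω => Fk k θ (U ω)) P)
    (hVmeas : ∀ n k l, 1 ≤ n → 1 ≤ k → 1 ≤ l → Measurable (V n k l))
    (hVlaw : ∀ n k l, 1 ≤ n → 1 ≤ k → 1 ≤ l → IdentDistrib (V n k l) U P P)
    (hVindep : iIndepFun (fun i : ℕ × ℕ × ℕ => V (i.1 + 1) (i.2.1 + 1) (i.2.2 + 1)) P) :
    ∃ c : ℝ, 0 < c ∧ ∀ n : ℕ, 1 ≤ n → 0 < A.σ n → ∀ θ : E,
      MemLp (fun ω => blockEstimator A Fk n θ (sampleBlock V n ω) - levelMean P U A Fk n θ)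
        (ENNReal.ofReal p) P ∧
      ∫ ω, (blockEstimator A Fk n θ (sampleBlock V n ω) - levelMean P U A Fk n θ) ∂P = 0 ∧
      lpNorm (fun ω => blockEstimator A Fk n θ (sampleBlock V n ω) - levelMean P U A Fk n θ)
        (ENNReal.ofReal p) P ≤ c * A.σ n := by
  obtain ⟨C₀, hC₀⟩ := exists_norm_add_rpow_le E hp
  have hC₀ : IsSmoothConst E p C₀ := hC₀
  obtain ⟨c, hc, hlev⟩ := exists_sum_level_le A hC1.one_lt_M
  have hC₀1 := hC₀.1
  refine ⟨Real.sqrt (2 * C₀ * c), by positivity, fun n hn hσ θ => ?_⟩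
  have hp1 : (1 : ℝ≥0∞) ≤ ENNReal.ofReal p := by
    rw [ENNReal.one_le_ofReal]; linarith
  have hM := hC1.one_lt_M
  have hM0 : 0 < A.M := by linarith
  have hΓ := hC1.Γ₁_pos θ
  -- a sigma type as index set, since the number of replications depends on the level
  set X : (Σ _ : ℕ, ℕ) → Ω → E := fun i ω =>
    centeredTerm P U A Fk n θ i.1 (V n (i.1 + 1) (i.2 + 1) ω) with hX
  have hDm : ∀ k, Measurable (centeredTerm P U A Fk n θ k) := fun k =>
    ((((hFk (k + 1)).comp measurable_prodMk_left).sub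
      ((hFk k).comp measurable_prodMk_left)).sub measurable_const).const_smul _
  have hXm : ∀ i, Measurable (X i) := fun i =>
    (hDm i.1).comp (hVmeas n _ _ hn (by omega) (by omega))
  have hXlaw : ∀ i, IdentDistrib (X i) (fun ω => centeredTerm P U A Fk n θ i.1 (U ω)) P P :=
    fun i => (hVlaw n _ _ hn (by omega) (by omega)).comp (hDm i.1)
  have hindV : iIndepFun (fun i : (Σ _ : ℕ, ℕ) => V n (i.1 + 1) (i.2 + 1)) P := by
    have := hVindep.precomp (g := fun i : (Σ _ : ℕ, ℕ) => (n - 1, i.1, i.2)) (by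
      rintro ⟨a, b⟩ ⟨a', b'⟩ h
      simp only [Prod.mk.injEq, true_and] at h
      obtain ⟨rfl, rfl⟩ := h
      rfl)
    simpa only [Function.comp_def, Nat.sub_add_cancel hn] using this
  have hind : iIndepFun X P := hindV.comp (fun i => centeredTerm P U A Fk n θ i.1) fun i => hDm i.1
  have hcoef : ∀ k, 0 < (numIter A n (k + 1) θ : ℝ) := fun k => by
    exact_mod_cast one_le_numIter hC1.Γ₁_pos hM hσ (k + 1) θ
  have hel : ∀ i, eLpNorm (X i) (ENNReal.ofReal p) P ≤ ENNReal.ofReal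
      (1 / (numIter A n (i.1 + 1) θ : ℝ) * (A.Γ₁ θ * A.M ^ (-((i.1 : ℝ) + 1) * A.β))) := by
    intro i
    rw [(hXlaw i).eLpNorm_eq]
    have := hC1.moment (i.1 + 1) (by omega) θ
    rw [Nat.add_sub_cancel] at this
    have e : (fun ω => centeredTerm P U A Fk n θ i.1 (U ω))
        = (1 / (numIter A n (i.1 + 1) θ : ℝ)) • fun ω => (Fk (i.1 + 1) θ (U ω) - Fk i.1 θ (U ω)
          - ∫ ω', (Fk (i.1 + 1) θ (U ω') - Fk i.1 θ (U ω')) ∂P) := rfl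
    rw [e, eLpNorm_const_smul, ENNReal.ofReal_mul (by positivity), Real.enorm_of_nonneg
      (by positivity)]
    gcongr
    simpa using this
  have hXL : ∀ i, MemLp (X i) (ENNReal.ofReal p) P := fun i =>
    ⟨(hXm i).aestronglyMeasurable, (hel i).trans_lt ENNReal.ofReal_lt_top⟩
  have hXlp : ∀ i, lpNorm (X i) (ENNReal.ofReal p) P
      ≤ 1 / (numIter A n (i.1 + 1) θ : ℝ) * (A.Γ₁ θ * A.M ^ (-((i.1 : ℝ) + 1) * A.β)) := fun i => by
    rw [← toReal_eLpNorm (hXm i).aestronglyMeasurable]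
    exact ENNReal.toReal_le_of_le_ofReal (by positivity) (hel i)
  have hXz : ∀ i, ∫ ω, X i ω ∂P = 0 := by
    intro i
    rw [(hXlaw i).integral_eq]
    simp only [centeredTerm]
    have hs : Integrable (fun ω => Fk (i.1 + 1) θ (U ω) - Fk i.1 θ (U ω)) P :=
      (hFkint _ θ).sub (hFkint _ θ)
    rw [integral_smul, integral_sub hs (integrable_const _)]
    simp
  set S := (Finset.range (maxLevel A n θ)).sigma (fun k => Finset.range (numIter A n (k + 1) θ))
    with hS
  have hZ : (fun ω => blockEstimator A Fk n θ (sampleBlock V n ω) - levelMean P U A Fk n θ)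
      = ∑ i ∈ S, X i := by
    funext ω
    rw [blockEstimator_sub_levelMean hC1 hσ hFk0 hFkint, Finset.sum_apply]
    rfl
  rw [hZ]
  refine ⟨memLp_finsetSum' S fun i _ => hXL i, ?_, ?_⟩
  · have e : (fun ω => (∑ i ∈ S, X i) ω) = fun ω => ∑ i ∈ S, X i ω :=
      funext fun ω => Finset.sum_apply _ _ _
    show ∫ ω, (∑ i ∈ S, X i) ω ∂P = 0
    rw [e, integral_finsetSum S fun i _ => (hXL i).integrable hp1]
    exact Finset.sum_eq_zero fun i _ => hXz i
  · have hsq := lpNorm_sum_sq_le_of_iIndepFun hp hC₀ hind hXm hXL hXz S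
    refine abs_le_of_sq_le_sq' ?_ (by positivity) |>.2
    refine hsq.trans ?_
    rw [mul_pow, Real.sq_sqrt (by positivity), mul_assoc (2 * C₀)]
    gcongr
    have hκ := kappa_pos hC1.Γ₁_pos hM hσ θ
    have hw := levelWeight_pos A hM (one_le_maxLevel A n θ)
    calc ∑ i ∈ S, lpNorm (X i) (ENNReal.ofReal p) P ^ 2
        ≤ ∑ i ∈ S, (1 / (numIter A n (i.1 + 1) θ : ℝ)
            * (A.Γ₁ θ * A.M ^ (-((i.1 : ℝ) + 1) * A.β))) ^ 2 := by
          exact Finset.sum_le_sum fun i _ => pow_le_pow_left₀ lpNorm_nonneg (hXlp i) 2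
      _ = ∑ k ∈ Finset.range (maxLevel A n θ), (numIter A n (k + 1) θ : ℝ)
            * (1 / (numIter A n (k + 1) θ : ℝ) * (A.Γ₁ θ * A.M ^ (-((k : ℝ) + 1) * A.β))) ^ 2 := by
          rw [hS, Finset.sum_sigma]
          refine Finset.sum_congr rfl fun k _ => ?_
          simp
      _ ≤ ∑ k ∈ Finset.range (maxLevel A n θ), A.Γ₁ θ ^ 2 / kappa A n θ
            * A.M ^ (((k : ℝ) + 1) * (1 / 2 - A.β)) := by
          refine Finset.sum_le_sum fun k _ => ?_
          have hNk := hcoef k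
          have hle : kappa A n θ * A.M ^ (-((k : ℝ) + 1) * (A.β + 1 / 2))
              ≤ (numIter A n (k + 1) θ : ℝ) := by
            have : kappa A n θ * A.M ^ (-((k + 1 : ℕ) : ℝ) * (A.β + 1 / 2))
                ≤ (numIter A n (k + 1) θ : ℝ) := Nat.le_ceil _
            push_cast at this
            exact this
          have e1 : (A.M ^ (-((k : ℝ) + 1) * A.β)) ^ 2
              = A.M ^ (((k : ℝ) + 1) * (1 / 2 - A.β))
                * A.M ^ (-((k : ℝ) + 1) * (A.β + 1 / 2)) := by
            rw [← Real.rpow_natCast, ← Real.rpow_mul hM0.le, ← Real.rpow_add hM0]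
            congr 1; push_cast; ring
          calc _ = A.Γ₁ θ ^ 2 * (A.M ^ (-((k : ℝ) + 1) * A.β)) ^ 2
                / (numIter A n (k + 1) θ : ℝ) := by field_simp
            _ ≤ A.Γ₁ θ ^ 2 * (A.M ^ (-((k : ℝ) + 1) * A.β)) ^ 2
                / (kappa A n θ * A.M ^ (-((k : ℝ) + 1) * (A.β + 1 / 2))) := by gcongr
            _ = _ := by rw [e1]; field_simp
      _ ≤ A.Γ₁ θ ^ 2 / kappa A n θ * (c * levelWeight A (maxLevel A n θ)) := by
          rw [← Finset.mul_sum]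
          gcongr
          exact hlev _
      _ = c * A.σ n ^ 2 := by
          rw [kappa_eq]; field_simp

end

/-! ### Perturbed Robbins-Monro schemes -/

section

variable {E Ω : Type*} [NormedAddCommGroup E] [MeasurableSpace Ω] {P : Measure Ω}
  [IsProbabilityMeasure P]

lemma lpNorm_mono_exponent {f : Ω → E} {p q : ℝ≥0∞} (hpq : p ≤ q) (hf : MemLp f q P) :
    lpNorm f p P ≤ lpNorm f q P := by
  rw [← toReal_eLpNorm hf.1, ← toReal_eLpNorm hf.1]
  exact ENNReal.toReal_mono hf.eLpNorm_ne_top (eLpNorm_le_eLpNorm_of_exponent_le hpq hf.1)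

lemma lpNorm_const_smul_eq [NormedSpace ℝ E] {P : Measure Ω} {f : Ω → E} {p : ℝ≥0∞} (c : ℝ) :
    lpNorm (c • f) p P = |c| * lpNorm f p P := by
  rw [lpNorm_const_smul]; rfl

lemma lpNorm_le_of_norm_le {F : Type*} [NormedAddCommGroup F] {f : Ω → E} {g : Ω → F} {p : ℝ≥0∞} {a b : ℝ} (hp : 1 ≤ p)
    (hg : MemLp g p P) (ha : 0 ≤ a) (hb : 0 ≤ b) (h : ∀ ω, ‖f ω‖ ≤ a * ‖g ω‖ + b) :
    lpNorm f p P ≤ a * lpNorm g p P + b := by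
  have h1 : MemLp (fun ω => a * ‖g ω‖) p P := hg.norm.const_mul a
  have h2 : MemLp (fun _ : Ω => b) p P := memLp_const b
  refine (lpNorm_mono_real (h1.add h2) h).trans ((lpNorm_add_le h1 hp).trans ?_)
  have e1 : lpNorm (fun ω => a * ‖g ω‖) p P = a * lpNorm g p P := by
    have := lpNorm_const_smul (p := p) a (fun ω => ‖g ω‖) P
    rw [lpNorm_norm hg.1, coe_nnnorm, Real.norm_of_nonneg ha] at this
    exact this
  have e2 : lpNorm (fun _ : Ω => b) p P = b := by
    rw [lpNorm_const (by positivity) (IsProbabilityMeasure.ne_zero P)]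
    simp [abs_of_nonneg hb]
  rw [e1, e2]

end

/-- A recursion `X_{n+1} = X_n + γ_{n+1} (f(X_n) + B_{n+1} + N_{n+1})` whose perturbations `B_{n+1}`
are known at time `n`, and whose perturbations `N_{n+1}` are in `L^p` and conditionally centered
given the past `ℱ n`. The latter is encoded by orthogonality to all `ℱ n`-measurable functions. -/
structure PerturbedScheme {Ω E : Type*} [mΩ : MeasurableSpace Ω] [NormedAddCommGroup E]
    [InnerProductSpace ℝ E] [MeasurableSpace E] (P : Measure Ω) (p : ℝ)
    (ℱ : ℕ → MeasurableSpace Ω) (f : E → E) (γ : ℕ → ℝ) (X B N : ℕ → Ω → E) : Prop where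
  le : ∀ n, ℱ n ≤ mΩ
  mono : ∀ n, ℱ n ≤ ℱ (n + 1)
  measurable_f : Measurable f
  measurable_X : ∀ n, Measurable[ℱ n] (X n)
  measurable_B : ∀ n, Measurable[ℱ n] (B (n + 1))
  measurable_N : ∀ n, Measurable[ℱ (n + 1)] (N (n + 1))
  memLp_zero : MemLp (X 0) (ENNReal.ofReal p) P
  memLp_N : ∀ n, MemLp (N (n + 1)) (ENNReal.ofReal p) P
  step : ∀ n ω, X (n + 1) ω = X n ω + γ (n + 1) • (f (X n ω) + B (n + 1) ω + N (n + 1) ω)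
  orth : ∀ n (Y : Ω → E), Measurable[ℱ n] Y →
    Integrable (fun ω => inner ℝ (Y ω) (N (n + 1) ω)) P → ∫ ω, inner ℝ (Y ω) (N (n + 1) ω) ∂P = 0

section

variable {E : Type*} [NormedAddCommGroup E] [InnerProductSpace ℝ E]

/-- The two one-sided conditions on `f` turn `x ↦ x + γ f(x)` into a contraction for small `γ`. -/
lemma norm_add_smul_le {x v : E} {g L L' : ℝ} (hg : 0 ≤ g)
    (h1 : inner ℝ x v ≤ -L * ‖x‖ ^ 2) (h2 : inner ℝ x v ≤ -L' * ‖v‖ ^ 2) (hgL' : g ≤ L')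
    (hgL : g * L ≤ 1) : ‖x + g • v‖ ≤ (1 - g * L / 2) * ‖x‖ := by
  have hfac : 0 ≤ 1 - g * L / 2 := by linarith
  refine abs_le_of_sq_le_sq' ?_ (by positivity) |>.2
  rw [norm_add_sq_real, inner_smul_right, norm_smul, Real.norm_of_nonneg hg, mul_pow, mul_pow]
  have h3 : g ^ 2 * ‖v‖ ^ 2 ≤ g * (L' * ‖v‖ ^ 2) := by
    rw [pow_two g, mul_assoc]
    gcongr
  have h4 := mul_le_mul_of_nonneg_left h1 hg
  have h5 := mul_le_mul_of_nonneg_left h2 hg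
  nlinarith [sq_nonneg (g * L / 2 * ‖x‖)]

lemma norm_le_of_inner_le {x v : E} {L' : ℝ} (hL' : 0 < L')
    (h2 : inner ℝ x v ≤ -L' * ‖v‖ ^ 2) : ‖v‖ ≤ 1 / L' * ‖x‖ := by
  have h := (abs_le.1 (abs_real_inner_le_norm x v)).1
  rw [one_div_mul_eq_div, le_div_iff₀ hL']
  rcases (norm_nonneg v).eq_or_lt with h0 | h0
  · rw [← h0]; simp
  · nlinarith

end

section

variable {E : Type*} [NormedAddCommGroup E] [InnerProductSpace ℝ E] [FiniteDimensional ℝ E]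
  [MeasurableSpace E] [BorelSpace E] {Ω : Type*} [mΩ : MeasurableSpace Ω]
  {P : Measure Ω} {p : ℝ} {ℱ : ℕ → MeasurableSpace Ω} {f : E → E}
  {γ : ℕ → ℝ} {X B N : ℕ → Ω → E}

namespace PerturbedScheme

lemma integral_inner_smul (hS : PerturbedScheme P p ℱ f γ X B N) (hp : 2 ≤ p) {n : ℕ} {Y : Ω → E}
    (hYm : Measurable[ℱ n] Y) (hY : MemLp Y (ENNReal.ofReal p) P) (a : ℝ) :
    ∫ ω, inner ℝ (‖Y ω‖ ^ (p - 2) • Y ω) ((a • N (n + 1)) ω) ∂P = 0 := by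
  simp only [Pi.smul_apply, inner_smul_right]
  rw [integral_const_mul, hS.orth n (fun ω => ‖Y ω‖ ^ (p - 2) • Y ω)
    ((by fun_prop : Measurable fun x : E => ‖x‖ ^ (p - 2) • x).comp hYm) (integrable_inner_rpow hp hY (hS.memLp_N n)), mul_zero]

variable [IsProbabilityMeasure P] {L L' : ℝ}

lemma memLp_drift (hS : PerturbedScheme P p ℱ f γ X B N)
    (hL' : 0 < L') (h2 : ∀ x, inner ℝ x (f x) ≤ -L' * ‖f x‖ ^ 2)
    {ε : ℕ → ℝ} (hB : ∀ n ω, ‖B (n + 1) ω‖ ≤ ε (n + 1)) {n : ℕ}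
    (hX : MemLp (X n) (ENNReal.ofReal p) P) :
    MemLp (fun ω => f (X n ω) + B (n + 1) ω) (ENNReal.ofReal p) P := by
  have hXm : Measurable (X n) := (hS.measurable_X n).mono (hS.le n) le_rfl
  have hBm : Measurable (B (n + 1)) := (hS.measurable_B n).mono (hS.le n) le_rfl
  refine MemLp.add ?_ ?_
  · refine (hX.const_smul (1 / L')).of_le (hS.measurable_f.comp hXm).aestronglyMeasurable
      (Filter.Eventually.of_forall fun ω => ?_)
    rw [Pi.smul_apply, norm_smul, Real.norm_of_nonneg (by positivity)]
    exact norm_le_of_inner_le hL' (h2 _)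
  · exact MemLp.of_bound hBm.aestronglyMeasurable (ε (n + 1))
      (Filter.Eventually.of_forall fun ω => hB n ω)

lemma memLp_X (hS : PerturbedScheme P p ℱ f γ X B N)
    (hL' : 0 < L') (h2 : ∀ x, inner ℝ x (f x) ≤ -L' * ‖f x‖ ^ 2)
    {ε : ℕ → ℝ} (hB : ∀ n ω, ‖B (n + 1) ω‖ ≤ ε (n + 1)) (n : ℕ) :
    MemLp (X n) (ENNReal.ofReal p) P := by
  induction n with
  | zero => exact hS.memLp_zero
  | succ n ih =>
    have e : X (n + 1) = X n + γ (n + 1) • ((fun ω => f (X n ω) + B (n + 1) ω) + N (n + 1)) :=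
      funext fun ω => hS.step n ω
    rw [e]
    exact ih.add (((hS.memLp_drift hL' h2 hB ih).add (hS.memLp_N n)).const_smul _)

lemma lpNorm_sq_succ_le (hS : PerturbedScheme P p ℱ f γ X B N) {C : ℝ} (hp : 2 ≤ p)
    (hC : IsSmoothConst E p C) (hL : 0 < L) (hL' : 0 < L')
    (h1 : ∀ x, inner ℝ x (f x) ≤ -L * ‖x‖ ^ 2)
    (h2 : ∀ x, inner ℝ x (f x) ≤ -L' * ‖f x‖ ^ 2)
    {ε : ℕ → ℝ} (hB : ∀ n ω, ‖B (n + 1) ω‖ ≤ ε (n + 1)) {n : ℕ}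
    (hγ0 : 0 < γ (n + 1)) (hγL' : γ (n + 1) ≤ L') (hγL : γ (n + 1) * L ≤ 1) :
    lpNorm (X (n + 1)) (ENNReal.ofReal p) P ^ 2
      ≤ (1 - γ (n + 1) * L / 2) * lpNorm (X n) (ENNReal.ofReal p) P ^ 2
        + γ (n + 1) * (2 / L * ε (n + 1) ^ 2
          + 2 * C * (γ (n + 1) * lpNorm (N (n + 1)) (ENNReal.ofReal p) P ^ 2)) := by
  set g := γ (n + 1) with hg
  have hp1 : (1 : ℝ≥0∞) ≤ ENNReal.ofReal p := by
    rw [ENNReal.one_le_ofReal]; linarith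
  have hε : 0 ≤ ε (n + 1) := by
    obtain ⟨ω⟩ := nonempty_of_isProbabilityMeasure P
    exact (norm_nonneg _).trans (hB n ω)
  have hXL := hS.memLp_X hL' h2 hB n
  set Y : Ω → E := fun ω => X n ω + g • (f (X n ω) + B (n + 1) ω) with hY
  have hYL : MemLp Y (ENNReal.ofReal p) P :=
    hXL.add ((hS.memLp_drift hL' h2 hB hXL).const_smul g)
  have hYm : Measurable[ℱ n] Y :=
    (hS.measurable_X n).add (((hS.measurable_f.comp (hS.measurable_X n)).add
      (hS.measurable_B n)).const_smul g)
  have e : X (n + 1) = Y + g • N (n + 1) := by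
    funext ω
    rw [hS.step n ω]
    simp only [hY, Pi.add_apply, Pi.smul_apply, smul_add, ← hg]
    abel
  have hYle : lpNorm Y (ENNReal.ofReal p) P
      ≤ (1 - g * L / 2) * lpNorm (X n) (ENNReal.ofReal p) P + g * ε (n + 1) := by
    refine lpNorm_le_of_norm_le hp1 hXL (by linarith) (by positivity) fun ω => ?_
    have := norm_add_smul_le hγ0.le (h1 (X n ω)) (h2 (X n ω)) hγL' hγL
    calc ‖Y ω‖ = ‖(X n ω + g • f (X n ω)) + g • B (n + 1) ω‖ := by
          simp only [hY, smul_add]; congr 1; abel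
      _ ≤ _ := norm_add_le _ _
      _ ≤ _ := by
          rw [norm_smul, Real.norm_of_nonneg hγ0.le]
          exact add_le_add this (mul_le_mul_of_nonneg_left (hB n ω) hγ0.le)
  have h := lpNorm_add_sq_le hp hC hYL ((hS.memLp_N n).const_smul g)
    (hS.integral_inner_smul hp hYm hYL g)
  rw [← e, lpNorm_const_smul_eq, abs_of_pos hγ0] at h
  set a := lpNorm (X n) (ENNReal.ofReal p) P
  set s := g * L / 2 with hs
  have hs0 : 0 < s := by positivity
  have hs1 : s ≤ 1 := by linarith
  have hY2 : lpNorm Y (ENNReal.ofReal p) P ^ 2 ≤ ((1 - s) * a + g * ε (n + 1)) ^ 2 :=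
    pow_le_pow_left₀ lpNorm_nonneg hYle 2
  -- convexity of the square, for the convex combination `(1 - s) a + s (2 ε / L)`
  have hconv : ((1 - s) * a + g * ε (n + 1)) ^ 2
      ≤ (1 - s) * a ^ 2 + g * (2 / L * ε (n + 1) ^ 2) := by
    have e1 : g * ε (n + 1) = s * (2 / L * ε (n + 1)) := by rw [hs]; field_simp
    have e2 : g * (2 / L * ε (n + 1) ^ 2) = s * (2 / L * ε (n + 1)) ^ 2 := by
      rw [hs]; field_simp
    rw [e1, e2]
    nlinarith [mul_nonneg (mul_nonneg hs0.le (sub_nonneg.2 hs1))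
      (sq_nonneg (a - 2 / L * ε (n + 1)))]
  nlinarith

open Filter Topology in
/-- The `L^p`-rate `n ^ (-(r₁ + r₂) / 2)` of the scheme, in squared form. -/
theorem exists_lpNorm_sq_le (hS : PerturbedScheme P p ℱ f γ X B N) (hp : 2 ≤ p)
    (hL : 0 < L) (hL' : 0 < L')
    (h1 : ∀ x, inner ℝ x (f x) ≤ -L * ‖x‖ ^ 2)
    (h2 : ∀ x, inner ℝ x (f x) ≤ -L' * ‖f x‖ ^ 2)
    {ε : ℕ → ℝ} (hB : ∀ n ω, ‖B (n + 1) ω‖ ≤ ε (n + 1))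
    {γ₀ r₁ r₂ e s : ℝ} (hγ₀ : 0 < γ₀) (hr₁ : 0 < r₁) (hr₁' : r₁ < 1) (hr₂ : 0 < r₁ + r₂)
    (hγ : ∀ n : ℕ, γ (n + 1) = γ₀ * ((n : ℝ) + 1) ^ (-r₁)) (he : 0 ≤ e) (hs : 0 ≤ s)
    (hε : ∀ n : ℕ, ε (n + 1) ^ 2 ≤ e * ((n : ℝ) + 1) ^ (-(r₁ + r₂)))
    (hσ : ∀ n : ℕ, lpNorm (N (n + 1)) (ENNReal.ofReal p) P ^ 2 ≤ s * ((n : ℝ) + 1) ^ (-r₂)) :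
    ∃ D : ℝ, 0 < D ∧ ∀ n : ℕ, 1 ≤ n →
      lpNorm (X n) (ENNReal.ofReal p) P ^ 2 ≤ D * (n : ℝ) ^ (-(r₁ + r₂)) := by
  obtain ⟨C, hC⟩ := exists_norm_add_rpow_le E hp
  have hC : IsSmoothConst E p C := hC
  have hC1 := hC.1
  have hlim : Tendsto (fun n : ℕ => γ (n + 1)) atTop (𝓝 0) := by
    simp_rw [hγ]
    have := ((tendsto_rpow_neg_atTop hr₁).comp (tendsto_atTop_add_const_right atTop (1 : ℝ)
      tendsto_natCast_atTop_atTop)).const_mul γ₀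
    simpa using this
  refine exists_le_rpow_of_recursion (c := γ₀ * L / 2)
    (C := γ₀ * (2 / L * e + 2 * C * (γ₀ * s))) (by positivity) (by positivity) hr₁ hr₁' hr₂ ?_
  filter_upwards [hlim.eventually (gt_mem_nhds hL'),
    hlim.eventually (gt_mem_nhds (by positivity : 0 < 1 / L))] with n ha hb
  have hg0 : 0 < γ (n + 1) := by rw [hγ]; positivity
  rw [lt_div_iff₀ hL] at hb
  refine (hS.lpNorm_sq_succ_le hp hC hL hL' h1 h2 hB hg0 ha.le hb.le).trans ?_
  have hεn := hε n
  have hσn := hσ n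
  have hsplit : ((n : ℝ) + 1) ^ (-(r₁ + r₂)) = ((n : ℝ) + 1) ^ (-r₁) * ((n : ℝ) + 1) ^ (-r₂) := by
    rw [← Real.rpow_add (by positivity)]; congr 1; ring
  have hpos : 0 ≤ ((n : ℝ) + 1) ^ (-r₁) := by positivity
  calc _ ≤ (1 - γ (n + 1) * L / 2) * lpNorm (X n) (ENNReal.ofReal p) P ^ 2
        + γ (n + 1) * (2 / L * (e * ((n : ℝ) + 1) ^ (-(r₁ + r₂)))
          + 2 * C * (γ (n + 1) * (s * ((n : ℝ) + 1) ^ (-r₂)))) := by gcongr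
    _ = _ := by rw [hγ, hsplit]; ring

/-- Weighted sums of the noise terms are martingales, so their squared `L^p`-norms add up. -/
lemma lpNorm_sum_noise_sq_le (hS : PerturbedScheme P p ℱ f γ X B N) {C : ℝ} (hp : 2 ≤ p)
    (hC : IsSmoothConst E p C) (a : ℕ → ℝ) (n : ℕ) :
    lpNorm (∑ k ∈ Finset.Icc 1 n, a k • N (k + 1)) (ENNReal.ofReal p) P ^ 2
      ≤ 2 * C * ∑ k ∈ Finset.Icc 1 n, a k ^ 2 * lpNorm (N (k + 1)) (ENNReal.ofReal p) P ^ 2 := by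
  have hmem : ∀ n, MemLp (∑ k ∈ Finset.Icc 1 n, a k • N (k + 1)) (ENNReal.ofReal p) P :=
    fun n => memLp_finsetSum' _ fun k _ => (hS.memLp_N k).const_smul _
  have hmeas : ∀ n, Measurable[ℱ (n + 1)] (∑ k ∈ Finset.Icc 1 n, a k • N (k + 1)) := by
    intro n
    induction n with
    | zero => simp only [Finset.Icc_eq_empty (by norm_num : ¬ (1 ≤ 0)), Finset.sum_empty]
              exact @measurable_const _ _ _ (ℱ (0 + 1)) 0
    | succ n ih =>
      rw [Finset.sum_Icc_succ_top (by omega)]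
      exact (ih.mono (hS.mono _) le_rfl).add ((hS.measurable_N (n + 1)).const_smul _)
  induction n with
  | zero => simp
  | succ n ih =>
    rw [Finset.sum_Icc_succ_top (by omega), Finset.sum_Icc_succ_top (by omega), mul_add]
    have h := lpNorm_add_sq_le hp hC (hmem n) ((hS.memLp_N (n + 1)).const_smul (a (n + 1)))
      (hS.integral_inner_smul hp (hmeas n) (hmem n) (a (n + 1)))
    rw [lpNorm_const_smul_eq, mul_pow, sq_abs] at h
    linarith

end PerturbedScheme

end

/-! ### Averaging -/

lemma succ_rpow_le (a : ℝ) {k : ℕ} (hk : 1 ≤ k) :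
    ((k : ℝ) + 1) ^ a ≤ 2 ^ |a| * (k : ℝ) ^ a := by
  have hk' : (1 : ℝ) ≤ k := by exact_mod_cast hk
  rcases le_or_gt 0 a with ha | ha
  · rw [abs_of_nonneg ha, ← Real.mul_rpow (by norm_num) (by positivity)]
    exact Real.rpow_le_rpow (by positivity) (by linarith) ha
  · have h1 : ((k : ℝ) + 1) ^ a ≤ (k : ℝ) ^ a :=
      Real.rpow_le_rpow_of_nonpos (by positivity) (by linarith) ha.le
    have h2 : (1 : ℝ) ≤ 2 ^ |a| := Real.one_le_rpow (by norm_num) (abs_nonneg a)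
    have h3 : 0 ≤ (k : ℝ) ^ a := by positivity
    nlinarith

/-- Summation by parts. -/
lemma sum_smul_sub_eq {E : Type*} [AddCommGroup E] [Module ℝ E] (w : ℕ → ℝ) (x : ℕ → E) (n : ℕ) :
    ∑ k ∈ Finset.Icc 1 n, w k • (x (k + 1) - x k) = w (n + 1) • x (n + 1) - w 1 • x 1
      - ∑ k ∈ Finset.Icc 1 n, (w (k + 1) - w k) • x (k + 1) := by
  induction n with
  | zero => simp
  | succ n ih =>
    rw [Finset.sum_Icc_succ_top (by omega), Finset.sum_Icc_succ_top (by omega), ih]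
    module

/-- The weights `k ^ r₃ / γ_{k+1}` that arise when the linearised recursion is solved for `X_k`
have increments of order `k ^ (r₁ + r₃ - 1)`. -/
lemma exists_abs_weight_sub_le {r₁ : ℝ} (r₃ : ℝ) (hr₁' : r₁ < 1) :
    ∃ C : ℝ, 0 < C ∧ ∀ k : ℕ, 1 ≤ k →
      |((k : ℝ) + 1) ^ r₃ * ((k : ℝ) + 1 + 1) ^ r₁ - (k : ℝ) ^ r₃ * ((k : ℝ) + 1) ^ r₁|
        ≤ C * ((k : ℝ) + 1) ^ (r₁ + r₃ - 1) := by
  obtain ⟨C₁, hC₁, h₁⟩ := exists_abs_rpow_sub_le r₁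
  obtain ⟨C₃, hC₃, h₃⟩ := exists_abs_rpow_sub_le r₃
  refine ⟨C₁ + C₃, by positivity, fun k hk => ?_⟩
  have h1 := h₁ (k + 1) (by omega)
  have h3 := h₃ k hk
  push_cast at h1
  have hk0 : (0 : ℝ) < (k : ℝ) + 1 := by positivity
  have h1' : |((k : ℝ) + 1 + 1) ^ r₁ - ((k : ℝ) + 1) ^ r₁| ≤ C₁ * ((k : ℝ) + 1) ^ (r₁ - 1) := by
    refine h1.trans ?_
    have := Real.rpow_le_rpow_of_nonpos hk0 (by linarith : (k : ℝ) + 1 ≤ k + 1 + 1)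
      (by linarith : r₁ - 1 ≤ 0)
    gcongr
  have e : ((k : ℝ) + 1) ^ r₃ * ((k : ℝ) + 1 + 1) ^ r₁ - (k : ℝ) ^ r₃ * ((k : ℝ) + 1) ^ r₁
      = ((k : ℝ) + 1) ^ r₃ * (((k : ℝ) + 1 + 1) ^ r₁ - ((k : ℝ) + 1) ^ r₁)
        + ((k : ℝ) + 1) ^ r₁ * (((k : ℝ) + 1) ^ r₃ - (k : ℝ) ^ r₃) := by ring
  rw [e]
  refine (abs_add_le _ _).trans ?_
  rw [abs_mul, abs_mul, abs_of_pos (Real.rpow_pos_of_pos hk0 r₃),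
    abs_of_pos (Real.rpow_pos_of_pos hk0 r₁), add_mul]
  have e1 : ((k : ℝ) + 1) ^ (r₁ + r₃ - 1) = ((k : ℝ) + 1) ^ r₃ * ((k : ℝ) + 1) ^ (r₁ - 1) := by
    rw [← Real.rpow_add hk0]; congr 1; ring
  have e3 : ((k : ℝ) + 1) ^ (r₁ + r₃ - 1) = ((k : ℝ) + 1) ^ r₁ * ((k : ℝ) + 1) ^ (r₃ - 1) := by
    rw [← Real.rpow_add hk0]; congr 1; ring
  refine add_le_add ?_ ?_
  · rw [e1, mul_left_comm]; gcongr
  · rw [e3, mul_left_comm]; gcongr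

/-- Interpolation of the linearisation error between its two bounds. -/
lemma norm_sub_le_rpow {E : Type*} [NormedAddCommGroup E] {x v : E} {L₁ L₂ lam s : ℝ}
    (hL₁ : 0 ≤ L₁) (hL₂ : 0 ≤ L₂) (hs1 : 1 ≤ s) (hs : s ≤ 1 + lam)
    (h1 : ‖v‖ ≤ L₁ * ‖x‖) (h2 : ‖v‖ ≤ L₂ * ‖x‖ ^ (1 + lam)) : ‖v‖ ≤ (L₁ + L₂) * ‖x‖ ^ s := by
  have hp : 0 ≤ ‖x‖ ^ s := by positivity
  rw [add_mul]
  rcases le_total 1 ‖x‖ with hx | hx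
  · have : ‖x‖ ≤ ‖x‖ ^ s := Real.self_le_rpow_of_one_le hx hs1
    nlinarith [mul_nonneg hL₂ hp, mul_le_mul_of_nonneg_left this hL₁]
  · have : ‖x‖ ^ (1 + lam) ≤ ‖x‖ ^ s := by
      rcases (norm_nonneg x).eq_or_lt with h0 | h0
      · rw [← h0, Real.zero_rpow (by linarith), Real.zero_rpow (by linarith)]
      · exact Real.rpow_le_rpow_of_exponent_ge h0 hx hs
    nlinarith [mul_nonneg hL₁ hp, mul_le_mul_of_nonneg_left this hL₂]

lemma memLp_lpNorm_rpow_div {E Ω : Type*} [NormedAddCommGroup E] [MeasurableSpace Ω]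
    {P : Measure Ω} {p q : ℝ} (hp : 0 < p) (hq : 0 < q) {g : Ω → E}
    (hg : MemLp g (ENNReal.ofReal p) P) :
    MemLp (fun ω => ‖g ω‖ ^ (p / q)) (ENNReal.ofReal q) P ∧
      lpNorm (fun ω => ‖g ω‖ ^ (p / q)) (ENNReal.ofReal q) P
        = lpNorm g (ENNReal.ofReal p) P ^ (p / q) := by
  have h := hg.norm_rpow_div (ENNReal.ofReal (p / q))
  rw [← ENNReal.ofReal_div_of_pos (by positivity), ENNReal.toReal_ofReal (by positivity),
    div_div_cancel₀ hp.ne'] at h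
  refine ⟨h, ?_⟩
  have e := lpNorm_rpow hq h.1
  have e2 : ∀ ω, ‖‖g ω‖ ^ (p / q)‖ ^ q = ‖g ω‖ ^ p := fun ω => by
    rw [Real.norm_of_nonneg (by positivity), ← Real.rpow_mul (norm_nonneg _),
      div_mul_cancel₀ _ hq.ne']
  simp only [e2] at e
  rw [← lpNorm_rpow hp hg.1] at e
  rw [← Real.rpow_left_inj lpNorm_nonneg (Real.rpow_nonneg lpNorm_nonneg _) hq.ne', e,
    ← Real.rpow_mul lpNorm_nonneg, div_mul_cancel₀ _ hq.ne']

namespace PerturbedScheme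

/-- The recursion, linearised at the zero of `f` and solved for the weighted sum of the iterates. -/
lemma map_sum_smul_eq {E Ω : Type*} [NormedAddCommGroup E] [InnerProductSpace ℝ E]
    [MeasurableSpace E] [MeasurableSpace Ω] {P : Measure Ω} {p : ℝ} {ℱ : ℕ → MeasurableSpace Ω}
    {f : E → E} {γ : ℕ → ℝ} {X B N : ℕ → Ω → E}
    (hS : PerturbedScheme P p ℱ f γ X B N) (H : E →L[ℝ] E) (b : ℕ → ℝ)
    (hγ : ∀ n, γ (n + 1) ≠ 0) (n : ℕ) (ω : Ω) :
    H (∑ k ∈ Finset.Icc 1 n, b k • X k ω)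
      = (b (n + 1) / γ (n + 1 + 1)) • X (n + 1) ω - (b 1 / γ (1 + 1)) • X 1 ω
        - ∑ k ∈ Finset.Icc 1 n, (b (k + 1) / γ (k + 1 + 1) - b k / γ (k + 1)) • X (k + 1) ω
        - ∑ k ∈ Finset.Icc 1 n, b k • (f (X k ω) - H (X k ω) + B (k + 1) ω)
        - ∑ k ∈ Finset.Icc 1 n, b k • N (k + 1) ω := by
  rw [← sum_smul_sub_eq (fun k => b k / γ (k + 1)) (fun k => X k ω), map_sum,
    ← Finset.sum_sub_distrib, ← Finset.sum_sub_distrib]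
  refine Finset.sum_congr rfl fun k _ => ?_
  rw [hS.step k ω, add_sub_cancel_left, smul_smul, div_mul_cancel₀ _ (hγ k), map_smul]
  module

variable {E : Type*} [NormedAddCommGroup E] [InnerProductSpace ℝ E] [FiniteDimensional ℝ E]
  [MeasurableSpace E] [BorelSpace E] {Ω : Type*} [mΩ : MeasurableSpace Ω]
  {P : Measure Ω} [IsProbabilityMeasure P] {p : ℝ} {ℱ : ℕ → MeasurableSpace Ω} {f : E → E}
  {γ : ℕ → ℝ} {X B N : ℕ → Ω → E}

/-- The weighted sums of the iterates. In the linearised recursion solved for the iterates, the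
boundary terms are of lower order, the remainder and the bias contribute `∑ k ^ (r₃ - ρ)` with
`ρ = (1 + r₂) / 2`, and the noise is of the same order by orthogonality. -/
theorem exists_lpNorm_sum_le (hS : PerturbedScheme P p ℱ f γ X B N) (hp : 2 ≤ p)
    {H : E →L[ℝ] E} {cH : ℝ} (hcH : 0 ≤ cH) (hH : ∀ x, ‖x‖ ≤ cH * ‖H x‖)
    {q : ℝ} (hq1 : 1 ≤ q) (hqp : q ≤ p) {c : ℝ} (hc : 0 ≤ c)
    (hrem : ∀ x, ‖f x - H x‖ ≤ c * ‖x‖ ^ (p / q))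
    {ε : ℕ → ℝ} (hB : ∀ n ω, ‖B (n + 1) ω‖ ≤ ε (n + 1))
    (hX : ∀ n, MemLp (X n) (ENNReal.ofReal p) P)
    {γ₀ r₁ r₂ r₃ D e s : ℝ} (hγ₀ : 0 < γ₀) (hr₁ : 0 < r₁) (hr₁' : r₁ < 1) (hr₂ : 0 < r₁ + r₂)
    (hr₃ : r₂ / 2 ≤ r₃) (hr : (1 + r₂) / 2 ≤ (r₁ + r₂) / 2 * (p / q))
    (hγ : ∀ n : ℕ, γ (n + 1) = γ₀ * ((n : ℝ) + 1) ^ (-r₁)) (hD : 0 ≤ D) (he : 0 ≤ e) (hs : 0 ≤ s)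
    (hXD : ∀ n : ℕ, 1 ≤ n →
      lpNorm (X n) (ENNReal.ofReal p) P ≤ D * (n : ℝ) ^ (-((r₁ + r₂) / 2)))
    (hε : ∀ n : ℕ, ε (n + 1) ≤ e * ((n : ℝ) + 1) ^ (-((1 + r₂) / 2)))
    (hσ : ∀ n : ℕ, lpNorm (N (n + 1)) (ENNReal.ofReal p) P ^ 2 ≤ s * ((n : ℝ) + 1) ^ (-r₂)) :
    ∃ κ : ℝ, 0 < κ ∧ ∀ n : ℕ, 1 ≤ n →
      lpNorm (fun ω => ∑ k ∈ Finset.Icc 1 n, (k : ℝ) ^ r₃ • X k ω) (ENNReal.ofReal q) P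
        ≤ κ * (n : ℝ) ^ (r₃ + 1 - (1 + r₂) / 2) := by
  obtain ⟨C, hC⟩ := exists_norm_add_rpow_le E hp
  have hC : IsSmoothConst E p C := hC
  have hC1 := hC.1
  have hp0 : 0 < p := by linarith
  have hq0 : 0 < q := by linarith
  have hpq : ENNReal.ofReal q ≤ ENNReal.ofReal p := ENNReal.ofReal_le_ofReal hqp
  have hqE : (1 : ℝ≥0∞) ≤ ENNReal.ofReal q := by rwa [ENNReal.one_le_ofReal]
  have hXq : ∀ n, MemLp (X n) (ENNReal.ofReal q) P := fun n => (hX n).mono_exponent hpq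
  have hXDq : ∀ n : ℕ, 1 ≤ n →
      lpNorm (X n) (ENNReal.ofReal q) P ≤ D * (n : ℝ) ^ (-((r₁ + r₂) / 2)) :=
    fun n hn => (lpNorm_mono_exponent hpq (hX n)).trans (hXD n hn)
  have hγne : ∀ n, γ (n + 1) ≠ 0 := fun n => by rw [hγ]; positivity
  -- `η` is the order of the boundary terms of the summation by parts, `τ` that of all other terms
  set η : ℝ := r₃ + r₁ / 2 - r₂ / 2 with hη
  set τ : ℝ := r₃ + 1 - (1 + r₂) / 2 with hτ
  have hη0 : 0 < η := by rw [hη]; linarith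
  have hητ : η ≤ τ := by rw [hη, hτ]; linarith
  have hτ0 : 0 < τ := hη0.trans_le hητ
  set b : ℕ → ℝ := fun k => (k : ℝ) ^ r₃ with hb
  have hw : ∀ k : ℕ, b k / γ (k + 1) = 1 / γ₀ * ((k : ℝ) ^ r₃ * ((k : ℝ) + 1) ^ r₁) := by
    intro k
    rw [hγ, Real.rpow_neg (by positivity)]
    simp only [hb]
    field_simp
  have hητ' : ∀ n : ℕ, 1 ≤ n → ((n : ℝ) + 1) ^ η ≤ 2 ^ |η| * (n : ℝ) ^ τ := by
    intro n hn
    refine (succ_rpow_le η hn).trans ?_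
    have hn' : (1 : ℝ) ≤ n := by exact_mod_cast hn
    gcongr
  set R : ℕ → Ω → E := fun k ω => f (X k ω) - H (X k ω) + B (k + 1) ω with hR
  have hRmem : ∀ k, MemLp (R k) (ENNReal.ofReal q) P ∧ lpNorm (R k) (ENNReal.ofReal q) P
      ≤ c * lpNorm (X k) (ENNReal.ofReal p) P ^ (p / q) + ε (k + 1) := by
    intro k
    obtain ⟨h1, h2⟩ := memLp_lpNorm_rpow_div hp0 hq0 (hX k)
    have hXm : Measurable (X k) := (hS.measurable_X k).mono (hS.le k) le_rfl
    have hBm : Measurable (B (k + 1)) := (hS.measurable_B k).mono (hS.le k) le_rfl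
    have hRm : Measurable (R k) :=
      ((hS.measurable_f.comp hXm).sub (H.measurable.comp hXm)).add hBm
    obtain ⟨ω₀⟩ := nonempty_of_isProbabilityMeasure P
    have hε0 : 0 ≤ ε (k + 1) := (norm_nonneg _).trans (hB k ω₀)
    have hbd : ∀ ω, ‖R k ω‖ ≤ c * ‖‖X k ω‖ ^ (p / q)‖ + ε (k + 1) := fun ω => by
      rw [Real.norm_of_nonneg (by positivity)]
      exact (norm_add_le _ _).trans (add_le_add (hrem _) (hB k ω))
    refine ⟨?_, (lpNorm_le_of_norm_le hqE h1 hc hε0 hbd).trans_eq (by rw [h2])⟩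
    refine ((h1.norm.const_mul c).add (memLp_const (ε (k + 1)))).of_le hRm.aestronglyMeasurable
      (Filter.Eventually.of_forall fun ω => ?_)
    exact (hbd ω).trans (le_abs_self _)
  have hRle : ∀ k : ℕ, 1 ≤ k → lpNorm (R k) (ENNReal.ofReal q) P
      ≤ (c * D ^ (p / q) + e) * (k : ℝ) ^ (-((1 + r₂) / 2)) := by
    intro k hk
    have hk' : (1 : ℝ) ≤ k := by exact_mod_cast hk
    have hk0 : (0 : ℝ) < k := by linarith
    refine (hRmem k).2.trans ?_
    rw [add_mul, mul_assoc]
    refine add_le_add ?_ ?_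
    · gcongr
      calc lpNorm (X k) (ENNReal.ofReal p) P ^ (p / q)
          ≤ (D * (k : ℝ) ^ (-((r₁ + r₂) / 2))) ^ (p / q) :=
            Real.rpow_le_rpow lpNorm_nonneg (hXD k hk) (by positivity)
        _ = D ^ (p / q) * (k : ℝ) ^ (-((r₁ + r₂) / 2 * (p / q))) := by
            rw [Real.mul_rpow hD (by positivity), ← Real.rpow_mul hk0.le, neg_mul]
        _ ≤ D ^ (p / q) * (k : ℝ) ^ (-((1 + r₂) / 2)) := by gcongr
    · refine (hε k).trans ?_
      have := Real.rpow_le_rpow_of_nonpos hk0 (by linarith : (k : ℝ) ≤ k + 1)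
        (by linarith : -((1 + r₂) / 2) ≤ 0)
      gcongr
  obtain ⟨Cw, hCw, hwd⟩ := exists_abs_weight_sub_le r₃ hr₁'
  obtain ⟨Cη, hCη, hsη⟩ := exists_sum_rpow_le (a := η - 1) (by linarith)
  obtain ⟨Cτ, hCτ, hsτ⟩ := exists_sum_rpow_le (a := τ - 1) (by linarith)
  obtain ⟨Cv, hCv, hsv⟩ := exists_sum_rpow_le (a := 2 * r₃ - r₂) (by linarith)
  simp only [sub_add_cancel] at hsη hsτ
  set K₁ : ℝ := 1 / γ₀ * 2 ^ r₁ * D * 2 ^ |η| with hK₁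
  set K₂ : ℝ := |b 1 / γ (1 + 1)| * lpNorm (X 1) (ENNReal.ofReal q) P with hK₂
  set K₃ : ℝ := 1 / γ₀ * Cw * D * Cη * 2 ^ |η| with hK₃
  set K₄ : ℝ := (c * D ^ (p / q) + e) * Cτ with hK₄
  set K₅ : ℝ := Real.sqrt (2 * C * (s * 2 ^ |-r₂| * Cv)) with hK₅
  have hK₁0 : 0 ≤ K₁ := by positivity
  have hK₂0 : 0 ≤ K₂ := mul_nonneg (abs_nonneg _) lpNorm_nonneg
  have hK₃0 : 0 ≤ K₃ := by positivity
  have hK₄0 : 0 ≤ K₄ := by positivity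
  refine ⟨cH * (K₁ + K₂ + K₃ + K₄ + K₅) + 1, by positivity, fun n hn => ?_⟩
  have hn' : (1 : ℝ) ≤ n := by exact_mod_cast hn
  have hn0 : (0 : ℝ) < n := by linarith
  have hnτ : 1 ≤ (n : ℝ) ^ τ := Real.one_le_rpow hn' hτ0.le
  set T₁ : Ω → E := (b (n + 1) / γ (n + 1 + 1)) • X (n + 1) with hT₁
  set T₂ : Ω → E := (b 1 / γ (1 + 1)) • X 1 with hT₂
  set T₃ : Ω → E :=
    ∑ k ∈ Finset.Icc 1 n, (b (k + 1) / γ (k + 1 + 1) - b k / γ (k + 1)) • X (k + 1) with hT₃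
  set T₄ : Ω → E := ∑ k ∈ Finset.Icc 1 n, b k • R k with hT₄
  set T₅ : Ω → E := ∑ k ∈ Finset.Icc 1 n, b k • N (k + 1) with hT₅
  have hT₁m : MemLp T₁ (ENNReal.ofReal q) P := (hXq _).const_smul _
  have hT₂m : MemLp T₂ (ENNReal.ofReal q) P := (hXq _).const_smul _
  have hT₃m : MemLp T₃ (ENNReal.ofReal q) P := memLp_finsetSum' _ fun k _ => (hXq _).const_smul _
  have hT₄m : MemLp T₄ (ENNReal.ofReal q) P :=
    memLp_finsetSum' _ fun k _ => (hRmem k).1.const_smul _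
  have hT₅m : MemLp T₅ (ENNReal.ofReal p) P :=
    memLp_finsetSum' _ fun k _ => (hS.memLp_N k).const_smul _
  have hT : (fun ω => H (∑ k ∈ Finset.Icc 1 n, b k • X k ω)) = T₁ - T₂ - T₃ - T₄ - T₅ := by
    funext ω
    rw [hS.map_sum_smul_eq H b hγne n ω]
    simp only [hT₁, hT₂, hT₃, hT₄, hT₅, hR, Pi.sub_apply, Finset.sum_apply, Pi.smul_apply]
  have hwsucc : ∀ k : ℕ, b (k + 1) / γ (k + 1 + 1)
      = 1 / γ₀ * (((k : ℝ) + 1) ^ r₃ * ((k : ℝ) + 1 + 1) ^ r₁) := fun k => by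
    have := hw (k + 1)
    push_cast at this
    exact this
  have hB₁ : lpNorm T₁ (ENNReal.ofReal q) P ≤ K₁ * (n : ℝ) ^ τ := by
    rw [hT₁, lpNorm_const_smul_eq, hwsucc, abs_of_nonneg (by positivity)]
    have h1 := hXDq (n + 1) (by omega)
    have h0 : 0 ≤ lpNorm (X (n + 1)) (ENNReal.ofReal q) P := lpNorm_nonneg
    have h2 : ((n : ℝ) + 1 + 1) ^ r₁ ≤ 2 ^ r₁ * ((n : ℝ) + 1) ^ r₁ := by
      have := succ_rpow_le r₁ (k := n + 1) (by omega)
      push_cast at this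
      rwa [abs_of_pos hr₁] at this
    push_cast at h1
    calc _ ≤ 1 / γ₀ * (((n : ℝ) + 1) ^ r₃ * (2 ^ r₁ * ((n : ℝ) + 1) ^ r₁))
          * (D * ((n : ℝ) + 1) ^ (-((r₁ + r₂) / 2))) := by gcongr
      _ = 1 / γ₀ * 2 ^ r₁ * D * ((n : ℝ) + 1) ^ η := by
          have : ((n : ℝ) + 1) ^ η = ((n : ℝ) + 1) ^ r₃ * ((n : ℝ) + 1) ^ r₁
              * ((n : ℝ) + 1) ^ (-((r₁ + r₂) / 2)) := by
            rw [← Real.rpow_add (by positivity), ← Real.rpow_add (by positivity), hη]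
            congr 1; ring
          rw [this]; ring
      _ ≤ 1 / γ₀ * 2 ^ r₁ * D * (2 ^ |η| * (n : ℝ) ^ τ) := by
          gcongr
          exact hητ' n hn
      _ = _ := by rw [hK₁]; ring
  have hB₂ : lpNorm T₂ (ENNReal.ofReal q) P ≤ K₂ * (n : ℝ) ^ τ := by
    rw [hT₂, lpNorm_const_smul_eq]
    exact le_mul_of_one_le_right hK₂0 hnτ
  have hB₃ : lpNorm T₃ (ENNReal.ofReal q) P ≤ K₃ * (n : ℝ) ^ τ := by
    refine (lpNorm_sum_le (fun k _ => (hXq _).const_smul _) hqE).trans ?_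
    calc _ ≤ ∑ k ∈ Finset.Icc 1 n, 1 / γ₀ * Cw * D * ((k + 1 : ℕ) : ℝ) ^ (η - 1) := by
          refine Finset.sum_le_sum fun k hk => ?_
          have hk1 := (Finset.mem_Icc.1 hk).1
          rw [lpNorm_const_smul_eq, hwsucc, hw, ← mul_sub, abs_mul,
            abs_of_pos (by positivity : 0 < 1 / γ₀)]
          have h1 := hXDq (k + 1) (by omega)
          have h0 : 0 ≤ lpNorm (X (k + 1)) (ENNReal.ofReal q) P := lpNorm_nonneg
          push_cast at h1 ⊢
          have : ((k : ℝ) + 1) ^ (η - 1) = ((k : ℝ) + 1) ^ (r₁ + r₃ - 1)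
              * ((k : ℝ) + 1) ^ (-((r₁ + r₂) / 2)) := by
            rw [← Real.rpow_add (by positivity), hη]; congr 1; ring
          rw [this]
          calc _ ≤ 1 / γ₀ * (Cw * ((k : ℝ) + 1) ^ (r₁ + r₃ - 1))
                * (D * ((k : ℝ) + 1) ^ (-((r₁ + r₂) / 2))) := by
                gcongr
                exact hwd k hk1
            _ = _ := by ring
      _ ≤ 1 / γ₀ * Cw * D * (Cη * (2 ^ |η| * (n : ℝ) ^ τ)) := by
          rw [← Finset.mul_sum]
          gcongr
          have h1 := hsη (n + 1)
          rw [sum_Icc_one_eq_sum_range, Finset.sum_range_succ'] at h1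
          rw [sum_Icc_one_eq_sum_range]
          have h2 : 0 ≤ ((0 + 1 : ℕ) : ℝ) ^ (η - 1) := by positivity
          push_cast at h1 h2 ⊢
          have h3 := hητ' n hn
          calc _ ≤ Cη * ((n : ℝ) + 1) ^ η := by linarith
            _ ≤ _ := by gcongr
      _ = _ := by rw [hK₃]; ring
  have hB₄ : lpNorm T₄ (ENNReal.ofReal q) P ≤ K₄ * (n : ℝ) ^ τ := by
    refine (lpNorm_sum_le (fun k _ => (hRmem k).1.const_smul _) hqE).trans ?_
    calc _ ≤ ∑ k ∈ Finset.Icc 1 n, (c * D ^ (p / q) + e) * (k : ℝ) ^ (τ - 1) := by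
          refine Finset.sum_le_sum fun k hk => ?_
          have hk1 := (Finset.mem_Icc.1 hk).1
          have hk0 : (0 : ℝ) < k := by exact_mod_cast hk1
          rw [lpNorm_const_smul_eq, abs_of_nonneg (by simp only [hb]; positivity)]
          have : (k : ℝ) ^ (τ - 1) = (k : ℝ) ^ r₃ * (k : ℝ) ^ (-((1 + r₂) / 2)) := by
            rw [← Real.rpow_add hk0, hτ]; congr 1; ring
          rw [this]
          have := mul_le_mul_of_nonneg_left (hRle k hk1) (by positivity : 0 ≤ (k : ℝ) ^ r₃)
          simp only [hb]
          linarith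
      _ ≤ (c * D ^ (p / q) + e) * (Cτ * (n : ℝ) ^ τ) := by
          rw [← Finset.mul_sum]
          gcongr
          exact hsτ n
      _ = _ := by rw [hK₄]; ring
  have hB₅ : lpNorm T₅ (ENNReal.ofReal q) P ≤ K₅ * (n : ℝ) ^ τ := by
    refine (lpNorm_mono_exponent hpq hT₅m).trans ?_
    refine abs_le_of_sq_le_sq' ?_ (by positivity) |>.2
    refine (hS.lpNorm_sum_noise_sq_le hp hC b n).trans ?_
    rw [mul_pow, hK₅, Real.sq_sqrt (by positivity), mul_assoc (2 * C)]
    gcongr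
    have hτ2 : ((n : ℝ) ^ τ) ^ 2 = (n : ℝ) ^ (2 * r₃ - r₂ + 1) := by
      rw [← Real.rpow_natCast, ← Real.rpow_mul hn0.le, hτ]; congr 1; push_cast; ring
    rw [hτ2]
    calc _ ≤ ∑ k ∈ Finset.Icc 1 n, s * 2 ^ |-r₂| * (k : ℝ) ^ (2 * r₃ - r₂) := by
          refine Finset.sum_le_sum fun k hk => ?_
          have hk1 := (Finset.mem_Icc.1 hk).1
          have hk0 : (0 : ℝ) < k := by exact_mod_cast hk1
          have h1 := hσ k
          have h2 := succ_rpow_le (-r₂) hk1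
          have e1 : (k : ℝ) ^ (2 * r₃ - r₂) = b k ^ 2 * (k : ℝ) ^ (-r₂) := by
            simp only [hb]
            rw [← Real.rpow_natCast, ← Real.rpow_mul hk0.le, ← Real.rpow_add hk0]
            congr 1; push_cast; ring
          rw [e1]
          calc _ ≤ b k ^ 2 * (s * (2 ^ |-r₂| * (k : ℝ) ^ (-r₂))) := by
                gcongr
                exact h1.trans (by gcongr)
            _ = _ := by ring
      _ ≤ _ := by
          rw [← Finset.mul_sum, mul_assoc (s * _)]
          gcongr
          exact hsv n
  have hsum : lpNorm (fun ω => H (∑ k ∈ Finset.Icc 1 n, b k • X k ω)) (ENNReal.ofReal q) P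
      ≤ (K₁ + K₂ + K₃ + K₄ + K₅) * (n : ℝ) ^ τ := by
    rw [hT]
    have h1 := lpNorm_sub_le (g := T₂) hT₁m hqE
    have h2 := lpNorm_sub_le (g := T₃) (hT₁m.sub hT₂m) hqE
    have h3 := lpNorm_sub_le (g := T₄) ((hT₁m.sub hT₂m).sub hT₃m) hqE
    have h4 := lpNorm_sub_le (g := T₅) (((hT₁m.sub hT₂m).sub hT₃m).sub hT₄m) hqE
    simp only [add_mul]
    linarith
  have hHm : MemLp (fun ω => H (∑ k ∈ Finset.Icc 1 n, b k • X k ω)) (ENNReal.ofReal q) P := by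
    rw [hT]
    exact (((hT₁m.sub hT₂m).sub hT₃m).sub hT₄m).sub (hT₅m.mono_exponent hpq)
  have hfin := lpNorm_le_of_norm_le (f := fun ω => ∑ k ∈ Finset.Icc 1 n, b k • X k ω) hqE hHm hcH
    le_rfl fun ω => (hH _).trans_eq (add_zero _).symm
  rw [add_zero] at hfin
  refine hfin.trans ?_
  have := mul_le_mul_of_nonneg_left hsum hcH
  rw [add_mul, one_mul, mul_assoc]
  linarith

end PerturbedScheme

/-! ### The multilevel algorithm as a perturbed scheme -/

/-- The linearisation of a uniformly contracting field is bounded below. -/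
lemma exists_norm_le_mul_norm_apply {E : Type*} [NormedAddCommGroup E] [InnerProductSpace ℝ E]
    [FiniteDimensional ℝ E] {f : E → E} {H : E →L[ℝ] E} {L L'' lam : ℝ} (hL : 0 < L)
    (hlam : 0 < lam) (h1 : ∀ x, inner ℝ x (f x) ≤ -L * ‖x‖ ^ 2)
    (h3 : ∀ x, ‖f x - H x‖ ≤ L'' * ‖x‖ ^ (1 + lam)) :
    ∃ c : ℝ, 0 ≤ c ∧ ∀ x, ‖x‖ ≤ c * ‖H x‖ := by
  have hker : LinearMap.ker (H : E →ₗ[ℝ] E) = ⊥ := by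
    rw [LinearMap.ker_eq_bot']
    intro x hx
    have hx : H x = 0 := hx
    by_contra hne
    have hn : 0 < ‖x‖ := norm_pos_iff.2 hne
    -- along the ray through `x`, the error bound would force `L ≤ L'' (t ‖x‖) ^ lam`
    have key : ∀ t : ℝ, 0 < t → L ≤ L'' * (t * ‖x‖) ^ lam := by
      intro t ht
      have hb := h3 (t • x)
      have ha := h1 (t • x)
      rw [map_smul, hx, smul_zero, sub_zero, norm_smul, Real.norm_of_nonneg ht.le] at hb
      rw [norm_smul, Real.norm_of_nonneg ht.le] at ha
      have hin := (abs_le.1 (abs_real_inner_le_norm (t • x) (f (t • x)))).1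
      rw [norm_smul, Real.norm_of_nonneg ht.le] at hin
      have hy : 0 < t * ‖x‖ := by positivity
      set y := t * ‖x‖
      rw [add_comm, Real.rpow_add_one hy.ne'] at hb
      have h5 : L * y ^ 2 ≤ L'' * y ^ lam * y ^ 2 := by nlinarith
      exact le_of_mul_le_mul_right h5 (by positivity)
    have hlim : Filter.Tendsto (fun t : ℝ => L'' * (t * ‖x‖) ^ lam) (nhdsWithin 0 (Set.Ioi 0))
        (nhds (L'' * (0 * ‖x‖) ^ lam)) := by
      refine Filter.Tendsto.mono_left ?_ nhdsWithin_le_nhds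
      have : Continuous fun t : ℝ => L'' * (t * ‖x‖) ^ lam :=
        continuous_const.mul ((continuous_id.mul continuous_const).rpow_const
          fun _ => Or.inr hlam.le)
      exact this.tendsto 0
    rw [zero_mul, Real.zero_rpow hlam.ne', mul_zero] at hlim
    have := ge_of_tendsto hlim (Filter.eventually_of_mem self_mem_nhdsWithin fun t ht => key t ht)
    linarith
  obtain ⟨K, _, hK⟩ := LinearMap.exists_antilipschitzWith (H : E →ₗ[ℝ] E) hker
  exact ⟨K, K.2, fun x => hK.le_mul_norm (map_zero _) x⟩

/-- The information available after step `n`. -/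
abbrev past {Ω 𝒰 : Type*} [m𝒰 : MeasurableSpace 𝒰] (V : ℕ → ℕ → ℕ → Ω → 𝒰) (n : ℕ) :
    MeasurableSpace Ω :=
  ⨆ i ∈ {i : ℕ × ℕ × ℕ | i.1 < n}, m𝒰.comap (V (i.1 + 1) (i.2.1 + 1) (i.2.2 + 1))

section

variable {Ω 𝒰 : Type*} [m𝒰 : MeasurableSpace 𝒰] {V : ℕ → ℕ → ℕ → Ω → 𝒰}

lemma past_le [mΩ : MeasurableSpace Ω]
    (hVmeas : ∀ n k l, 1 ≤ n → 1 ≤ k → 1 ≤ l → Measurable (V n k l)) (n : ℕ) :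
    past V n ≤ mΩ :=
  iSup₂_le fun _ _ => (hVmeas _ _ _ (by omega) (by omega) (by omega)).comap_le

lemma past_mono (n : ℕ) : past V n ≤ past V (n + 1) :=
  biSup_mono fun _ hi => Nat.lt_succ_of_lt hi

lemma measurable_sampleBlock_past (n : ℕ) : Measurable[past V (n + 1)] (sampleBlock V (n + 1)) := by
  refine @measurable_pi_lambda _ _ _ (past V (n + 1)) _ _ fun i => ?_
  have h : m𝒰.comap (V (n + 1) (i.1 + 1) (i.2 + 1)) ≤ past V (n + 1) :=
    le_iSup₂_of_le (f := fun (i : ℕ × ℕ × ℕ) (_ : i ∈ {i : ℕ × ℕ × ℕ | i.1 < n + 1}) =>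
      m𝒰.comap (V (i.1 + 1) (i.2.1 + 1) (i.2.2 + 1))) (n, i.1, i.2) (Nat.lt_succ_self n) le_rfl
  exact measurable_iff_comap_le.2 h

lemma indepFun_sampleBlock [mΩ : MeasurableSpace Ω] {P : Measure Ω}
    (hVmeas : ∀ n k l, 1 ≤ n → 1 ≤ k → 1 ≤ l → Measurable (V n k l))
    (hVindep : iIndepFun (fun i : ℕ × ℕ × ℕ => V (i.1 + 1) (i.2.1 + 1) (i.2.2 + 1)) P)
    {α : Type*} [MeasurableSpace α] {n : ℕ} {ξ : Ω → α} (hξ : Measurable[past V n] ξ) :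
    IndepFun ξ (sampleBlock V (n + 1)) P := by
  have hind := indep_iSup_of_disjoint
    (m := fun i : ℕ × ℕ × ℕ => m𝒰.comap (V (i.1 + 1) (i.2.1 + 1) (i.2.2 + 1)))
    (fun i => (hVmeas _ _ _ (by omega) (by omega) (by omega)).comap_le) hVindep
    (S := {i | i.1 < n}) (T := {i | i.1 = n})
    (Set.disjoint_left.2 fun i (hi : i.1 < n) (hi' : i.1 = n) => by omega)
  have hW : MeasurableSpace.comap (sampleBlock V (n + 1)) inferInstance ≤
      ⨆ i ∈ {i : ℕ × ℕ × ℕ | i.1 = n}, m𝒰.comap (V (i.1 + 1) (i.2.1 + 1) (i.2.2 + 1)) := by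
    rw [← measurable_iff_comap_le]
    refine @measurable_pi_lambda _ _ _ (_) _ _ fun i => ?_
    refine measurable_iff_comap_le.2 ?_
    exact le_iSup₂_of_le (f := fun (i : ℕ × ℕ × ℕ) (_ : i ∈ {i : ℕ × ℕ × ℕ | i.1 = n}) =>
      m𝒰.comap (V (i.1 + 1) (i.2.1 + 1) (i.2.2 + 1))) (n, i.1, i.2) rfl le_rfl
  exact indep_of_indep_of_le_left (indep_of_indep_of_le_right hind hW)
    (measurable_iff_comap_le.1 hξ)

end

lemma robbinsMonro_succ {E Ω 𝒰 : Type*} [NormedAddCommGroup E] [NormedSpace ℝ E] (A : Params E) (Fk : ℕ → E → 𝒰 → E) (V : ℕ → ℕ → ℕ → Ω → 𝒰) (θ₀ : E)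
    (n : ℕ) (ω : Ω) : robbinsMonro A Fk V θ₀ (n + 1) ω = robbinsMonro A Fk V θ₀ n ω
      + A.γ (n + 1) • blockEstimator A Fk (n + 1) (robbinsMonro A Fk V θ₀ n ω)
        (sampleBlock V (n + 1) ω) := by
  rw [robbinsMonro, estimator_eq]

lemma measurable_robbinsMonro {E Ω 𝒰 : Type*} [NormedAddCommGroup E] [InnerProductSpace ℝ E]
    [FiniteDimensional ℝ E] [MeasurableSpace E] [BorelSpace E] [MeasurableSpace 𝒰]
    {Fk : ℕ → E → 𝒰 → E} {A : Params E} {V : ℕ → ℕ → ℕ → Ω → 𝒰} (hΓ₁ : Measurable A.Γ₁) (hΓ₂ : Measurable A.Γ₂)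
    (hFk : ∀ k, Measurable (fun x : E × 𝒰 => Fk k x.1 x.2)) (θ₀ : E) (n : ℕ) :
    Measurable[past V n] (robbinsMonro A Fk V θ₀ n) := by
  induction n with
  | zero => exact @measurable_const _ _ _ (past V 0) θ₀
  | succ n ih =>
    have e : robbinsMonro A Fk V θ₀ (n + 1) = fun ω => robbinsMonro A Fk V θ₀ n ω
      + A.γ (n + 1) • blockEstimator A Fk (n + 1) (robbinsMonro A Fk V θ₀ n ω)
        (sampleBlock V (n + 1) ω) := funext fun ω => robbinsMonro_succ A Fk V θ₀ n ω
    rw [e]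
    have ih' : Measurable[past V (n + 1)] (robbinsMonro A Fk V θ₀ n) := ih.mono (past_mono n) le_rfl
    exact ih'.add (((measurable_blockEstimator hΓ₁ hΓ₂ hFk (n + 1)).comp
      (ih'.prodMk (measurable_sampleBlock_past n))).const_smul (A.γ (n + 1)))

section

variable {E : Type*} [NormedAddCommGroup E] [InnerProductSpace ℝ E] [FiniteDimensional ℝ E]
  [MeasurableSpace E] [BorelSpace E] {Ω 𝒰 : Type*} [mΩ : MeasurableSpace Ω] [MeasurableSpace 𝒰]
  {P : Measure Ω} {U : Ω → 𝒰} {p : ℝ} {F : E → 𝒰 → E} {Fk : ℕ → E → 𝒰 → E} {C : ℕ → ℝ}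
  {A : Params E} {V : ℕ → ℕ → ℕ → Ω → 𝒰}

lemma measurable_meanField [IsProbabilityMeasure P] (hU : Measurable U)
    (hF : Measurable (fun x : E × 𝒰 => F x.1 x.2)) : Measurable (meanField P U F) := by
  have h1 : Measurable fun z : E × Ω => F z.1 (U z.2) :=
    hF.comp (measurable_fst.prodMk (hU.comp measurable_snd))
  exact (h1.stronglyMeasurable.integral_prod_right (ν := P)).measurable

/-- The centered iterates of the multilevel algorithm form a perturbed scheme for the field
centered at its zero, with bias bounded by `ε_n` and noise of size at most a multiple of `σ_n`. -/
theorem exists_perturbedScheme [IsProbabilityMeasure P] (hp : 2 ≤ p) (hU : Measurable U)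
    (hF : Measurable (fun x : E × 𝒰 => F x.1 x.2))
    (hFint : ∀ θ, Integrable (fun ω => F θ (U ω)) P)
    (hC1 : LevelAssumption P U p F Fk C A)
    (hFk0 : ∀ θ u, Fk 0 θ u = 0) (hFk : ∀ k, Measurable (fun x : E × 𝒰 => Fk k x.1 x.2))
    (hFkint : ∀ k, ∀ θ, Integrable (fun ω => Fk k θ (U ω)) P)
    (hVmeas : ∀ n k l, 1 ≤ n → 1 ≤ k → 1 ≤ l → Measurable (V n k l))
    (hVlaw : ∀ n k l, 1 ≤ n → 1 ≤ k → 1 ≤ l → IdentDistrib (V n k l) U P P)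
    (hVindep : iIndepFun (fun i : ℕ × ℕ × ℕ => V (i.1 + 1) (i.2.1 + 1) (i.2.2 + 1)) P)
    (hε : ∀ n, 0 < A.ε (n + 1)) (hσ : ∀ n, 0 < A.σ (n + 1)) (θ₀ θstar : E) :
    ∃ (B N : ℕ → Ω → E) (c : ℝ), 0 < c ∧
      PerturbedScheme P p (past V) (fun x => meanField P U F (θstar + x)) A.γ
        (fun n ω => robbinsMonro A Fk V θ₀ n ω - θstar) B N ∧
      (∀ n ω, ‖B (n + 1) ω‖ ≤ A.ε (n + 1)) ∧
      ∀ n, lpNorm (N (n + 1)) (ENNReal.ofReal p) P ≤ c * A.σ (n + 1) := by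
  obtain ⟨c, hc, hnoise⟩ := exists_noise_bound hp hC1 hFk0 hFk hFkint hVmeas hVlaw hVindep
  have hΓ₁ := hC1.measurable_Γ₁
  have hΓ₂ := hC1.measurable_Γ₂
  obtain ⟨θ, hθ⟩ : ∃ θ : ℕ → Ω → E, θ = robbinsMonro A Fk V θ₀ := ⟨_, rfl⟩
  rw [← hθ]
  have hθm : ∀ n, Measurable[past V n] (θ n) := fun n => hθ ▸
    measurable_robbinsMonro hΓ₁ hΓ₂ hFk θ₀ n
  have hθm' : ∀ n, Measurable (θ n) := fun n => (hθm n).mono (past_le hVmeas n) le_rfl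
  have hWm : ∀ n, Measurable (sampleBlock V (n + 1)) := fun n =>
    measurable_sampleBlock hVmeas (by omega)
  have hmean := fun n => measurable_levelMean (P := P) (A := A) (Fk := Fk) hU hΓ₂ hFk n
  have hf := measurable_meanField (P := P) hU hF
  obtain ⟨h, hh⟩ : ∃ h : ℕ → E → (ℕ × ℕ → 𝒰) → E, h = fun n x w =>
    blockEstimator A Fk n x w - levelMean P U A Fk n x := ⟨_, rfl⟩
  have hhm : ∀ n, Measurable fun z : E × (ℕ × ℕ → 𝒰) => h n z.1 z.2 := fun n => hh ▸
    (measurable_blockEstimator hΓ₁ hΓ₂ hFk n).sub ((hmean n).comp measurable_fst)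
  have hnoise : ∀ n, ∀ x, MemLp (fun ω => h (n + 1) x (sampleBlock V (n + 1) ω))
      (ENNReal.ofReal p) P ∧ ∫ ω, h (n + 1) x (sampleBlock V (n + 1) ω) ∂P = 0 ∧
      lpNorm (fun ω => h (n + 1) x (sampleBlock V (n + 1) ω)) (ENNReal.ofReal p) P
        ≤ c * A.σ (n + 1) := by
    intro n x
    rw [hh]
    exact hnoise (n + 1) (by omega) (hσ n) x
  have hN := fun n => memLp_lpNorm_le_of_indepFun (hθm' n) (hWm n)
    (indepFun_sampleBlock hVmeas hVindep (hθm n)) (h := h (n + 1)) (c := c * A.σ (n + 1)) (p := p)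
    (mul_pos hc (hσ n)).le (by linarith) (hhm (n + 1))
    (fun x => (hnoise n x).1)
    (fun x => (hnoise n x).2.2)
  have hp1 : (1 : ℝ≥0∞) ≤ ENNReal.ofReal p := by
    rw [ENNReal.one_le_ofReal]; linarith
  obtain ⟨B, hB⟩ : ∃ B : ℕ → Ω → E, ∀ n, B (n + 1) = fun ω =>
      levelMean P U A Fk (n + 1) (θ n ω) - meanField P U F (θ n ω) :=
    ⟨fun n => Nat.casesOn n 0 fun n ω =>
      levelMean P U A Fk (n + 1) (θ n ω) - meanField P U F (θ n ω), fun n => rfl⟩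
  obtain ⟨N, hN'⟩ : ∃ N : ℕ → Ω → E, ∀ n, N (n + 1) = fun ω =>
      h (n + 1) (θ n ω) (sampleBlock V (n + 1) ω) :=
    ⟨fun n => Nat.casesOn n 0 fun n ω => h (n + 1) (θ n ω) (sampleBlock V (n + 1) ω),
      fun n => rfl⟩
  refine ⟨B, N, c, hc, ?_, ?_, fun n => by rw [hN']; exact (hN n).2⟩
  · refine
      { le := past_le hVmeas
        mono := past_mono
        measurable_f := hf.comp (measurable_const_add θstar)
        measurable_X := fun n => (hθm n).sub_const θstar
        measurable_B := fun n => ?_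
        measurable_N := fun n => ?_
        memLp_zero := ?_
        memLp_N := fun n => by rw [hN']; exact (hN n).1
        step := fun n ω => ?_
        orth := fun n Y hY hint => ?_ }
    · rw [hB]
      exact ((hmean (n + 1)).comp (hθm n)).sub (hf.comp (hθm n))
    · rw [hN']
      have hθ' : Measurable[past V (n + 1)] (θ n) := (hθm n).mono (past_mono n) le_rfl
      have hpair : Measurable[past V (n + 1)] fun ω => (θ n ω, sampleBlock V (n + 1) ω) :=
        hθ'.prodMk (measurable_sampleBlock_past n)
      have hcomp := (hhm (n + 1)).comp hpair
      exact hcomp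
    · rw [hθ]
      exact memLp_const (θ₀ - θstar)
    · rw [hB, hN', hh, hθ, robbinsMonro_succ]
      simp only [add_sub_cancel]
      module
    · have hξ : Measurable[past V n] fun ω => (Y ω, θ n ω) := hY.prodMk (hθm n)
      rw [hN'] at hint ⊢
      have hξ' : Measurable fun ω => (Y ω, θ n ω) := hξ.mono (past_le hVmeas n) le_rfl
      exact integral_inner_eq_zero_of_indepFun hξ' (hWm n)
        (indepFun_sampleBlock hVmeas hVindep hξ) (g := Prod.fst) measurable_fst
        (h := fun z w => h (n + 1) z.2 w)
        ((hhm (n + 1)).comp ((measurable_snd.comp measurable_fst).prodMk measurable_snd))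
        (fun z => (hnoise n z.2).1.integrable hp1)
        (fun z => (hnoise n z.2).2.1) hint
  · intro n ω
    rw [hB]
    exact norm_levelMean_sub_le hC1 (hε n) hFint hFkint _

end

/-! ### Computational cost -/

section

variable {E : Type*} {A : Params E} {n : ℕ}

lemma maxLevel_le (A : Params E) (n : ℕ) (θ : E) :
    (maxLevel A n θ : ℝ) ≤ 1 + max 0 ((1 / A.α) * Real.logb A.M (A.Γ₂ θ / A.ε n)) := by
  set y := (1 / A.α) * Real.logb A.M (A.Γ₂ θ / A.ε n) with hy
  unfold maxLevel
  rw [← hy, Nat.cast_max, Nat.cast_one]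
  refine max_le (by linarith [le_max_left 0 y]) ?_
  rcases le_total 0 y with h | h
  · rw [max_eq_right h]; linarith [Nat.ceil_lt_add_one h]
  · rw [Nat.ceil_eq_zero.2 h, Nat.cast_zero]; linarith [le_max_left 0 y]

lemma rpow_maxLevel_le (hM : 1 < A.M) (θ : E) (hΓ : 0 < A.Γ₂ θ) (hε : 0 < A.ε n) :
    A.M ^ (maxLevel A n θ : ℝ) ≤ A.M * max 1 ((A.Γ₂ θ / A.ε n) ^ (1 / A.α)) := by
  have hM0 : 0 < A.M := by linarith
  have hx : 0 < A.Γ₂ θ / A.ε n := by positivity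
  calc A.M ^ (maxLevel A n θ : ℝ)
      ≤ A.M ^ (1 + max 0 ((1 / A.α) * Real.logb A.M (A.Γ₂ θ / A.ε n))) :=
        Real.rpow_le_rpow_of_exponent_le hM.le (maxLevel_le A n θ)
    _ = A.M * A.M ^ (max 0 ((1 / A.α) * Real.logb A.M (A.Γ₂ θ / A.ε n))) := by
        rw [Real.rpow_add hM0, Real.rpow_one]
    _ = _ := by
        congr 1
        rw [(Real.monotone_rpow_of_base_ge_one hM.le).map_max, Real.rpow_zero, mul_comm (1 / A.α),
          Real.rpow_mul hM0.le, Real.rpow_logb hM0 hM.ne' hx]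

/-- The cost of one evaluation of the multilevel estimator: the first term stems from the number of
replications before rounding up, the second one from the rounding. -/
lemma exists_sum_numIter_mul_le (hM : 1 < A.M) {C : ℕ → ℝ} {K : ℝ} (hK : 0 < K)
    (hC0 : ∀ k, 1 ≤ k → 0 < C k) (hC : ∀ k : ℕ, 1 ≤ k → C k ≤ K * A.M ^ k) :
    ∃ c : ℝ, 0 < c ∧ ∀ (n : ℕ) (θ : E),
      ∑ k ∈ Finset.Icc 1 (maxLevel A n θ), (numIter A n k θ : ℝ) * C k
        ≤ c * ((A.Γ₁ θ / A.σ n) ^ 2 * levelWeight A (maxLevel A n θ) ^ 2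
          + A.M ^ (maxLevel A n θ : ℝ)) := by
  have hM0 : 0 < A.M := by linarith
  obtain ⟨c, hc, hlev⟩ := exists_sum_level_le A hM
  have hc' : 0 < A.M / (A.M - 1) := div_pos hM0 (by linarith)
  refine ⟨K * (c + A.M / (A.M - 1)), by positivity, fun n θ => ?_⟩
  have hw := levelWeight_pos A hM (one_le_maxLevel A n θ)
  have hκ0 : 0 ≤ kappa A n θ := by rw [kappa_eq]; positivity
  rw [sum_Icc_one_eq_sum_range]
  calc _ ≤ ∑ k ∈ Finset.range (maxLevel A n θ), (K * kappa A n θ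
          * A.M ^ (((k : ℝ) + 1) * (1 / 2 - A.β)) + K * A.M ^ (k + 1)) := by
        refine Finset.sum_le_sum fun k _ => ?_
        have h1 : (numIter A n (k + 1) θ : ℝ)
            ≤ kappa A n θ * A.M ^ (-((k + 1 : ℕ) : ℝ) * (A.β + 1 / 2)) + 1 :=
          (Nat.ceil_lt_add_one (by positivity)).le
        have h2 := hC (k + 1) (by omega)
        have h3 := (hC0 (k + 1) (by omega)).le
        have e : A.M ^ (((k : ℝ) + 1) * (1 / 2 - A.β))
            = A.M ^ (-((k + 1 : ℕ) : ℝ) * (A.β + 1 / 2)) * A.M ^ (k + 1) := by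
          rw [← Real.rpow_natCast A.M (k + 1), ← Real.rpow_add hM0]
          congr 1; push_cast; ring
        calc _ ≤ (kappa A n θ * A.M ^ (-((k + 1 : ℕ) : ℝ) * (A.β + 1 / 2)) + 1)
              * (K * A.M ^ (k + 1)) := by gcongr
          _ = _ := by rw [e]; ring
    _ ≤ K * kappa A n θ * (c * levelWeight A (maxLevel A n θ))
        + K * (A.M / (A.M - 1) * A.M ^ (maxLevel A n θ)) := by
        rw [Finset.sum_add_distrib, ← Finset.mul_sum, ← Finset.mul_sum]
        gcongr
        · exact hlev _
        · exact sum_pow_succ_le_of_one_lt hM _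
    _ = K * c * ((A.Γ₁ θ / A.σ n) ^ 2 * levelWeight A (maxLevel A n θ) ^ 2)
        + K * (A.M / (A.M - 1)) * A.M ^ (maxLevel A n θ : ℝ) := by
        rw [kappa_eq, Real.rpow_natCast]; ring
    _ ≤ _ := by
        have h1 : 0 ≤ (A.Γ₁ θ / A.σ n) ^ 2 * levelWeight A (maxLevel A n θ) ^ 2 := by positivity
        have h2 : 0 ≤ A.M ^ (maxLevel A n θ : ℝ) := by positivity
        nlinarith [mul_nonneg (mul_nonneg hK.le hc.le) h2, mul_nonneg (mul_nonneg hK.le hc'.le) h1]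

/-- The growth in `n` of the part of the cost of step `n` that stems from the number of replications
before rounding. -/
noncomputable def stepRate (α β r₂ ρ : ℝ) (n : ℕ) : ℝ :=
  if 1 / 2 < β then (n : ℝ) ^ r₂
  else if β = 1 / 2 then (n : ℝ) ^ r₂ * Real.log ((n : ℝ) + 1) ^ 2
  else (n : ℝ) ^ (r₂ + ρ * (1 - 2 * β) / α)

variable [NormedAddCommGroup E] {p K₁ β₁ ε₀ σ₀ r₂ ρ : ℝ}

lemma exists_rpow_maxLevel_le (hM : 1 < A.M) (hα : 0 < A.α) (hp : 0 < p) (hK₁ : 0 < K₁)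
    (hε₀ : 0 < ε₀) (hρ : 0 < ρ) (hΓpos : ∀ θ, 0 < A.Γ₂ θ)
    (hΓ : ∀ θ, A.Γ₂ θ ≤ K₁ * (1 + ‖θ‖) ^ (A.α * p))
    (hε : ∀ n : ℕ, 1 ≤ n → A.ε n = ε₀ * (1 / (n : ℝ) ^ ρ)) :
    ∃ G : ℝ, 1 ≤ G ∧ ∀ n : ℕ, 1 ≤ n → ∀ θ : E,
      A.M ^ (maxLevel A n θ : ℝ) ≤ G * ((1 + ‖θ‖) ^ p * (n : ℝ) ^ (ρ / A.α)) := by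
  refine ⟨A.M * max 1 ((K₁ / ε₀) ^ (1 / A.α)),
    one_le_mul_of_one_le_of_one_le hM.le (le_max_left _ _), fun n hn θ => ?_⟩
  have hn' : (1 : ℝ) ≤ n := by exact_mod_cast hn
  have hθ : 1 ≤ 1 + ‖θ‖ := by linarith [norm_nonneg θ]
  have hεn : 0 < A.ε n := by rw [hε n hn]; positivity
  have hM0 : 0 < A.M := by linarith
  refine (rpow_maxLevel_le hM θ (hΓpos θ) hεn).trans ?_
  rw [mul_assoc]
  gcongr
  have h1 : 1 ≤ (1 + ‖θ‖) ^ p * (n : ℝ) ^ (ρ / A.α) :=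
    one_le_mul_of_one_le_of_one_le (Real.one_le_rpow hθ hp.le)
      (Real.one_le_rpow hn' (by positivity))
  refine max_le ?_ ?_
  · exact one_le_mul_of_one_le_of_one_le (le_max_left _ _) h1
  · have h2 : A.Γ₂ θ / A.ε n ≤ K₁ / ε₀ * ((1 + ‖θ‖) ^ (A.α * p) * (n : ℝ) ^ ρ) := by
      rw [hε n hn]
      calc _ ≤ K₁ * (1 + ‖θ‖) ^ (A.α * p) / (ε₀ * (1 / (n : ℝ) ^ ρ)) := by
            gcongr
            exact hΓ θ
        _ = _ := by field_simp
    calc (A.Γ₂ θ / A.ε n) ^ (1 / A.α)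
        ≤ (K₁ / ε₀ * ((1 + ‖θ‖) ^ (A.α * p) * (n : ℝ) ^ ρ)) ^ (1 / A.α) :=
          Real.rpow_le_rpow (div_pos (hΓpos θ) hεn).le h2 (by positivity)
      _ = (K₁ / ε₀) ^ (1 / A.α) * ((1 + ‖θ‖) ^ p * (n : ℝ) ^ (ρ / A.α)) := by
          rw [Real.mul_rpow (by positivity) (by positivity),
            Real.mul_rpow (by positivity) (by positivity), ← Real.rpow_mul (by positivity),
            ← Real.rpow_mul (by positivity)]
          congr 3 <;> field_simp
      _ ≤ _ := by
          gcongr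
          exact le_max_right _ _

/-- For `β = 1/2` the maximal level enters the cost polynomially, and is bounded by a logarithm of
`n` times an arbitrarily small power of the norm of the parameter. -/
lemma exists_maxLevel_le (hM : 1 < A.M) {G s δ : ℝ} (hG : 1 ≤ G) (hp : 0 ≤ p) (hs : 0 ≤ s)
    (hδ : 0 < δ)
    (h : ∀ n : ℕ, 1 ≤ n → ∀ θ : E,
      A.M ^ (maxLevel A n θ : ℝ) ≤ G * ((1 + ‖θ‖) ^ p * (n : ℝ) ^ s)) :
    ∃ c : ℝ, 0 < c ∧ ∀ n : ℕ, 1 ≤ n → ∀ θ : E,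
      (maxLevel A n θ : ℝ) ≤ c * (Real.log ((n : ℝ) + 1) * (1 + ‖θ‖) ^ δ) := by
  have hM0 : 0 < A.M := by linarith
  have hlM : 0 < Real.log A.M := Real.log_pos hM
  have hl2 : 0 < Real.log 2 := Real.log_pos (by norm_num)
  have hlG : 0 ≤ Real.log G := Real.log_nonneg hG
  refine ⟨(Real.log G / Real.log 2 + p / (δ * Real.log 2) + s) / Real.log A.M + 1,
    by positivity, fun n hn θ => ?_⟩
  have hn' : (1 : ℝ) ≤ n := by exact_mod_cast hn
  have hθ : 1 ≤ 1 + ‖θ‖ := by linarith [norm_nonneg θ]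
  have hl : Real.log 2 ≤ Real.log ((n : ℝ) + 1) := Real.log_le_log (by norm_num) (by linarith)
  have hln : Real.log n ≤ Real.log ((n : ℝ) + 1) := Real.log_le_log (by linarith) (by linarith)
  have hln0 : 0 ≤ Real.log n := Real.log_nonneg hn'
  set ℓ := Real.log ((n : ℝ) + 1) with hℓ
  have hℓ0 : 0 < ℓ := by linarith
  set T := (1 + ‖θ‖) ^ δ with hT
  have hT1 : 1 ≤ T := Real.one_le_rpow hθ hδ.le
  have h1 := Real.log_le_log (by positivity) (h n hn θ)
  rw [Real.log_rpow hM0, Real.log_mul (by positivity) (by positivity),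
    Real.log_mul (by positivity) (by positivity), Real.log_rpow (by positivity),
    Real.log_rpow (by positivity)] at h1
  have h2 : Real.log (1 + ‖θ‖) ≤ T / δ := Real.log_le_rpow_div (by positivity) hδ
  have hℓT : ℓ ≤ ℓ * T := le_mul_of_one_le_right hℓ0.le hT1
  have g1 : Real.log G ≤ Real.log G / Real.log 2 * (ℓ * T) := by
    rw [div_mul_eq_mul_div, le_div_iff₀ hl2]
    exact mul_le_mul_of_nonneg_left (hl.trans hℓT) hlG
  have g2 : p * Real.log (1 + ‖θ‖) ≤ p / (δ * Real.log 2) * (ℓ * T) := by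
    calc p * Real.log (1 + ‖θ‖) ≤ p * (T / δ) := by gcongr
      _ = p / (δ * Real.log 2) * (Real.log 2 * T) := by field_simp
      _ ≤ _ := by gcongr
  have g3 : s * Real.log n ≤ s * (ℓ * T) := by gcongr; exact hln.trans hℓT
  have hmul : (maxLevel A n θ : ℝ) * Real.log A.M
      ≤ (Real.log G / Real.log 2 + p / (δ * Real.log 2) + s) * (ℓ * T) := by
    rw [add_mul, add_mul]; linarith
  rw [← le_div_iff₀ hlM] at hmul
  refine hmul.trans ?_
  rw [mul_div_right_comm]
  exact mul_le_mul_of_nonneg_right (by linarith) (by positivity)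

lemma exists_sq_mul_levelWeight_sq_le (hM : 1 < A.M) (hα : 0 < A.α) (hp : 0 < p) (hK₁ : 0 < K₁)
    (hβ₁' : A.β ≠ 1 / 2 → β₁ ≤ min A.β (1 / 2))
    (hβ₁'' : A.β = 1 / 2 → β₁ < 1 / 2) (hσ₀ : 0 < σ₀) (hρ : 0 < ρ)
    (hΓpos : ∀ θ, 0 < A.Γ₁ θ) (hΓ : ∀ θ, A.Γ₁ θ ≤ K₁ * (1 + ‖θ‖) ^ (β₁ * p))
    (hσ : ∀ n : ℕ, 1 ≤ n → 0 < A.σ n ∧ A.σ n ^ 2 = σ₀ ^ 2 * (1 / (n : ℝ) ^ r₂))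
    {G : ℝ} (hG : 1 ≤ G) (hlev : ∀ n : ℕ, 1 ≤ n → ∀ θ : E,
      A.M ^ (maxLevel A n θ : ℝ) ≤ G * ((1 + ‖θ‖) ^ p * (n : ℝ) ^ (ρ / A.α))) :
    ∃ c : ℝ, 0 < c ∧ ∀ n : ℕ, 1 ≤ n → ∀ θ : E,
      (A.Γ₁ θ / A.σ n) ^ 2 * levelWeight A (maxLevel A n θ) ^ 2
        ≤ c * (stepRate A.α A.β r₂ ρ n * (1 + ‖θ‖) ^ p) := by
  have hM0 : 0 < A.M := by linarith
  have hbase : ∀ n : ℕ, 1 ≤ n → ∀ θ : E, (A.Γ₁ θ / A.σ n) ^ 2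
      ≤ K₁ ^ 2 / σ₀ ^ 2 * ((n : ℝ) ^ r₂ * (1 + ‖θ‖) ^ (2 * β₁ * p)) := by
    intro n hn θ
    have hn0 : (0 : ℝ) < n := by exact_mod_cast hn
    have hθ : 0 < 1 + ‖θ‖ := by linarith [norm_nonneg θ]
    rw [div_pow, (hσ n hn).2]
    have e : (1 + ‖θ‖) ^ (2 * β₁ * p) = ((1 + ‖θ‖) ^ (β₁ * p)) ^ 2 := by
      rw [← Real.rpow_natCast, ← Real.rpow_mul hθ.le]; congr 1; push_cast; ring
    have h1 : A.Γ₁ θ ^ 2 ≤ (K₁ * (1 + ‖θ‖) ^ (β₁ * p)) ^ 2 :=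
      pow_le_pow_left₀ (hΓpos θ).le (hΓ θ) 2
    calc _ ≤ (K₁ * (1 + ‖θ‖) ^ (β₁ * p)) ^ 2 / (σ₀ ^ 2 * (1 / (n : ℝ) ^ r₂)) := by gcongr
      _ = _ := by rw [e]; field_simp
  have hQ : 0 < K₁ ^ 2 / σ₀ ^ 2 := by positivity
  rcases lt_trichotomy A.β (1 / 2) with hβ | hβ | hβ
  · have hb := hβ₁' hβ.ne
    rw [min_eq_left hβ.le] at hb
    have h12 : 0 < 1 - 2 * A.β := by linarith
    refine ⟨K₁ ^ 2 / σ₀ ^ 2 * G ^ (1 - 2 * A.β), by positivity, fun n hn θ => ?_⟩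
    have hn0 : (0 : ℝ) < n := by exact_mod_cast hn
    have hθ : 1 ≤ 1 + ‖θ‖ := by linarith [norm_nonneg θ]
    have hθ0 : 0 < 1 + ‖θ‖ := by linarith
    have hw : levelWeight A (maxLevel A n θ) ^ 2
        ≤ G ^ (1 - 2 * A.β) * ((1 + ‖θ‖) ^ (p * (1 - 2 * A.β))
          * (n : ℝ) ^ (ρ * (1 - 2 * A.β) / A.α)) := by
      have e : levelWeight A (maxLevel A n θ) ^ 2
          = (A.M ^ (maxLevel A n θ : ℝ)) ^ (1 - 2 * A.β) := by
        rw [levelWeight, if_neg hβ.ne, max_eq_left (by linarith), ← Real.rpow_natCast,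
          ← Real.rpow_mul hM0.le, ← Real.rpow_mul hM0.le]
        congr 1; push_cast; ring
      rw [e]
      refine (Real.rpow_le_rpow (by positivity) (hlev n hn θ) h12.le).trans_eq ?_
      rw [Real.mul_rpow (by linarith) (by positivity), Real.mul_rpow (by positivity) (by positivity),
        ← Real.rpow_mul hθ0.le, ← Real.rpow_mul hn0.le]
      congr 3; ring
    have hrate : stepRate A.α A.β r₂ ρ n = (n : ℝ) ^ r₂ * (n : ℝ) ^ (ρ * (1 - 2 * A.β) / A.α) := by
      rw [stepRate, if_neg (by linarith), if_neg hβ.ne, Real.rpow_add hn0]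
    have hpow : (1 + ‖θ‖) ^ (2 * β₁ * p) * (1 + ‖θ‖) ^ (p * (1 - 2 * A.β)) ≤ (1 + ‖θ‖) ^ p := by
      rw [← Real.rpow_add hθ0]
      refine Real.rpow_le_rpow_of_exponent_le hθ ?_
      nlinarith
    calc _ ≤ K₁ ^ 2 / σ₀ ^ 2 * ((n : ℝ) ^ r₂ * (1 + ‖θ‖) ^ (2 * β₁ * p))
          * (G ^ (1 - 2 * A.β) * ((1 + ‖θ‖) ^ (p * (1 - 2 * A.β))
          * (n : ℝ) ^ (ρ * (1 - 2 * A.β) / A.α))) := by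
          gcongr
          exact hbase n hn θ
      _ = K₁ ^ 2 / σ₀ ^ 2 * G ^ (1 - 2 * A.β) * (stepRate A.α A.β r₂ ρ n
          * ((1 + ‖θ‖) ^ (2 * β₁ * p) * (1 + ‖θ‖) ^ (p * (1 - 2 * A.β)))) := by
          rw [hrate]; ring
      _ ≤ _ := by
          have : 0 ≤ stepRate A.α A.β r₂ ρ n := by rw [hrate]; positivity
          gcongr
  · have hb := hβ₁'' hβ
    obtain ⟨c, hc, hm⟩ := exists_maxLevel_le (δ := p * (1 / 2 - β₁)) hM hG hp.le
      (by positivity : 0 ≤ ρ / A.α) (mul_pos hp (by linarith)) hlev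
    refine ⟨K₁ ^ 2 / σ₀ ^ 2 * c ^ 2, by positivity, fun n hn θ => ?_⟩
    have hn0 : (0 : ℝ) < n := by exact_mod_cast hn
    have hθ0 : 0 < 1 + ‖θ‖ := by linarith [norm_nonneg θ]
    have hw : levelWeight A (maxLevel A n θ) = (maxLevel A n θ : ℝ) := by
      rw [levelWeight, if_pos hβ]
    have hrate : stepRate A.α A.β r₂ ρ n = (n : ℝ) ^ r₂ * Real.log ((n : ℝ) + 1) ^ 2 := by
      rw [stepRate, if_neg (by linarith), if_pos hβ]
    have e : (1 + ‖θ‖) ^ (2 * β₁ * p) * ((1 + ‖θ‖) ^ (p * (1 / 2 - β₁))) ^ 2 = (1 + ‖θ‖) ^ p := by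
      rw [← Real.rpow_natCast, ← Real.rpow_mul hθ0.le, ← Real.rpow_add hθ0]
      congr 1; push_cast; ring
    rw [hw]
    calc _ ≤ K₁ ^ 2 / σ₀ ^ 2 * ((n : ℝ) ^ r₂ * (1 + ‖θ‖) ^ (2 * β₁ * p))
          * (c * (Real.log ((n : ℝ) + 1) * (1 + ‖θ‖) ^ (p * (1 / 2 - β₁)))) ^ 2 := by
          gcongr
          · exact hbase n hn θ
          · exact hm n hn θ
      _ = K₁ ^ 2 / σ₀ ^ 2 * c ^ 2 * ((n : ℝ) ^ r₂ * Real.log ((n : ℝ) + 1) ^ 2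
          * ((1 + ‖θ‖) ^ (2 * β₁ * p) * ((1 + ‖θ‖) ^ (p * (1 / 2 - β₁))) ^ 2)) := by ring
      _ = _ := by rw [hrate, e]
  · have hb := hβ₁' hβ.ne'
    rw [min_eq_right hβ.le] at hb
    refine ⟨K₁ ^ 2 / σ₀ ^ 2, by positivity, fun n hn θ => ?_⟩
    have hn0 : (0 : ℝ) < n := by exact_mod_cast hn
    have hθ : 1 ≤ 1 + ‖θ‖ := by linarith [norm_nonneg θ]
    have hw : levelWeight A (maxLevel A n θ) = 1 := by
      rw [levelWeight, if_neg hβ.ne', max_eq_right (by linarith), mul_zero, Real.rpow_zero]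
    rw [hw, one_pow, mul_one, stepRate, if_pos hβ]
    refine (hbase n hn θ).trans ?_
    gcongr
    nlinarith

/-- Summing the costs of the single steps. The condition on `r₂` is what makes the contribution
`n ^ (ρ / α)` of the rounding negligible. -/
lemma exists_sum_stepRate_le {α β : ℝ} (hα : 0 < α) (hr₂ : -1 < r₂) (hρ : ρ = (1 + r₂) / 2)
    (hβ : 0 < β) (hβα : min β (1 / 2) < α) (hr : min β (1 / 2) / (α - min β (1 / 2)) ≤ r₂) :
    ∃ c : ℝ, 0 < c ∧ ∀ n : ℕ, 1 ≤ n →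
      ∑ j ∈ Finset.Icc 1 n, (stepRate α β r₂ ρ j + (j : ℝ) ^ (ρ / α)) ≤ c * costRate α β ρ n := by
  have hρ0 : 0 < ρ := by rw [hρ]; linarith
  have hρα : 0 < ρ / α := by positivity
  rw [div_le_iff₀ (by linarith)] at hr
  obtain ⟨c₁, hc₁, h₁⟩ := exists_sum_rpow_le (a := ρ / α) (by linarith)
  obtain ⟨c₂, hc₂, h₂⟩ := exists_sum_rpow_le hr₂
  have e2 : r₂ + 1 = 2 * ρ := by rw [hρ]; ring
  rw [e2] at h₂
  rcases lt_trichotomy β (1 / 2) with hb | hb | hb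
  · rw [min_eq_left hb.le] at hr hβα
    have h12 : 0 < 1 - 2 * β := by linarith
    have hx : 0 < ρ * (1 - 2 * β) / α := by positivity
    obtain ⟨c₃, hc₃, h₃⟩ := exists_sum_rpow_le (a := r₂ + ρ * (1 - 2 * β) / α) (by linarith)
    refine ⟨c₃ + c₁, by positivity, fun n hn => ?_⟩
    have hn' : (1 : ℝ) ≤ n := by exact_mod_cast hn
    have e3 : r₂ + ρ * (1 - 2 * β) / α + 1 = 2 * ρ * (1 + (1 - 2 * β) / (2 * α)) := by
      rw [hρ]; field_simp; ring
    have hle : ρ / α + 1 ≤ 2 * ρ * (1 + (1 - 2 * β) / (2 * α)) := by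
      rw [← e3, ← sub_nonneg]
      have : r₂ + ρ * (1 - 2 * β) / α + 1 - (ρ / α + 1) = (r₂ * (α - β) - β) / α := by
        rw [hρ]; field_simp; ring
      rw [this]
      exact div_nonneg (by linarith) hα.le
    simp only [stepRate, costRate, if_neg (not_lt.2 hb.le), if_neg hb.ne]
    rw [Finset.sum_add_distrib, add_mul]
    have g3 := h₃ n
    rw [e3] at g3
    have g1 := (h₁ n).trans (mul_le_mul_of_nonneg_left
      (Real.rpow_le_rpow_of_exponent_le hn' hle) hc₁.le)
    linarith
  · rw [min_eq_right hb.ge] at hr hβα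
    have hl2 : 0 < Real.log 2 := Real.log_pos (by norm_num)
    refine ⟨c₂ + c₁ / Real.log 2 ^ 2, by positivity, fun n hn => ?_⟩
    have hn' : (1 : ℝ) ≤ n := by exact_mod_cast hn
    have hl : Real.log 2 ≤ Real.log ((n : ℝ) + 1) := Real.log_le_log (by norm_num) (by linarith)
    have hle : ρ / α + 1 ≤ 2 * ρ := by
      rw [← sub_nonneg]
      have : 2 * ρ - (ρ / α + 1) = (r₂ * (α - 1 / 2) - 1 / 2) / α := by
        rw [hρ]; field_simp; ring
      rw [this]
      exact div_nonneg (by linarith) hα.le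
    simp only [stepRate, costRate, if_neg (not_lt.2 hb.le), if_pos hb]
    rw [Finset.sum_add_distrib, add_mul]
    refine add_le_add ?_ ?_
    · calc _ ≤ ∑ j ∈ Finset.Icc 1 n, (j : ℝ) ^ r₂ * Real.log ((n : ℝ) + 1) ^ 2 := by
            refine Finset.sum_le_sum fun j hj => ?_
            have hj1 : (1 : ℝ) ≤ j := by exact_mod_cast (Finset.mem_Icc.1 hj).1
            have hjn : (j : ℝ) ≤ n := by exact_mod_cast (Finset.mem_Icc.1 hj).2
            have := Real.log_nonneg (by linarith : (1 : ℝ) ≤ j + 1)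
            gcongr
        _ ≤ c₂ * (n : ℝ) ^ (2 * ρ) * Real.log ((n : ℝ) + 1) ^ 2 := by
            rw [← Finset.sum_mul]
            gcongr
            exact h₂ n
        _ = _ := by ring
    · calc _ ≤ c₁ * (n : ℝ) ^ (2 * ρ) := (h₁ n).trans (mul_le_mul_of_nonneg_left
            (Real.rpow_le_rpow_of_exponent_le hn' hle) hc₁.le)
        _ = c₁ / Real.log 2 ^ 2 * ((n : ℝ) ^ (2 * ρ) * Real.log 2 ^ 2) := by field_simp
        _ ≤ _ := by gcongr
  · rw [min_eq_right hb.le] at hr hβα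
    refine ⟨c₂ + c₁, by positivity, fun n hn => ?_⟩
    have hn' : (1 : ℝ) ≤ n := by exact_mod_cast hn
    have hle : ρ / α + 1 ≤ 2 * ρ := by
      rw [← sub_nonneg]
      have : 2 * ρ - (ρ / α + 1) = (r₂ * (α - 1 / 2) - 1 / 2) / α := by
        rw [hρ]; field_simp; ring
      rw [this]
      exact div_nonneg (by linarith) hα.le
    simp only [stepRate, costRate, if_pos hb]
    rw [Finset.sum_add_distrib, add_mul]
    have g1 := (h₁ n).trans (mul_le_mul_of_nonneg_left
      (Real.rpow_le_rpow_of_exponent_le hn' hle) hc₁.le)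
    linarith [h₂ n]

end

/-- If the moments `E[(1 + ‖X_j‖) ^ p]` are bounded, and the costs `g j x` grow at most like
`(1 + ‖x‖) ^ p` in `x`, the mean costs add up. -/
lemma lintegral_ofReal_sum_le {E Ω : Type*} [NormedAddCommGroup E] [MeasurableSpace Ω]
    {P : Measure Ω} {p D : ℝ} {X : ℕ → Ω → E} (hX : ∀ j, AEStronglyMeasurable (X j) P)
    (hD : 0 ≤ D) (hmom : ∀ j, ∫⁻ ω, ENNReal.ofReal ((1 + ‖X j ω‖) ^ p) ∂P ≤ ENNReal.ofReal D)
    {g : ℕ → E → ℝ} {a : ℕ → ℝ} (ha : ∀ j, 1 ≤ j → 0 ≤ a j)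
    (hg : ∀ j, 1 ≤ j → ∀ x, g j x ≤ a j * (1 + ‖x‖) ^ p) (n : ℕ) :
    ∫⁻ ω, ENNReal.ofReal (∑ j ∈ Finset.Icc 1 n, g j (X (j - 1) ω)) ∂P
      ≤ ENNReal.ofReal (D * ∑ j ∈ Finset.Icc 1 n, a j) := by
  calc _ ≤ ∫⁻ ω, ∑ j ∈ Finset.Icc 1 n,
        ENNReal.ofReal (a j) * ENNReal.ofReal ((1 + ‖X (j - 1) ω‖) ^ p) ∂P := by
        refine lintegral_mono fun ω => ?_
        have h0 : ∀ j ∈ Finset.Icc 1 n, 0 ≤ a j * (1 + ‖X (j - 1) ω‖) ^ p := fun j hj =>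
          mul_nonneg (ha j (Finset.mem_Icc.1 hj).1) (by positivity)
        refine (ENNReal.ofReal_le_ofReal (Finset.sum_le_sum fun j hj =>
          hg j (Finset.mem_Icc.1 hj).1 (X (j - 1) ω))).trans_eq ?_
        rw [ENNReal.ofReal_sum_of_nonneg h0]
        exact Finset.sum_congr rfl fun j hj =>
          ENNReal.ofReal_mul (ha j (Finset.mem_Icc.1 hj).1)
    _ = ∑ j ∈ Finset.Icc 1 n, ENNReal.ofReal (a j)
        * ∫⁻ ω, ENNReal.ofReal ((1 + ‖X (j - 1) ω‖) ^ p) ∂P := by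
        have hm : ∀ j, AEMeasurable (fun ω => ENNReal.ofReal ((1 + ‖X j ω‖) ^ p)) P := fun j =>
          (((hX j).norm.aemeasurable.const_add 1).pow_const p).ennreal_ofReal
        rw [lintegral_finsetSum' _ fun j _ => (hm (j - 1)).const_mul _]
        exact Finset.sum_congr rfl fun j _ => lintegral_const_mul'' _ (hm (j - 1))
    _ ≤ ∑ j ∈ Finset.Icc 1 n, ENNReal.ofReal (a j) * ENNReal.ofReal D := by
        gcongr with j _
        exact hmom _
    _ = _ := by
        rw [mul_comm, ENNReal.ofReal_mul' hD, ENNReal.ofReal_sum_of_nonneg fun j hj =>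
          ha j (Finset.mem_Icc.1 hj).1, Finset.sum_mul]

/-! ### Rates for the multilevel algorithm -/

lemma exists_lintegral_rpow_le {E Ω : Type*} [NormedAddCommGroup E] [MeasurableSpace Ω]
    {P : Measure Ω} [IsProbabilityMeasure P] {p : ℝ} {X : ℕ → Ω → E} (hp : 1 ≤ p) (θstar : E)
    (hX : ∀ n, MemLp (fun ω => X n ω - θstar) (ENNReal.ofReal p) P) {D : ℝ}
    (hXD : ∀ n, lpNorm (fun ω => X n ω - θstar) (ENNReal.ofReal p) P ≤ D) :
    ∃ D' : ℝ, 0 < D' ∧ ∀ n,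
      ∫⁻ ω, ENNReal.ofReal ((1 + ‖X n ω‖) ^ p) ∂P ≤ ENNReal.ofReal D' := by
  have hp0 : 0 < p := by linarith
  have hp1 : (1 : ℝ≥0∞) ≤ ENNReal.ofReal p := by rwa [ENNReal.one_le_ofReal]
  have hD : 0 ≤ D := lpNorm_nonneg.trans (hXD 0)
  refine ⟨(D + (1 + ‖θstar‖)) ^ p, by positivity, fun n => ?_⟩
  have hXm : AEStronglyMeasurable (X n) P := by
    simpa using (hX n).1.add_const θstar
  have hm : AEStronglyMeasurable (fun ω => 1 + ‖X n ω‖) P := hXm.norm.const_add 1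
  have hbd : ∀ ω, ‖1 + ‖X n ω‖‖ ≤ 1 * ‖X n ω - θstar‖ + (1 + ‖θstar‖) := fun ω => by
    rw [Real.norm_of_nonneg (by positivity), one_mul]
    have := norm_add_le (X n ω - θstar) θstar
    rw [sub_add_cancel] at this
    linarith
  have hle := lpNorm_le_of_norm_le hp1 (hX n) zero_le_one (by positivity) hbd
  have hmem : MemLp (fun ω => 1 + ‖X n ω‖) (ENNReal.ofReal p) P :=
    (((hX n).norm.const_mul 1).add (memLp_const (1 + ‖θstar‖))).of_le hm
      (Filter.Eventually.of_forall fun ω => (hbd ω).trans (le_abs_self _))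
  have hint := MemLp.integrable_rpow hp0 hmem
  have e : ∀ ω, ‖1 + ‖X n ω‖‖ ^ p = (1 + ‖X n ω‖) ^ p := fun ω => by
    rw [Real.norm_of_nonneg (by positivity)]
  have h2 := lpNorm_rpow hp0 hm
  simp only [e] at hint h2
  rw [← ofReal_integral_eq_lintegral_ofReal hint
    (Filter.Eventually.of_forall fun ω => by simp only [Pi.zero_apply]; positivity), ← h2]
  refine ENNReal.ofReal_le_ofReal (Real.rpow_le_rpow lpNorm_nonneg (hle.trans ?_) hp0.le)
  rw [one_mul]
  gcongr
  exact hXD n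

end MultilevelSA

open MultilevelSA in
theorem theorem3p2
    -- `E` is `ℝ^d` with an arbitrary scalar product
    {E : Type*} [NormedAddCommGroup E] [InnerProductSpace ℝ E] [FiniteDimensional ℝ E]
    [MeasurableSpace E] [BorelSpace E]
    {Ω 𝒰 : Type*} [MeasurableSpace Ω] [MeasurableSpace 𝒰]
    (P : Measure Ω) [IsProbabilityMeasure P]
    (p : ℝ) (hp : 2 ≤ p)
    (U : Ω → 𝒰) (hU : Measurable U)
    (F : E → 𝒰 → E) (hF : Measurable (fun x : E × 𝒰 => F x.1 x.2))
    (hFint : ∀ θ, Integrable (fun ω => F θ (U ω)) P)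
    (θstar : E) (hzero : ∀ θ, MultilevelSA.meanField P U F θ = 0 ↔ θ = θstar)
    (Fk : ℕ → E → 𝒰 → E) (hFk0 : ∀ θ u, Fk 0 θ u = 0)
    (hFk : ∀ k, 1 ≤ k → Measurable (fun x : E × 𝒰 => Fk k x.1 x.2))
    (hFkint : ∀ k, 1 ≤ k → ∀ θ, Integrable (fun ω => Fk k θ (U ω)) P)
    (C : ℕ → ℝ) (hC : ∀ k, 1 ≤ k → 0 < C k)
    -- `V n k l`, `n, k, l ≥ 1`, are independent copies of `U`
    (V : ℕ → ℕ → ℕ → Ω → 𝒰)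
    (hVmeas : ∀ n k l, 1 ≤ n → 1 ≤ k → 1 ≤ l → Measurable (V n k l))
    (hVlaw : ∀ n k l, 1 ≤ n → 1 ≤ k → 1 ≤ l → IdentDistrib (V n k l) U P P)
    (hVindep : iIndepFun (fun i : ℕ × ℕ × ℕ => V (i.1 + 1) (i.2.1 + 1) (i.2.2 + 1)) P)
    (lam : ℝ) (hB1 : MultilevelSA.FieldAssumption (MultilevelSA.meanField P U F) θstar lam)
    (A : MultilevelSA.Params E)
    (hC1 : MultilevelSA.LevelAssumption P U p F Fk C A)
    (hC2 : MultilevelSA.GrowthAssumption p A)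
    (θ₀ : E)
    (q : ℝ) (hq : p / (1 + lam) ≤ q) (hqp : q < p)
    (γ₀ σ₀ ε₀ b₀ r₁ r₂ r₃ ρ : ℝ)
    (hγ₀ : 0 < γ₀) (hσ₀ : 0 < σ₀) (hε₀ : 0 < ε₀) (hb₀ : 0 < b₀)
    (hr₁ : 0 < r₁) (hr₁' : r₁ < 1) (hr₂ : -r₁ < r₂) (hr₃ : r₂ / 2 ≤ r₃)
    (hr : (1 + r₂) / (r₁ + r₂) ≤ p / q)
    (hρ : ρ = (1 + r₂) / 2)
    (hγ : ∀ n : ℕ, 1 ≤ n → A.γ n = γ₀ * (1 / (n : ℝ) ^ r₁))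
    (hε : ∀ n : ℕ, 1 ≤ n → A.ε n = ε₀ * (1 / (n : ℝ) ^ ρ))
    (hσ : ∀ n : ℕ, 1 ≤ n → 0 < A.σ n ∧ A.σ n ^ 2 = σ₀ ^ 2 * (1 / (n : ℝ) ^ r₂))
    (b : ℕ → ℝ) (hb : ∀ n : ℕ, 1 ≤ n → b n = b₀ * (n : ℝ) ^ r₃) :
    (1 ≤ q ∨ (1 + r₂) / (r₁ + r₂) ≤ p → ∃ κ : ℝ, 0 < κ ∧ ∀ n : ℕ, 1 ≤ n →
      eLpNorm (fun ω => MultilevelSA.polyakRuppert A Fk V θ₀ b n ω - θstar) (ENNReal.ofReal q) P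
        ≤ ENNReal.ofReal (κ * (n : ℝ) ^ (-ρ))) ∧
    (min A.β (1 / 2) < A.α → min A.β (1 / 2) / (A.α - min A.β (1 / 2)) ≤ r₂ →
      ∃ κ' : ℝ, 0 < κ' ∧ ∀ n : ℕ, 1 ≤ n →
        MultilevelSA.meanCost P A Fk C V θ₀ n
          ≤ ENNReal.ofReal (κ' * MultilevelSA.costRate A.α A.β ρ n)) := by
  have hp0 : 0 < p := by linarith
  obtain ⟨hlam, L, L', L'', hL, hL', hL'', H, hfield⟩ := hB1
  have hFk' : ∀ k, Measurable (fun x : E × 𝒰 => Fk k x.1 x.2) := by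
    intro k
    rcases Nat.eq_zero_or_pos k with rfl | hk
    · simp only [hFk0]; exact measurable_const
    · exact hFk k hk
  have hFkint' : ∀ k, ∀ θ, Integrable (fun ω => Fk k θ (U ω)) P := by
    intro k θ
    rcases Nat.eq_zero_or_pos k with rfl | hk
    · simp only [hFk0]; exact integrable_zero _ _ _
    · exact hFkint k hk θ
  have hr₂1 : -1 < r₂ := by linarith
  have hs : 0 < r₁ + r₂ := by linarith
  have hρ0 : 0 < ρ := by rw [hρ]; linarith
  have hγ' : ∀ n : ℕ, A.γ (n + 1) = γ₀ * ((n : ℝ) + 1) ^ (-r₁) := fun n => by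
    rw [hγ (n + 1) (by omega), Real.rpow_neg (by positivity), one_div]; push_cast; rfl
  have hε' : ∀ n : ℕ, A.ε (n + 1) = ε₀ * ((n : ℝ) + 1) ^ (-((1 + r₂) / 2)) := fun n => by
    rw [hε (n + 1) (by omega), Real.rpow_neg (by positivity), one_div, hρ]; push_cast; rfl
  have hσ' : ∀ n : ℕ, A.σ (n + 1) ^ 2 = σ₀ ^ 2 * ((n : ℝ) + 1) ^ (-r₂) := fun n => by
    rw [(hσ (n + 1) (by omega)).2, Real.rpow_neg (by positivity), one_div]; push_cast; rfl
  have hεpos : ∀ n, 0 < A.ε (n + 1) := fun n => by rw [hε']; positivity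
  obtain ⟨B, N, c, hc, hS, hBle, hNle⟩ := exists_perturbedScheme hp hU hF hFint hC1 hFk0 hFk'
    hFkint' hVmeas hVlaw hVindep hεpos (fun n => (hσ (n + 1) (by omega)).1) θ₀ θstar
  set f : E → E := fun x => meanField P U F (θstar + x) with hf
  set X : ℕ → Ω → E := fun n ω => robbinsMonro A Fk V θ₀ n ω - θstar with hX
  have hfield' : ∀ x : E, inner ℝ x (f x) ≤ -L * ‖x‖ ^ 2 ∧ inner ℝ x (f x) ≤ -L' * ‖f x‖ ^ 2 ∧
      ‖f x - H x‖ ≤ L'' * ‖x‖ ^ (1 + lam) := fun x => by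
    have := hfield (θstar + x)
    rwa [add_sub_cancel_left] at this
  have h1 := fun x => (hfield' x).1
  have h2 := fun x => (hfield' x).2.1
  have h3 := fun x => (hfield' x).2.2
  have hXL : ∀ n, MemLp (X n) (ENNReal.ofReal p) P := hS.memLp_X hL' h2 hBle
  have hNle' : ∀ n : ℕ, lpNorm (N (n + 1)) (ENNReal.ofReal p) P ^ 2
      ≤ c ^ 2 * σ₀ ^ 2 * ((n : ℝ) + 1) ^ (-r₂) := fun n => by
    calc _ ≤ (c * A.σ (n + 1)) ^ 2 := pow_le_pow_left₀ lpNorm_nonneg (hNle n) 2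
      _ = _ := by rw [mul_pow, hσ', mul_assoc]
  have hε2 : ∀ n : ℕ, A.ε (n + 1) ^ 2 ≤ ε₀ ^ 2 * ((n : ℝ) + 1) ^ (-(r₁ + r₂)) := fun n => by
    rw [hε', mul_pow, ← Real.rpow_natCast (_ ^ _), ← Real.rpow_mul (by positivity)]
    gcongr
    · linarith [Nat.cast_nonneg (α := ℝ) n]
    · push_cast; linarith
  obtain ⟨D, hD, hXD⟩ := hS.exists_lpNorm_sq_le hp hL hL' h1 h2 hBle hγ₀ hr₁ hr₁' hs hγ'
    (by positivity) (by positivity) hε2 hNle'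
  have hXD' : ∀ n : ℕ, 1 ≤ n →
      lpNorm (X n) (ENNReal.ofReal p) P ≤ Real.sqrt D * (n : ℝ) ^ (-((r₁ + r₂) / 2)) := by
    intro n hn
    refine abs_le_of_sq_le_sq' ?_ (by positivity) |>.2
    refine (hXD n hn).trans_eq ?_
    rw [mul_pow, Real.sq_sqrt hD.le, ← Real.rpow_natCast (_ ^ _), ← Real.rpow_mul (by positivity)]
    congr 2; push_cast; ring
  constructor
  · intro hcase
    obtain ⟨cH, hcH, hH⟩ := exists_norm_le_mul_norm_apply hL hlam h1 h3
    have main : ∀ q' : ℝ, 1 ≤ q' → q' < p → p / (1 + lam) ≤ q' → (1 + r₂) / (r₁ + r₂) ≤ p / q' →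
        ∃ κ : ℝ, 0 < κ ∧ ∀ n : ℕ, 1 ≤ n →
          eLpNorm (fun ω => polyakRuppert A Fk V θ₀ b n ω - θstar) (ENNReal.ofReal q') P
            ≤ ENNReal.ofReal (κ * (n : ℝ) ^ (-ρ)) := by
      intro q' hq1 hqp' hqlam hrq
      have hq0' : 0 < q' := by linarith
      have hs1 : 1 ≤ p / q' := by rw [le_div_iff₀ hq0']; linarith
      have hs2 : p / q' ≤ 1 + lam := by
        rw [div_le_iff₀ hq0']; rw [div_le_iff₀ (by linarith)] at hqlam; linarith
      have hrem : ∀ x, ‖f x - H x‖ ≤ ((1 / L' + ‖H‖) + L'') * ‖x‖ ^ (p / q') := fun x => by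
        refine norm_sub_le_rpow (by positivity) hL''.le hs1 hs2 ?_ (h3 x)
        calc ‖f x - H x‖ ≤ ‖f x‖ + ‖H x‖ := norm_sub_le _ _
          _ ≤ 1 / L' * ‖x‖ + ‖H‖ * ‖x‖ := add_le_add (norm_le_of_inner_le hL' (h2 x)) (H.le_opNorm x)
          _ = _ := by ring
      have hrate : (1 + r₂) / 2 ≤ (r₁ + r₂) / 2 * (p / q') := by
        rw [div_le_iff₀ hs] at hrq; linarith
      obtain ⟨κ, hκ, hsum⟩ := hS.exists_lpNorm_sum_le hp hcH hH hq1 hqp'.le (by positivity) hrem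
        hBle hXL hγ₀ hr₁ hr₁' hs hr₃ hrate hγ' (Real.sqrt_nonneg D) hε₀.le (by positivity) hXD'
        (fun n => (hε' n).le) hNle'
      obtain ⟨c', hc', hlow⟩ := exists_le_sum_rpow (a := r₃) (by linarith)
      refine ⟨κ / c', by positivity, fun n hn => ?_⟩
      have hn0 : (0 : ℝ) < n := by exact_mod_cast hn
      set S : ℝ := ∑ k ∈ Finset.Icc 1 n, (k : ℝ) ^ r₃ with hSdef
      have hSlow := hlow n
      have hS0 : 0 < S := lt_of_lt_of_le (by positivity) hSlow
      have hb' : ∀ k ∈ Finset.Icc 1 n, b k = b₀ * (k : ℝ) ^ r₃ := fun k hk =>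
        hb k (Finset.mem_Icc.1 hk).1
      have hfun : (fun ω => polyakRuppert A Fk V θ₀ b n ω - θstar)
          = S⁻¹ • fun ω => ∑ k ∈ Finset.Icc 1 n, (k : ℝ) ^ r₃ • X k ω := by
        funext ω
        have e1 : ∑ k ∈ Finset.Icc 1 n, b k = b₀ * S := by
          rw [Finset.sum_congr rfl hb', Finset.mul_sum]
        have e2 : ∑ k ∈ Finset.Icc 1 n, b k • robbinsMonro A Fk V θ₀ k ω
            = b₀ • ∑ k ∈ Finset.Icc 1 n, (k : ℝ) ^ r₃ • robbinsMonro A Fk V θ₀ k ω := by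
          rw [Finset.smul_sum]
          exact Finset.sum_congr rfl fun k hk => by rw [hb' k hk, mul_smul]
        simp only [polyakRuppert, Pi.smul_apply, hX, smul_sub, Finset.sum_sub_distrib]
        rw [e1, e2, ← Finset.sum_smul, ← hSdef, smul_smul, smul_smul, inv_mul_cancel₀ hS0.ne',
          one_smul, one_div, mul_inv, mul_comm b₀⁻¹, mul_assoc, inv_mul_cancel₀ hb₀.ne', mul_one]
      have hmem : MemLp (fun ω => ∑ k ∈ Finset.Icc 1 n, (k : ℝ) ^ r₃ • X k ω)
          (ENNReal.ofReal q') P :=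
        memLp_finsetSum _ fun k _ => ((hXL k).mono_exponent
          (ENNReal.ofReal_le_ofReal hqp'.le)).const_smul _
      rw [hfun, ← ofReal_lpNorm (hmem.const_smul _), lpNorm_const_smul_eq, abs_of_pos (by positivity)]
      refine ENNReal.ofReal_le_ofReal ?_
      have hpow : (n : ℝ) ^ (r₃ + 1 - (1 + r₂) / 2) = (n : ℝ) ^ (r₃ + 1) * (n : ℝ) ^ (-ρ) := by
        rw [← Real.rpow_add hn0, hρ]; ring_nf
      calc _ ≤ (c' * (n : ℝ) ^ (r₃ + 1))⁻¹ * (κ * (n : ℝ) ^ (r₃ + 1 - (1 + r₂) / 2)) := by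
            gcongr
            · exact lpNorm_nonneg
            · exact hsum n hn
        _ = _ := by
            rw [hpow]
            have : (n : ℝ) ^ (r₃ + 1) ≠ 0 := by positivity
            field_simp
    -- for `q < 1` the second alternative allows to use the bound for the first moment
    rcases le_or_gt 1 q with hq1 | hq1
    · exact main q hq1 hqp hq hr
    · have hcase' : (1 + r₂) / (r₁ + r₂) ≤ p / 1 := by
        rw [div_one]
        exact hcase.resolve_left (not_le.2 hq1)
      obtain ⟨κ, hκ, h⟩ := main 1 le_rfl (by linarith) (hq.trans hq1.le) hcase'
      refine ⟨κ, hκ, fun n hn => le_trans ?_ (h n hn)⟩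
      refine eLpNorm_le_eLpNorm_of_exponent_le (ENNReal.ofReal_le_ofReal hq1.le) ?_
      have hθm : ∀ k, AEStronglyMeasurable (robbinsMonro A Fk V θ₀ k) P := fun k => by
        simpa [hX] using (hXL k).1.add_const θstar
      have : AEStronglyMeasurable (fun ω => ∑ k ∈ Finset.Icc 1 n, b k • robbinsMonro A Fk V θ₀ k ω) P :=
        Finset.aestronglyMeasurable_fun_sum _ fun k _ => (hθm k).const_smul (b k)
      exact (this.const_smul _).sub aestronglyMeasurable_const
  · intro hβα hr'
    obtain ⟨K₁, β₁, hK₁, hβ₁, hβ₁', hβ₁'', hgrowth⟩ := hC2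
    obtain ⟨K, hK, hCK⟩ := hC1.cost
    have hM := hC1.one_lt_M
    have hα := hC1.α_pos
    obtain ⟨G, hG, hlev⟩ := exists_rpow_maxLevel_le hM hα hp0 hK₁ hε₀ hρ0 hC1.Γ₂_pos
      (fun θ => (hgrowth θ).2) hε
    obtain ⟨c₁, hc₁, hrep⟩ := exists_sq_mul_levelWeight_sq_le (r₂ := r₂) hM hα hp0 hK₁ hβ₁' hβ₁'' hσ₀
      hρ0 hC1.Γ₁_pos (fun θ => (hgrowth θ).1) hσ hG hlev
    obtain ⟨c₂, hc₂, hcost⟩ := exists_sum_numIter_mul_le hM hK hC hCK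
    obtain ⟨c₃, hc₃, hsum⟩ := exists_sum_stepRate_le hα hr₂1 hρ hC1.β_pos hβα hr'
    obtain ⟨D', hD', hmom⟩ := exists_lintegral_rpow_le (X := robbinsMonro A Fk V θ₀)
      (D := max (Real.sqrt D) (lpNorm (X 0) (ENNReal.ofReal p) P)) (by linarith : 1 ≤ p) θstar hXL
      (by
        intro n
        rcases Nat.eq_zero_or_pos n with rfl | hn
        · exact le_max_right _ _
        · refine ((hXD' n hn).trans ?_).trans (le_max_left _ _)
          refine mul_le_of_le_one_right (Real.sqrt_nonneg D)
            (Real.rpow_le_one_of_one_le_of_nonpos (by exact_mod_cast hn) (by linarith)))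
    have hθm : ∀ k, AEStronglyMeasurable (robbinsMonro A Fk V θ₀ k) P := fun k => by
      simpa [hX] using (hXL k).1.add_const θstar
    have hrate0 : ∀ j : ℕ, 0 ≤ stepRate A.α A.β r₂ ρ j := fun j => by
      unfold stepRate; split_ifs <;> positivity
    refine ⟨D' * (c₂ * (c₁ + G)) * c₃, by positivity, fun n hn => ?_⟩
    have hbound := lintegral_ofReal_sum_le (X := robbinsMonro A Fk V θ₀) hθm hD'.le hmom
      (g := fun j θ => ∑ k ∈ Finset.Icc 1 (maxLevel A j θ), (numIter A j k θ : ℝ) * C k)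
      (a := fun j => c₂ * (c₁ + G) * (stepRate A.α A.β r₂ ρ j + (j : ℝ) ^ (ρ / A.α)))
      (fun j _ => mul_nonneg (by positivity) (add_nonneg (hrate0 j) (by positivity)))
      (fun j hj θ => by
        have g1 := hrep j hj θ
        have g2 := hlev j hj θ
        have g3 : 0 ≤ (1 + ‖θ‖) ^ p := by positivity
        have g4 : 0 ≤ (j : ℝ) ^ (ρ / A.α) := by positivity
        calc _ ≤ c₂ * (c₁ * (stepRate A.α A.β r₂ ρ j * (1 + ‖θ‖) ^ p)
              + G * ((1 + ‖θ‖) ^ p * (j : ℝ) ^ (ρ / A.α))) := by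
              refine (hcost j θ).trans ?_
              gcongr
          _ ≤ _ := by
              have := mul_nonneg (mul_nonneg hc₁.le g4) g3
              have := mul_nonneg (mul_nonneg (by linarith : 0 ≤ G) (hrate0 j)) g3
              rw [mul_assoc c₂, mul_assoc c₂]
              gcongr
              linarith) n
    refine hbound.trans (ENNReal.ofReal_le_ofReal ?_)
    rw [← Finset.mul_sum]
    calc _ ≤ D' * (c₂ * (c₁ + G) * (c₃ * costRate A.α A.β ρ n)) := by
          gcongr
          exact hsum n hn
      _ = _ := by ring
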